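/- **Setting.** Let $X_1\in\mathbb R^{d_1}$, $X_2\in\mathbb R^{d_2}$ with $\mathbb E\|X_2\|^2<\infty$, and let $L\in\{0,\dots,p\}$ be a class label, $p<d_2$, with one-hot encoding $Y=(\mathbf 1_{L=0},\dots,\mathbf 1_{L=p-1})\in\mathbb R^p$ (the last class is left out). Put $m(X_1)=\mathbb E[Y\mid X_1]$ and $X=\psi^*(X_1)=\mathbb E[X_2\mid X_1]$. Let $C^h:\mathbb R^{d_1}\to\mathbb R^{d_2\times p}$ be any measurable encoding function with $C^h(X_1)$ integrable and $X=C^h(X_1)\,m(X_1)$ almost surely (for instance, one with $\mathbb E[X_2\mid X_1,Y]=C^h(X_1)Y$), and let $\widetilde C=\mathbb E[C^h(X_1)]$. For $s\ge 0$ with $p+s\le d_2$ let $$\varepsilon_s=\min_{B,g}\frac1{d_2}\,\mathbb E\big\|X-(\widetilde C+B\,g(X_1))\,m(X_1)\big\|^2,$$ over $B\in\mathbb R^{d_2\times s}$ and measurable $g:\mathbb R^{d_1}\to\mathbb R^{s\times p}$; let $(B^*,g^*)$ be any minimizer, $\widetilde X=(\widetilde C+B^*g^*(X_1))\,m(X_1)$,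 $\bar X=\widetilde X-X$, and let $\Sigma,\widetilde\Sigma,\bar\Sigma$ be the covariance matrices of $X,\widetilde X,\bar X$. Fix $y_0\in\mathbb R^p$ and predict the label by $\beta X+b(\beta)$, $\beta\in\mathbb R^{p\times d_2}$, with intercept $b(\beta)=y_0-\beta\,\mathbb E[X]$. (For $y_0=\mathbb E[Y]$ this is $b(\beta)=\mathbb E[Y]-\beta\,\mathbb E[X_2]$; for $y_0=0$ and $\mathbb E[X]=0$ there is no intercept.) Put $\mathrm{error}_{\mathrm{apx}}(\beta)=\mathbb E\|m(X_1)-\beta X-b(\beta)\|^2$ and $\mathrm{error}^*_{\mathrm{apx}}=\min_\beta\mathrm{error}_{\mathrm{apx}}(\beta)$, let $\beta^*$ be a minimizer, and put $a=m(X_1)-\beta^*X-b(\beta^*)$. Given $n\ge1$ independent copies $(X_1^{(i)},Y^{(i)})$ of $(X_1,Y)$, an OLS estimator is any minimizer $\hat\beta_0$ of $\frac1n\sum_{i=1}^n\|Y^{(i)}-\beta\,\psi^*(X_1^{(i)})-b(\beta)\|^2$. Its excess risk is $\mathcal R(\hat\beta_0)=\mathrm{error}_{\mathrm{apx}}(\hat\beta_0)$.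 A random vector $Z$ is $v$-sub-Gaussian if $\mathbb E Z=0$ and $\mathbb E e^{t u^\top Z}\le e^{t^2v/2}$ for all $t\in\mathbb R$ and all unit vectors $u$. Norms of matrices are Frobenius norms, $\lambda_{\max}$ is the largest eigenvalue, $\lambda_{\min\ne0}$ the smallest nonzero eigenvalue, and inverse square roots of covariance matrices are generalized inverses. **Assumptions.** For constants $\sigma>0$ and $\rho,\tilde b,\bar b,c_1,c_2\ge0$: 1. $Y-m(X_1)$ is $\sigma^2$-sub-Gaussian, and $\widetilde\Sigma^{-1/2}(\widetilde X-\mathbb E\widetilde X)$ and $\bar\Sigma^{-1/2}(\bar X-\mathbb E\bar X)$ are $\rho^2$-sub-Gaussian. 2. Almost surely $\|\widetilde\Sigma^{-1/2}(\widetilde X-\mathbb E\widetilde X)\,a^\top\|\le\tilde b\sqrt{p+s}$ and $\|\bar\Sigma^{-1/2}(\bar X-\mathbb E\bar X)\,a^\top\|\le\bar b\sqrt{d_2}$. 3. $\lambda_{\max}(\widetilde\Sigma-\Sigma)\le\frac{c_1}{d_2}|\mathrm{tr}(\widetilde\Sigma-\Sigma)|$ and $\lambda_{\max}(\bar\Sigma)\le\frac{c_2}{d_2}\mathrm{tr}(\bar\Sigma)$.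 4. $\mathrm{rank}(\widetilde\Sigma)\le\mathrm{rank}(\Sigma)$ and $\mathrm{rank}(\bar\Sigma)\le\mathrm{rank}(\Sigma)$. **Theorem.** There are an absolute constant $k$, a constant $C_0$ depending only on $c_1,c_2,\lambda_{\min\ne0}(\Sigma)$, and a constant $C_1$ depending only on $c_1,c_2,\lambda_{\min\ne0}(\Sigma),\tilde b/\sigma,\bar b/\sigma$, such that under these assumptions, for every $\delta\in(0,1)$: if $$n\ \ge\ C_0\,(1+\varepsilon_s)^2\rho^4\Big(d_2+\log\frac1\delta\Big),$$ then with probability at least $1-\delta$ every OLS estimator satisfies $$\mathcal R(\hat\beta_0)\ \le\ \mathrm{error}^*_{\mathrm{apx}}+C_1\Big(1+\log\frac{n d_2}{\delta}\Big)^{k}\Big((1+\varepsilon_s)\frac{p+s}{n}\sigma^2+\varepsilon_s\frac{d_2}{n}\sigma^2\Big).$$ If $\varepsilon_s=0$, then already $n\ge C_0\,\rho^4(p+s+\log\frac1\delta)$ implies that with probability at least $1-\delta$ every OLS estimator satisfies $$\mathcal R(\hat\beta_0)\ \le\ \mathrm{error}^*_{\mathrm{apx}}+C_1\Big(1+\log\frac{n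 d_2}{\delta}\Big)^{k}\,\frac{p+s}{n}\sigma^2 .$$ -/

import Mathlib

open MeasureTheory ProbabilityTheory Matrix
open scoped ENNReal NNReal

noncomputable section

namespace SSL

/-! ### Vectors, matrices, moments -/

/-- Squared Euclidean norm of a vector. -/
def sqNorm {d : ℕ} (v : Fin d → ℝ) : ℝ := ∑ i, v i ^ 2

/-- Frobenius norm of a matrix. -/
def frobNorm {a b : ℕ} (A : Matrix (Fin a) (Fin b) ℝ) : ℝ := √(∑ i, ∑ j, A i j ^ 2)

/-- Largest eigenvalue of a symmetric real matrix (of positive size). -/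
def lambdaMax {d : ℕ} (A : Matrix (Fin d) (Fin d) ℝ) : ℝ := sSup (spectrum ℝ A)

/-- Smallest nonzero eigenvalue of a positive semidefinite real matrix
(it is `0` when the matrix is zero). -/
def lambdaMinNeZero {d : ℕ} (A : Matrix (Fin d) (Fin d) ℝ) : ℝ := sInf (spectrum ℝ A \ {0})

variable {Ω : Type*} [MeasurableSpace Ω]

/-- The centred random vector `Z - E[Z]`. -/
def centre {d : ℕ} (μ : Measure Ω) (Z : Ω → Fin d → ℝ) (ω : Ω) : Fin d → ℝ :=
  Z ω - ∫ ω', Z ω' ∂μ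

/-- Covariance matrix of a random vector. -/
def covMatrix {d : ℕ} (μ : Measure Ω) (Z : Ω → Fin d → ℝ) : Matrix (Fin d) (Fin d) ℝ :=
  Matrix.of fun i j => cov[fun ω => Z ω i, fun ω => Z ω j; μ]

theorem covMatrix_isHermitian {d : ℕ} (μ : Measure Ω) (Z : Ω → Fin d → ℝ) :
    (covMatrix μ Z).IsHermitian := by
  ext i j
  simp [covMatrix, Matrix.conjTranspose_apply, covariance_comm]

/-- The whitened vector `Cov(Z)^{-1/2} (Z - E[Z])`; here `Cov(Z)^{-1/2}` is the generalized inverse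
square root, obtained by applying `x ↦ 1/√x` to the nonzero eigenvalues and keeping the zero
ones. -/
def whiten {d : ℕ} (μ : Measure Ω) (Z : Ω → Fin d → ℝ) (ω : Ω) : Fin d → ℝ :=
  ((covMatrix_isHermitian μ Z).cfc fun x => (√x)⁻¹) *ᵥ centre μ Z ω

/-- A random vector is `v`-sub-Gaussian: it has mean zero and `E[exp (t uᵀZ)] ≤ exp (t² v / 2)`
for every real `t` and every unit vector `u` (with the exponential moments finite). -/
def IsSubGaussian {d : ℕ} (μ : Measure Ω) (Z : Ω → Fin d → ℝ) (v : ℝ≥0) : Prop :=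
  Integrable Z μ ∧ ∫ ω, Z ω ∂μ = 0 ∧
    ∀ u : Fin d → ℝ, sqNorm u = 1 → HasSubgaussianMGF (fun ω => u ⬝ᵥ Z ω) v μ

/-! ### The learning problem -/

/-- One-hot encoding of a label in `{0, …, p}`, with the last class left out. -/
def oneHot {p : ℕ} (l : Fin (p + 1)) : Fin p → ℝ := fun j => if l = j.castSucc then 1 else 0

/-- `f` is a version of the regression function `x ↦ E[Z | X₁ = x]`. -/
def IsRegression {d₁ d : ℕ} (μ : Measure Ω) (X₁ : Ω → Fin d₁ → ℝ) (Z : Ω → Fin d → ℝ)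
    (f : (Fin d₁ → ℝ) → Fin d → ℝ) : Prop :=
  Measurable f ∧ (fun ω => f (X₁ ω)) =ᵐ[μ] μ[Z | MeasurableSpace.comap X₁ inferInstance]

/-- A population for reconstructive self-supervised learning: features `X₁`, pretext target `X₂`,
class label `L`; `ψ` is the optimal pretext predictor `E[X₂ | X₁ = ·]`, `m` is the optimal
downstream predictor `E[Y | X₁ = ·]` for the one-hot vector `Y` of `L`. -/
structure IsPopulation {d₁ d₂ p : ℕ} (μ : Measure Ω) (X₁ : Ω → Fin d₁ → ℝ) (X₂ : Ω → Fin d₂ → ℝ)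
    (L : Ω → Fin (p + 1)) (ψ : (Fin d₁ → ℝ) → Fin d₂ → ℝ) (m : (Fin d₁ → ℝ) → Fin p → ℝ) :
    Prop where
  measurable_X₁ : Measurable X₁
  measurable_X₂ : Measurable X₂
  measurable_L : Measurable L
  memLp_X₂ : MemLp X₂ 2 μ
  isRegression_ψ : IsRegression μ X₁ X₂ ψ
  isRegression_m : IsRegression μ X₁ (fun ω => oneHot (L ω)) m

/-- `Ch` is an encoding function: `E[X₂ | X₁] = Ch(X₁) E[Y | X₁]`. By the tower property this holds
for every integrable `Ch` with `E[X₂ | X₁, Y] = Ch(X₁) Y`, and for all functions that differ from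
such a `Ch` by an (integrable) term whose rows are orthogonal to `E[Y | X₁]`. -/
structure IsEncoding {d₁ d₂ p : ℕ} (μ : Measure Ω) (X₁ : Ω → Fin d₁ → ℝ)
    (ψ : (Fin d₁ → ℝ) → Fin d₂ → ℝ) (m : (Fin d₁ → ℝ) → Fin p → ℝ)
    (Ch : (Fin d₁ → ℝ) → Matrix (Fin d₂) (Fin p) ℝ) : Prop where
  measurable : ∀ i j, Measurable fun x => Ch x i j
  integrable : ∀ i j, Integrable (fun ω => Ch (X₁ ω) i j) μ
  eq : ∀ᵐ ω ∂μ, ψ (X₁ ω) = Ch (X₁ ω) *ᵥ m (X₁ ω)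

/-- The mean encoding matrix `E[Ch(X₁)]`. -/
def meanEncoding {d₁ d₂ p : ℕ} (μ : Measure Ω) (X₁ : Ω → Fin d₁ → ℝ)
    (Ch : (Fin d₁ → ℝ) → Matrix (Fin d₂) (Fin p) ℝ) : Matrix (Fin d₂) (Fin p) ℝ :=
  Matrix.of fun i j => ∫ ω, Ch (X₁ ω) i j ∂μ

/-- The low-rank vector `(Ct + B g(X₁)) E[Y | X₁]`. -/
def lowRank {d₁ d₂ p s : ℕ} (X₁ : Ω → Fin d₁ → ℝ) (m : (Fin d₁ → ℝ) → Fin p → ℝ)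
    (Ct : Matrix (Fin d₂) (Fin p) ℝ) (B : Matrix (Fin d₂) (Fin s) ℝ)
    (g : (Fin d₁ → ℝ) → Matrix (Fin s) (Fin p) ℝ) (ω : Ω) : Fin d₂ → ℝ :=
  (Ct + B * g (X₁ ω)) *ᵥ m (X₁ ω)

/-- `E ‖X - (Ct + B g(X₁)) E[Y | X₁]‖²`, in `[0, ∞]`, for `X = ψ(X₁)`. -/
def lowRankError {d₁ d₂ p s : ℕ} (μ : Measure Ω) (X₁ : Ω → Fin d₁ → ℝ)
    (ψ : (Fin d₁ → ℝ) → Fin d₂ → ℝ) (m : (Fin d₁ → ℝ) → Fin p → ℝ)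
    (Ct : Matrix (Fin d₂) (Fin p) ℝ) (B : Matrix (Fin d₂) (Fin s) ℝ)
    (g : (Fin d₁ → ℝ) → Matrix (Fin s) (Fin p) ℝ) : ℝ≥0∞ :=
  ∫⁻ ω, ENNReal.ofReal (sqNorm (ψ (X₁ ω) - lowRank X₁ m Ct B g ω)) ∂μ

/-- The smallest value of `lowRankError` over all matrices `B` with `s` columns and all measurable
functions `g`. -/
def minLowRankError {d₁ d₂ p : ℕ} (s : ℕ) (μ : Measure Ω) (X₁ : Ω → Fin d₁ → ℝ)
    (ψ : (Fin d₁ → ℝ) → Fin d₂ → ℝ) (m : (Fin d₁ → ℝ) → Fin p → ℝ)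
    (Ct : Matrix (Fin d₂) (Fin p) ℝ) : ℝ≥0∞ :=
  ⨅ (B : Matrix (Fin d₂) (Fin s) ℝ) (g : (Fin d₁ → ℝ) → Matrix (Fin s) (Fin p) ℝ)
    (_ : ∀ i j, Measurable fun x => g x i j), lowRankError μ X₁ ψ m Ct B g

/-- The low-rank approximation level `ε_s`. -/
def epsLevel {d₁ d₂ p : ℕ} (s : ℕ) (μ : Measure Ω) (X₁ : Ω → Fin d₁ → ℝ)
    (ψ : (Fin d₁ → ℝ) → Fin d₂ → ℝ) (m : (Fin d₁ → ℝ) → Fin p → ℝ)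
    (Ct : Matrix (Fin d₂) (Fin p) ℝ) : ℝ :=
  1 / (d₂ : ℝ) * (minLowRankError s μ X₁ ψ m Ct).toReal

/-- `(B, g)` attains the minimum in the definition of `ε_s`. -/
def IsLowRankMinimizer {d₁ d₂ p s : ℕ} (μ : Measure Ω) (X₁ : Ω → Fin d₁ → ℝ)
    (ψ : (Fin d₁ → ℝ) → Fin d₂ → ℝ) (m : (Fin d₁ → ℝ) → Fin p → ℝ)
    (Ct : Matrix (Fin d₂) (Fin p) ℝ) (B : Matrix (Fin d₂) (Fin s) ℝ)
    (g : (Fin d₁ → ℝ) → Matrix (Fin s) (Fin p) ℝ) : Prop :=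
  (∀ i j, Measurable fun x => g x i j) ∧
    lowRankError μ X₁ ψ m Ct B g = minLowRankError s μ X₁ ψ m Ct

/-- The downstream residual `E[Y | X₁] - (β X + b(β))`, with `X = ψ(X₁)` and intercept
`b(β) = y₀ - β E[X]`. For `y₀ = E[Y]` this is the population intercept `E[Y] - β E[X₂]`; for
`y₀ = 0` and `E[X] = 0` there is no intercept at all. -/
def residual {d₁ d₂ p : ℕ} (μ : Measure Ω) (X₁ : Ω → Fin d₁ → ℝ)
    (ψ : (Fin d₁ → ℝ) → Fin d₂ → ℝ) (m : (Fin d₁ → ℝ) → Fin p → ℝ) (y₀ : Fin p → ℝ)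
    (β : Matrix (Fin p) (Fin d₂) ℝ) (ω : Ω) : Fin p → ℝ :=
  m (X₁ ω) - y₀ - β *ᵥ centre μ (fun ω' => ψ (X₁ ω')) ω

/-- The approximation error of a linear map `β`. For an estimator it is the excess risk. -/
def errApx {d₁ d₂ p : ℕ} (μ : Measure Ω) (X₁ : Ω → Fin d₁ → ℝ)
    (ψ : (Fin d₁ → ℝ) → Fin d₂ → ℝ) (m : (Fin d₁ → ℝ) → Fin p → ℝ) (y₀ : Fin p → ℝ)
    (β : Matrix (Fin p) (Fin d₂) ℝ) : ℝ :=
  ∫ ω, sqNorm (residual μ X₁ ψ m y₀ β ω) ∂μ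

/-- The least approximation error. -/
def errApxMin {d₁ d₂ p : ℕ} (μ : Measure Ω) (X₁ : Ω → Fin d₁ → ℝ)
    (ψ : (Fin d₁ → ℝ) → Fin d₂ → ℝ) (m : (Fin d₁ → ℝ) → Fin p → ℝ) (y₀ : Fin p → ℝ) : ℝ :=
  ⨅ β : Matrix (Fin p) (Fin d₂) ℝ, errApx μ X₁ ψ m y₀ β

/-- The empirical squared loss of `β` (with intercept `y₀ - β E[X]`) on `n` labelled examples,
given by the values `x i` of `X₁` and the labels `l i`. -/
def empLoss {d₁ d₂ p n : ℕ} (μ : Measure Ω) (X₁ : Ω → Fin d₁ → ℝ)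
    (ψ : (Fin d₁ → ℝ) → Fin d₂ → ℝ) (y₀ : Fin p → ℝ)
    (x : Fin n → Fin d₁ → ℝ) (l : Fin n → Fin (p + 1)) (β : Matrix (Fin p) (Fin d₂) ℝ) : ℝ :=
  1 / (n : ℝ) * ∑ i, sqNorm (oneHot (l i) - y₀ - β *ᵥ (ψ (x i) - ∫ ω, ψ (X₁ ω) ∂μ))

/-- `β` is an ordinary least squares estimator: it minimizes the empirical squared loss. -/
def IsOLS {d₁ d₂ p n : ℕ} (μ : Measure Ω) (X₁ : Ω → Fin d₁ → ℝ)
    (ψ : (Fin d₁ → ℝ) → Fin d₂ → ℝ) (y₀ : Fin p → ℝ)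
    (x : Fin n → Fin d₁ → ℝ) (l : Fin n → Fin (p + 1)) (β : Matrix (Fin p) (Fin d₂) ℝ) : Prop :=
  ∀ β', empLoss μ X₁ ψ y₀ x l β ≤ empLoss μ X₁ ψ y₀ x l β'

/-- `n` labelled examples, independent, each distributed as `(X₁, L)`. -/
def IsLabelledSample {d₁ p n : ℕ} (μ : Measure Ω) (X₁ : Ω → Fin d₁ → ℝ) (L : Ω → Fin (p + 1))
    (x : Fin n → Ω → Fin d₁ → ℝ) (l : Fin n → Ω → Fin (p + 1)) : Prop :=
  iIndepFun (fun i ω => (x i ω, l i ω)) μ ∧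
    ∀ i, IdentDistrib (fun ω => (x i ω, l i ω)) (fun ω => (X₁ ω, L ω)) μ μ

/-! ### The assumptions -/

/-- Sub-Gaussian noise `Y - E[Y | X₁]` and sub-Gaussian whitened vectors `X̃`, `X̃ - X`. -/
structure SubGaussianAssumption {d₁ d₂ p : ℕ} (μ : Measure Ω) (X₁ : Ω → Fin d₁ → ℝ)
    (L : Ω → Fin (p + 1)) (m : (Fin d₁ → ℝ) → Fin p → ℝ) (Xt Xb : Ω → Fin d₂ → ℝ)
    (σ ρ : ℝ≥0) : Prop where
  noise : IsSubGaussian μ (fun ω => oneHot (L ω) - m (X₁ ω)) (σ ^ 2)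
  whiten_tilde : IsSubGaussian μ (whiten μ Xt) (ρ ^ 2)
  whiten_bar : IsSubGaussian μ (whiten μ Xb) (ρ ^ 2)

/-- Boundedness: `‖Σ̃^{-1/2} X̃ aᵀ‖ ≤ bt √(p+s)` and `‖Σ̄^{-1/2} X̄ aᵀ‖ ≤ bb √d₂` almost surely, for
the residual `a`. -/
structure BoundedAssumption {d₂ p : ℕ} (s : ℕ) (μ : Measure Ω) (Xt Xb : Ω → Fin d₂ → ℝ)
    (a : Ω → Fin p → ℝ) (bt bb : ℝ) : Prop where
  tilde : ∀ᵐ ω ∂μ, frobNorm (Matrix.vecMulVec (whiten μ Xt ω) (a ω)) ≤ bt * √((p : ℝ) + s)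
  bar : ∀ᵐ ω ∂μ, frobNorm (Matrix.vecMulVec (whiten μ Xb ω) (a ω)) ≤ bb * √(d₂ : ℝ)

/-- The largest eigenvalue is comparable with the average one, for `Σ̃ - Σ` and for `Σ̄`. -/
structure EigenvalueAssumption {d₂ : ℕ} (S St Sb : Matrix (Fin d₂) (Fin d₂) ℝ) (c₁ c₂ : ℝ) :
    Prop where
  tilde : lambdaMax (St - S) ≤ c₁ * (1 / (d₂ : ℝ)) * |(St - S).trace|
  bar : lambdaMax Sb ≤ c₂ * (1 / (d₂ : ℝ)) * Sb.trace

/-- `rank Σ̃ ≤ rank Σ` and `rank Σ̄ ≤ rank Σ`. -/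
structure RankAssumption {d₂ : ℕ} (S St Sb : Matrix (Fin d₂) (Fin d₂) ℝ) : Prop where
  tilde : St.rank ≤ S.rank
  bar : Sb.rank ≤ S.rank

end SSL

end

/-!
The excess risk exceeds the least approximation error exactly by the squared estimation error
`E ‖(β̂ - β*)(X - E X)‖²`, because the residual `a` of the best linear map is uncorrelated with `X`
(`errApx_eq_errApxMin_add`). Write `D = β̂ - β*`, `V` for the centred `X` and `η = Y - m(X₁)` for
the noise. Comparing the empirical losses of `β̂` and `β*` gives the basic inequality
`∑ᵢ ‖D Vᵢ‖² ≤ 2 ∑ᵢ ⟨ηᵢ + aᵢ, D Vᵢ⟩`.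

The left side is at least `n / 2` times the squared estimation error, uniformly in `D`: this is the
lower tail of the empirical covariance of the whitened `X`, a sub-Gaussian vector in dimension
`rank Σ`, and follows from a net argument (`measure_exists_sum_sq_lt_le`). The lower bound for `n`
is what makes the union over the net work.

The right side is split along `X = X̃ - X̄`. In whitened coordinates of `X̃` and `X̄` it is an inner
product of the two images of `D` with the sums of the matrices `(ηᵢ + aᵢ) ⊗ w̃ᵢ` and
`(ηᵢ + aᵢ) ⊗ w̄ᵢ`. The means of the residual parts `a ⊗ w̃`, `a ⊗ w̄` need not vanish separately,
but they cancel in the inner product by the normal equations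
(`integral_residual_dotProduct_eq_zero`), so the summands may be centred. Sums of independent
centred bounded vectors obey the Pinelis–Bernstein inequality (`measure_norm_sum_gt_le`). The
residual summands are bounded by assumption. The noise summands are bounded once the whitened
coordinates are truncated at a logarithmic level; their variance is proportional to the number of
coordinates, which is at most `p + s` for `X̃`, since `X̃` takes values in the column space of
`[C̃ B*]`, and at most `d₂` for `X̄`. For this variance to carry the factor `σ²`, two regimes are
distinguished: if `σ²` is at least the reciprocal of the logarithmic factor, then the bound
`‖η‖² ≤ 2` of one-hot noise suffices; if it is smaller, then the labels are all but deterministic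
and Markov's inequality bounds the total noise (`measure_sum_noise_outer_gt_le`).

It remains to bound the images of `D` by the estimation error. On the range of `Σ`, the variance of
`X̄` is at most `λ_max(Σ̄) / λ_min≠0(Σ) ≤ c₂ ε_s / λ_min≠0(Σ)` times that of `X`, and the variance of
`X̃ = X + X̄` at most a constant times `1 + ε_s` times it
(`EigenFrame.integral_lift_dotProduct_sq_le`, `EigenFrame.integral_lift_dotProduct_add_sq_le`). The
same comparison shows that the whitened `X` is sub-Gaussian with variance proxy of the order
`(1 + ε_s) ρ²`. If `ε_s = 0`, then `X = X̃`, whose covariance has rank at most `p + s`, and the net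
lives in that smaller dimension.
-/

namespace SSL

/-! ### A Bernstein inequality for sums of independent random vectors -/

/-- `y ↦ cosh √y` is convex, being a power series with nonnegative coefficients. -/
lemma convexOn_cosh_sqrt : ConvexOn ℝ (Set.Ici 0) fun y : ℝ => Real.cosh √y := by
  have key : ∀ y : ℝ, 0 ≤ y →
      HasSum (fun k : ℕ => y ^ k / ((2 * k).factorial : ℝ)) (Real.cosh √y) := fun y hy => by
    have h := Real.hasSum_cosh √y
    simpa only [pow_mul, Real.sq_sqrt hy] using h
  refine ⟨convex_Ici 0, fun x hx y hy a b ha hb hab => ?_⟩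
  simp only [Set.mem_Ici, smul_eq_mul] at *
  refine hasSum_le (fun k => ?_) (key _ (by positivity))
    (((key x hx).mul_left a).add ((key y hy).mul_left b))
  have h := (convexOn_pow k).2 (Set.mem_Ici.2 hx) (Set.mem_Ici.2 hy) ha hb hab
  simp only [smul_eq_mul] at h
  rw [← mul_div_assoc, ← mul_div_assoc, ← add_div]
  gcongr

/-- One step of the growth of `cosh ‖S‖` along a sum. Writing `‖s + x‖²` as a convex combination
of `(‖s‖ ± ‖x‖)²`, convexity of `cosh √·` bounds the left-hand side by
`cosh ‖s‖ cosh ‖x‖ + ⟪s, x⟫ (sinh ‖s‖ / ‖s‖) (sinh ‖x‖ / ‖x‖)`. The last term is then made linear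
in `x`, so that it disappears on averaging over a centred `x`. -/
lemma cosh_norm_add_le {H : Type*} [NormedAddCommGroup H] [InnerProductSpace ℝ H] (s x : H) :
    Real.cosh ‖s + x‖ ≤ Real.cosh ‖s‖ * (Real.exp ‖x‖ - ‖x‖) +
      Real.sinh ‖s‖ / ‖s‖ * inner ℝ s x := by
  rcases eq_or_ne s 0 with rfl | hs
  · simp only [zero_add, norm_zero, Real.cosh_zero, one_mul, Real.sinh_zero, inner_zero_left,
      mul_zero, add_zero]
    have h1 := Real.cosh_add_sinh ‖x‖
    have h2 := Real.self_le_sinh_iff.2 (norm_nonneg x)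
    linarith
  rcases eq_or_ne x 0 with rfl | hx
  · simp
  have hs0 : 0 < ‖s‖ := norm_pos_iff.2 hs
  have hx0 : 0 < ‖x‖ := norm_pos_iff.2 hx
  set σ := ‖s‖
  set ξ := ‖x‖
  set c := inner ℝ s x / (σ * ξ) with hc
  have hin : inner ℝ s x = c * (σ * ξ) := by rw [hc]; field_simp
  have habs : |c| ≤ 1 := abs_real_inner_div_norm_mul_norm_le_one s x
  obtain ⟨hc1, hc2⟩ := abs_le.1 habs
  have hsq : ‖s + x‖ ^ 2 = ((1 + c) / 2) * (σ + ξ) ^ 2 + ((1 - c) / 2) * (σ - ξ) ^ 2 := by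
    rw [norm_add_sq_real, hin]; ring
  have hconv := convexOn_cosh_sqrt.2 (Set.mem_Ici.2 (sq_nonneg (σ + ξ)))
    (Set.mem_Ici.2 (sq_nonneg (σ - ξ))) (show 0 ≤ (1 + c) / 2 by linarith)
    (show 0 ≤ (1 - c) / 2 by linarith) (by ring)
  simp only [smul_eq_mul, ← hsq, Real.sqrt_sq_eq_abs, abs_norm, Real.cosh_abs] at hconv
  rw [Real.cosh_add, Real.cosh_sub] at hconv
  have h2 : Real.sinh ξ ≥ ξ := Real.self_le_sinh_iff.2 hx0.le
  have h4 : Real.sinh σ ≤ Real.cosh σ := (Real.sinh_lt_cosh σ).le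
  have h5 : 0 ≤ Real.sinh σ := Real.sinh_nonneg_iff.2 hs0.le
  have h6 : Real.sinh σ / σ * inner ℝ s x = c * Real.sinh σ * ξ := by rw [hin]; field_simp
  rw [h6, ← Real.cosh_add_sinh ξ]
  nlinarith [mul_nonneg (mul_nonneg (sub_nonneg.2 hc2) h5) (sub_nonneg.2 h2),
    mul_nonneg (sub_nonneg.2 h4) (sub_nonneg.2 h2)]

variable {Ω : Type*} [MeasurableSpace Ω]

section Bernstein

variable {H : Type*} [NormedAddCommGroup H] [InnerProductSpace ℝ H] [FiniteDimensional ℝ H]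
  [MeasurableSpace H] [BorelSpace H]

lemma measurable_sinh_norm_div_smul :
    Measurable fun s : H => (Real.sinh ‖s‖ / ‖s‖) • s := by
  have := Real.measurable_sinh
  fun_prop

/-- Adding an independent centred vector of norm at most one. -/
lemma integral_cosh_norm_add_le {μ : Measure Ω} [IsProbabilityMeasure μ] {S T : Ω → H}
    (hS : AEMeasurable S μ) (hT : AEMeasurable T μ) (hind : IndepFun S T μ)
    {A v : ℝ} (hSA : ∀ᵐ ω ∂μ, ‖S ω‖ ≤ A) (hT1 : ∀ᵐ ω ∂μ, ‖T ω‖ ≤ 1)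
    (hT0 : ∫ ω, T ω ∂μ = 0) (hTv : ∫ ω, ‖T ω‖ ^ 2 ∂μ ≤ v) :
    ∫ ω, Real.cosh ‖S ω + T ω‖ ∂μ ≤ (1 + v) * ∫ ω, Real.cosh ‖S ω‖ ∂μ := by
  have : CompleteSpace H := FiniteDimensional.complete ℝ H
  have hcm : Measurable Real.cosh := Real.measurable_cosh
  have hbd : ∀ {W : Ω → H} {K : ℝ}, AEMeasurable W μ → (∀ᵐ ω ∂μ, ‖W ω‖ ≤ K) →
      Integrable (fun ω => Real.cosh ‖W ω‖) μ := fun {W K} hW hK => by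
    refine Integrable.of_bound (C := Real.cosh K) (hcm.comp_aemeasurable
      hW.norm).aestronglyMeasurable ?_
    filter_upwards [hK] with ω h
    rw [Real.norm_of_nonneg (Real.cosh_pos _).le, Real.cosh_le_cosh, abs_norm]
    exact h.trans (le_abs_self K)
  have hiS := hbd hS hSA
  have hiT : Integrable T μ := Integrable.of_bound hT.aestronglyMeasurable 1 hT1
  have hiT2 : Integrable (fun ω => 1 + ‖T ω‖ ^ 2) μ := by
    refine (integrable_const _).add (Integrable.of_bound (C := 1) (by fun_prop) ?_)
    filter_upwards [hT1] with ω h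
    rw [norm_pow, norm_norm]
    exact pow_le_one₀ (norm_nonneg _) h
  set G : Ω → H := fun ω => (Real.sinh ‖S ω‖ / ‖S ω‖) • S ω
  have hGm : AEMeasurable G μ := measurable_sinh_norm_div_smul.comp_aemeasurable hS
  have hGi : Integrable G μ := by
    refine hiS.mono' hGm.aestronglyMeasurable (ae_of_all _ fun ω => ?_)
    rw [norm_smul, norm_div, norm_norm]
    rcases eq_or_ne ‖S ω‖ 0 with h | h
    · rw [h]; simp
    · rw [div_mul_cancel₀ _ h, Real.norm_of_nonneg (Real.sinh_nonneg_iff.2 (norm_nonneg _))]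
      exact (Real.sinh_lt_cosh _).le
  have hindG : IndepFun G T μ := hind.comp measurable_sinh_norm_div_smul measurable_id
  have hlin : ∫ ω, inner ℝ (G ω) (T ω) ∂μ = 0 := by
    have h := hindG.integral_bilin hGi hiT (innerSL ℝ)
    rw [hT0, map_zero] at h
    exact h
  have hlini : Integrable (fun ω => inner ℝ (G ω) (T ω)) μ := by
    exact hindG.integrable_bilin hGi hiT (innerSL ℝ)
  have hind2 : IndepFun (fun ω => Real.cosh ‖S ω‖) (fun ω => 1 + ‖T ω‖ ^ 2) μ :=
    hind.comp (φ := fun s : H => Real.cosh ‖s‖) (ψ := fun t : H => 1 + ‖t‖ ^ 2)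
      (by fun_prop) (by fun_prop)
  have hprod := hind2.integral_fun_mul_eq_mul_integral hiS.1 hiT2.1
  have hprodi : Integrable (fun ω => Real.cosh ‖S ω‖ * (1 + ‖T ω‖ ^ 2)) μ :=
    hind2.integrable_mul hiS hiT2
  calc ∫ ω, Real.cosh ‖S ω + T ω‖ ∂μ
      ≤ ∫ ω, (Real.cosh ‖S ω‖ * (1 + ‖T ω‖ ^ 2) + inner ℝ (G ω) (T ω)) ∂μ := by
        refine integral_mono_ae (hbd (K := A + 1) (hS.add hT) ?_) (hprodi.add hlini) ?_
        · filter_upwards [hSA, hT1] with ω h1 h2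
          exact (norm_add_le _ _).trans (add_le_add h1 h2)
        · filter_upwards [hT1] with ω h
          refine (cosh_norm_add_le (S ω) (T ω)).trans ?_
          have h1 := (abs_le.1 (Real.abs_exp_sub_one_sub_id_le (x := ‖T ω‖) (by simpa using h))).2
          have : inner ℝ (G ω) (T ω) = Real.sinh ‖S ω‖ / ‖S ω‖ * inner ℝ (S ω) (T ω) := by
            simp [G, real_inner_smul_left]
          rw [this]
          gcongr
          linarith
    _ = (∫ ω, Real.cosh ‖S ω‖ ∂μ) * ∫ ω, (1 + ‖T ω‖ ^ 2) ∂μ := by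
        rw [integral_add hprodi hlini, hlin, hprod, add_zero]
    _ ≤ _ := by
        rw [mul_comm]
        refine mul_le_mul_of_nonneg_right ?_ (integral_nonneg fun ω => (Real.cosh_pos _).le)
        have : Integrable (fun ω => ‖T ω‖ ^ 2) μ := by
          refine (hiT2.sub (integrable_const (1 : ℝ))).congr (ae_of_all _ fun ω => ?_)
          simp
        rw [integral_add (integrable_const _) this]
        simpa using hTv

lemma integral_cosh_norm_sum_le {μ : Measure Ω} [IsProbabilityMeasure μ] {n : ℕ}
    {Y : Fin n → Ω → H} (hm : ∀ i, AEMeasurable (Y i) μ) (hind : iIndepFun Y μ) {v : ℝ}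
    (h1 : ∀ i, ∀ᵐ ω ∂μ, ‖Y i ω‖ ≤ 1) (h0 : ∀ i, ∫ ω, Y i ω ∂μ = 0)
    (hv : ∀ i, ∫ ω, ‖Y i ω‖ ^ 2 ∂μ ≤ v) (hv0 : 0 ≤ v) (s : Finset (Fin n)) :
    ∫ ω, Real.cosh ‖∑ i ∈ s, Y i ω‖ ∂μ ≤ (1 + v) ^ s.card := by
  classical
  induction s using Finset.induction_on with
  | empty => simp
  | insert i s hi ih =>
    rw [Finset.card_insert_of_notMem hi, pow_succ']
    have hb : ∀ᵐ ω ∂μ, ‖(∑ j ∈ s, Y j) ω‖ ≤ s.card := by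
      filter_upwards [ae_all_iff.2 h1] with ω h
      rw [Finset.sum_apply]
      exact (norm_sum_le_of_le s fun j _ => h j).trans (by simp)
    have h := integral_cosh_norm_add_le (S := ∑ j ∈ s, Y j) (T := Y i)
      (Finset.aemeasurable_sum s fun j _ => hm j) (hm i)
      (hind.indepFun_finsetSum_of_notMem₀ hm hi) hb (h1 i) (h0 i) (hv i)
    simp only [Finset.sum_apply] at h
    calc _ = ∫ ω, Real.cosh ‖(∑ j ∈ s, Y j ω) + Y i ω‖ ∂μ := by
          simp only [Finset.sum_insert hi, add_comm]
      _ ≤ _ := h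
      _ ≤ _ := by gcongr

/-- Bernstein's inequality for independent centred random vectors, in Pinelis' form: there is no
dependence on the dimension. -/
lemma measure_norm_sum_gt_le {μ : Measure Ω} [IsProbabilityMeasure μ] {n : ℕ}
    {Y : Fin n → Ω → H} (hm : ∀ i, AEMeasurable (Y i) μ) (hind : iIndepFun Y μ) {v R δ : ℝ}
    (hR : ∀ i, ∀ᵐ ω ∂μ, ‖Y i ω‖ ≤ R) (h0 : ∀ i, ∫ ω, Y i ω ∂μ = 0)
    (hv : ∀ i, ∫ ω, ‖Y i ω‖ ^ 2 ∂μ ≤ v) (hv0 : 0 ≤ v) (hR0 : 0 ≤ R) (hδ : 0 < δ) :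
    μ {ω | (√(n * v) + R) * (1 + Real.log (2 / δ)) < ‖∑ i, Y i ω‖} ≤ ENNReal.ofReal δ := by
  rcases hR0.eq_or_lt with rfl | hRp
  · -- all the vectors vanish almost surely
    have : ∀ᵐ ω ∂μ, ∀ i, Y i ω = 0 := ae_all_iff.2 fun i => by
      filter_upwards [hR i] with ω h using norm_le_zero_iff.1 h
    rcases le_or_gt 2 δ with h2 | h2
    · exact prob_le_one.trans (by simpa using by linarith)
    refine le_of_eq_of_le (measure_eq_zero_iff_ae_notMem.2 ?_) zero_le
    filter_upwards [this] with ω h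
    simp only [h, Finset.sum_const_zero, norm_zero, not_lt]
    have : 0 ≤ Real.log (2 / δ) := Real.log_nonneg (by rw [le_div_iff₀ hδ]; linarith)
    positivity
  set D := √(n * v) + R
  have hD : 0 < D := by positivity
  set lam := 1 / D
  have hlam : 0 < lam := by positivity
  have hb : ∀ i, ∀ᵐ ω ∂μ, ‖lam • Y i ω‖ ≤ 1 := fun i => by
    filter_upwards [hR i] with ω h
    rw [norm_smul, Real.norm_of_nonneg hlam.le, show lam = D⁻¹ from one_div D, inv_mul_le_iff₀ hD, mul_one]
    exact h.trans (le_add_of_nonneg_left (Real.sqrt_nonneg _))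
  have key := integral_cosh_norm_sum_le (Y := fun i ω => lam • Y i ω)
    (fun i => (hm i).const_smul lam)
    (hind.comp (fun _ y => lam • y) fun _ => measurable_const_smul lam)
    (v := lam ^ 2 * v) hb (fun i => by rw [integral_smul, h0, smul_zero])
    (fun i => by
      simp only [norm_smul, mul_pow, Real.norm_of_nonneg hlam.le]
      rw [integral_const_mul]
      exact mul_le_mul_of_nonneg_left (hv i) (by positivity)) (by positivity) Finset.univ
  have hexp : (1 + lam ^ 2 * v) ^ n ≤ Real.exp 1 := by
    calc (1 + lam ^ 2 * v) ^ n ≤ Real.exp (lam ^ 2 * v) ^ n := by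
          gcongr
          linarith [Real.add_one_le_exp (lam ^ 2 * v)]
      _ = Real.exp (n * (lam ^ 2 * v)) := by rw [← Real.exp_nat_mul]
      _ ≤ Real.exp 1 := by
          refine Real.exp_le_exp.2 ?_
          have : n * v ≤ D ^ 2 := by
            calc (n : ℝ) * v = √(n * v) ^ 2 := (Real.sq_sqrt (by positivity)).symm
              _ ≤ D ^ 2 := by gcongr; exact le_add_of_nonneg_right hRp.le
          calc n * (lam ^ 2 * v) = (n * v) / D ^ 2 := by simp only [lam]; field_simp
            _ ≤ 1 := div_le_one_of_le₀ this (by positivity)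
  simp only [Finset.card_univ, Fintype.card_fin, ← Finset.smul_sum] at key
  have hmark := mul_meas_ge_le_integral_of_nonneg (μ := μ)
    (f := fun ω => Real.cosh ‖lam • ∑ i, Y i ω‖)
    (ae_of_all _ fun ω => (Real.cosh_pos _).le) (by
      have hms : AEMeasurable (fun ω => ∑ i, Y i ω) μ := Finset.aemeasurable_fun_sum _ fun i _ => hm i
      refine Integrable.of_bound (C := Real.cosh n) (Real.measurable_cosh.comp_aemeasurable
        (hms.const_smul lam).norm).aestronglyMeasurable ?_
      filter_upwards [ae_all_iff.2 hb] with ω h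
      rw [Real.norm_of_nonneg (Real.cosh_pos _).le, Real.cosh_le_cosh, abs_norm, Finset.smul_sum]
      exact (norm_sum_le_of_le _ fun j _ => h j).trans (by simp)) (Real.exp 1 / δ)
  have hle : μ.real {ω | Real.exp 1 / δ ≤ Real.cosh ‖lam • ∑ i, Y i ω‖} ≤ δ := by
    have := hmark.trans (key.trans hexp)
    rw [div_mul_eq_mul_div, div_le_iff₀ hδ] at this
    exact le_of_mul_le_mul_left this (Real.exp_pos 1)
  calc μ {ω | D * (1 + Real.log (2 / δ)) < ‖∑ i, Y i ω‖}
      ≤ μ {ω | Real.exp 1 / δ ≤ Real.cosh ‖lam • ∑ i, Y i ω‖} := by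
        refine measure_mono fun ω hω => ?_
        simp only [Set.mem_ofPred_eq] at hω ⊢
        rw [norm_smul, Real.norm_of_nonneg hlam.le]
        have h2 : 1 + Real.log (2 / δ) ≤ lam * ‖∑ i, Y i ω‖ := by
          rw [show lam = D⁻¹ from one_div D, le_inv_mul_iff₀ hD]; exact hω.le
        have h3 := Real.exp_le_exp.2 h2
        rw [Real.exp_add, Real.exp_log (by positivity)] at h3
        rw [Real.cosh_eq]
        have := Real.exp_pos (-(lam * ‖∑ i, Y i ω‖))
        calc Real.exp 1 / δ = Real.exp 1 * (2 / δ) / 2 := by ring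
          _ ≤ _ := by gcongr; linarith
    _ = ENNReal.ofReal (μ.real {ω | Real.exp 1 / δ ≤ Real.cosh ‖lam • ∑ i, Y i ω‖}) := by
        rw [ofReal_measureReal]
    _ ≤ ENNReal.ofReal δ := ENNReal.ofReal_le_ofReal hle

end Bernstein

end SSL

namespace SSL

/-! ### Squares of sub-Gaussian variables -/

variable {Ω : Type*} [MeasurableSpace Ω]

lemma lintegral_exp_sq_div_four_gaussianReal :
    ∫⁻ g, ENNReal.ofReal (Real.exp (g ^ 2 / 4)) ∂(gaussianReal 0 1) ≤ 2 := by
  have hpi := Real.pi_pos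
  rw [gaussianReal_of_var_ne_zero _ one_ne_zero,
    lintegral_withDensity_eq_lintegral_mul _ (measurable_gaussianPDF 0 1) (by fun_prop)]
  have h1 : ∀ g : ℝ, (gaussianPDF 0 1 * fun g => ENNReal.ofReal (Real.exp (g ^ 2 / 4))) g =
      ENNReal.ofReal ((√(2 * Real.pi))⁻¹ * Real.exp (-(1 / 4) * g ^ 2)) := fun g => by
    rw [Pi.mul_apply, gaussianPDF, ← ENNReal.ofReal_mul (gaussianPDFReal_nonneg _ _ _),
      gaussianPDFReal, mul_assoc, ← Real.exp_add]
    congr 3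
    · simp
    · simp only [sub_zero, NNReal.coe_one]
      ring
  rw [lintegral_congr h1, ← ofReal_integral_eq_lintegral_ofReal
    ((integrable_exp_neg_mul_sq (by norm_num)).const_mul _) (ae_of_all _ fun g => by positivity),
    integral_const_mul, integral_gaussian]
  refine ENNReal.ofReal_le_of_le_toReal ?_
  rw [ENNReal.toReal_ofNat, inv_mul_le_iff₀ (by positivity), Real.sqrt_le_left (by positivity),
    mul_pow, Real.sq_sqrt (by positivity)]
  linarith

/-- A square exponential moment of a sub-Gaussian variable, from `exp (Z² / (4v)) = E exp (c Z g)`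
for an independent standard Gaussian `g` and `c = 1 / √(2v)`. -/
lemma lintegral_exp_sq_le {μ : Measure Ω} [IsProbabilityMeasure μ] {Z : Ω → ℝ} {v : ℝ≥0}
    (hZ : HasSubgaussianMGF Z v μ) (hv : 0 < v) :
    ∫⁻ ω, ENNReal.ofReal (Real.exp (Z ω ^ 2 / (4 * v))) ∂μ ≤ 2 := by
  set c : ℝ := (√(2 * v))⁻¹
  have hc : c ^ 2 = 1 / (2 * v) := by
    simp only [c, inv_pow]
    rw [Real.sq_sqrt (by positivity), one_div]
  have hgauss : ∀ y : ℝ, ENNReal.ofReal (Real.exp (y ^ 2 / (4 * v))) =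
      ∫⁻ g, ENNReal.ofReal (Real.exp (c * y * g)) ∂(gaussianReal 0 1) := fun y => by
    rw [← ofReal_integral_eq_lintegral_ofReal (integrable_exp_mul_gaussianReal _)
      (ae_of_all _ fun g => (Real.exp_pos _).le)]
    have h := congrFun (mgf_fun_id_gaussianReal (μ := 0) (v := 1)) (c * y)
    rw [mgf] at h
    rw [h]
    congr 2
    rw [mul_pow, hc]
    simp only [zero_mul, NNReal.coe_one, zero_add]
    field_simp
    ring
  simp_rw [hgauss]
  have hm : AEMeasurable (Function.uncurry fun (ω : Ω) (g : ℝ) =>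
      ENNReal.ofReal (Real.exp (c * Z ω * g))) (μ.prod (gaussianReal 0 1)) := by
    have : AEMeasurable (fun q : Ω × ℝ => Z q.1) (μ.prod (gaussianReal 0 1)) :=
      hZ.aemeasurable.comp_fst
    exact (Real.measurable_exp.comp_aemeasurable
      ((this.const_mul c).mul measurable_snd.aemeasurable)).ennreal_ofReal
  rw [lintegral_lintegral_swap hm]
  refine (lintegral_mono fun g => ?_).trans lintegral_exp_sq_div_four_gaussianReal
  have h := hZ.mgf_le (c * g)
  have hi := hZ.integrable_exp_mul (c * g)
  simp only [mul_right_comm c _ g]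
  rw [← ofReal_integral_eq_lintegral_ofReal hi (ae_of_all _ fun ω => (Real.exp_pos _).le)]
  refine ENNReal.ofReal_le_ofReal (h.trans (Real.exp_le_exp.2 (le_of_eq ?_)))
  rw [mul_pow, hc]
  field_simp
  ring

lemma integrable_exp_sq {μ : Measure Ω} [IsProbabilityMeasure μ] {Z : Ω → ℝ} {v : ℝ≥0}
    (hZ : HasSubgaussianMGF Z v μ) (hv : 0 < v) :
    Integrable (fun ω => Real.exp (Z ω ^ 2 / (4 * v))) μ := by
  have := hZ.aemeasurable
  refine ⟨AEMeasurable.aestronglyMeasurable (by fun_prop), ?_⟩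
  rw [hasFiniteIntegral_iff_ofReal (ae_of_all _ fun ω => (Real.exp_pos _).le)]
  exact (lintegral_exp_sq_le hZ hv).trans_lt (by simp)

lemma integral_exp_sq_le {μ : Measure Ω} [IsProbabilityMeasure μ] {Z : Ω → ℝ} {v : ℝ≥0}
    (hZ : HasSubgaussianMGF Z v μ) (hv : 0 < v) :
    ∫ ω, Real.exp (Z ω ^ 2 / (4 * v)) ∂μ ≤ 2 := by
  have h := lintegral_exp_sq_le hZ hv
  rw [← ofReal_integral_eq_lintegral_ofReal (integrable_exp_sq hZ hv)
    (ae_of_all _ fun ω => (Real.exp_pos _).le)] at h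
  simpa using (ENNReal.ofReal_le_ofReal_iff (q := 2) (by norm_num)).1 (by simpa using h)

/-- A variable with second moment one cannot be sub-Gaussian with a small parameter. -/
lemma HasSubgaussianMGF.pos_of_integral_sq_eq_one {μ : Measure Ω}
    {Z : Ω → ℝ} {v : ℝ≥0} (hZ : HasSubgaussianMGF Z v μ) (h1 : ∫ ω, Z ω ^ 2 ∂μ = 1) : 0 < v := by
  refine pos_iff_ne_zero.2 fun h => ?_
  subst h
  rw [integral_congr_ae (g := fun _ => 0)
    (by filter_upwards [hZ.ae_eq_zero_of_hasSubgaussianMGF_zero] with ω h; simp [h])] at h1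
  simp at h1

lemma HasSubgaussianMGF.integrable_sq {μ : Measure Ω}
    {Z : Ω → ℝ} {v : ℝ≥0} (hZ : HasSubgaussianMGF Z v μ) : Integrable (fun ω => Z ω ^ 2) μ :=
  (hZ.memLp 2).integrable_sq

lemma HasSubgaussianMGF.one_le_four_mul {μ : Measure Ω} [IsProbabilityMeasure μ]
    {Z : Ω → ℝ} {v : ℝ≥0} (hZ : HasSubgaussianMGF Z v μ) (h1 : ∫ ω, Z ω ^ 2 ∂μ = 1) :
    (1 : ℝ) ≤ 4 * v := by
  have hv := HasSubgaussianMGF.pos_of_integral_sq_eq_one hZ h1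
  have hi : Integrable (fun ω => Z ω ^ 2 / (4 * v)) μ :=
    (HasSubgaussianMGF.integrable_sq hZ).div_const _
  have h : ∫ ω, (Z ω ^ 2 / (4 * v) + 1) ∂μ ≤ 2 :=
    (integral_mono (hi.add (integrable_const 1)) (integrable_exp_sq hZ hv)
      fun ω => Real.add_one_le_exp _).trans (integral_exp_sq_le hZ hv)
  rw [integral_add hi (integrable_const 1), integral_div, h1] at h
  simp only [integral_const, probReal_univ, smul_eq_mul, mul_one] at h
  have : 1 / (4 * (v : ℝ)) ≤ 1 := by linarith
  rwa [div_le_one (by positivity)] at this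

lemma exp_mul_le_of_abs_le_half {r y : ℝ} (hy : 0 ≤ y) (hr : |r| ≤ 1 / 2) :
    Real.exp (r * y) ≤ 1 + r * y + 8 * r ^ 2 * Real.exp y := by
  have h := Complex.norm_exp_sub_sum_le_norm_mul_exp ((r * y : ℝ) : ℂ) 2
  have h1 : Complex.exp ((r * y : ℝ) : ℂ) - ∑ m ∈ Finset.range 2,
      ((r * y : ℝ) : ℂ) ^ m / (m.factorial : ℂ) =
      ((Real.exp (r * y) - (1 + r * y) : ℝ) : ℂ) := by
    simp [Finset.sum_range_succ]
  rw [h1, Complex.norm_real, Complex.norm_real, Real.norm_eq_abs, Real.norm_eq_abs] at h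
  have h2 := (abs_le.1 h).2
  have h3 : |r * y| ≤ y / 2 := by
    rw [abs_mul, abs_of_nonneg hy]; nlinarith
  have h5 : (y / 2) ^ 2 / 2 ≤ Real.exp (y / 2) := by
    have := Real.quadratic_le_exp_of_nonneg (x := y / 2) (by positivity)
    nlinarith
  have h6 : Real.exp y = Real.exp (y / 2) * Real.exp (y / 2) := by rw [← Real.exp_add]; ring_nf
  rw [sq_abs] at h2
  have h7 : (r * y) ^ 2 * Real.exp |r * y| ≤ 8 * r ^ 2 * Real.exp y := by
    rw [h6]
    have : (r * y) ^ 2 * Real.exp |r * y| ≤ (r * y) ^ 2 * Real.exp (y / 2) := by gcongr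
    nlinarith [mul_nonneg (mul_nonneg (sq_nonneg r) (sub_nonneg.2 h5)) (Real.exp_pos (y / 2)).le]
  linarith

/-- The centred square of a normalised sub-Gaussian variable has a sub-Gaussian moment generating
function near the origin. -/
lemma HasSubgaussianMGF.mgf_sq_le {μ : Measure Ω} [IsProbabilityMeasure μ]
    {Z : Ω → ℝ} {v : ℝ≥0} (hZ : HasSubgaussianMGF Z v μ) (h1 : ∫ ω, Z ω ^ 2 ∂μ = 1)
    {t : ℝ} (ht : |t| * (8 * v) ≤ 1) :
    Integrable (fun ω => Real.exp (t * Z ω ^ 2)) μ ∧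
      mgf (fun ω => Z ω ^ 2) μ t ≤ Real.exp (t + 256 * t ^ 2 * v ^ 2) := by
  have hv := HasSubgaussianMGF.pos_of_integral_sq_eq_one hZ h1
  have hsq := HasSubgaussianMGF.integrable_sq hZ
  set r : ℝ := t * (4 * v)
  have hr : |r| ≤ 1 / 2 := by
    simp only [r]
    rw [abs_mul, abs_of_pos (by positivity : (0 : ℝ) < 4 * v)]
    linarith
  have hrt : ∀ ω, t * Z ω ^ 2 = r * (Z ω ^ 2 / (4 * v)) := fun ω => by simp only [r]; field_simp
  have hpt : ∀ ω, Real.exp (t * Z ω ^ 2) ≤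
      1 + t * Z ω ^ 2 + 8 * r ^ 2 * Real.exp (Z ω ^ 2 / (4 * v)) := fun ω => by
    rw [hrt]
    exact exp_mul_le_of_abs_le_half (by positivity) hr
  have hi1 : Integrable (fun ω => 1 + t * Z ω ^ 2) μ :=
    (integrable_const _).add (hsq.const_mul t)
  have hi2 : Integrable (fun ω => 8 * r ^ 2 * Real.exp (Z ω ^ 2 / (4 * v))) μ :=
    (integrable_exp_sq hZ hv).const_mul _
  have hm := hZ.aemeasurable
  have hint : Integrable (fun ω => Real.exp (t * Z ω ^ 2)) μ :=
    (hi1.add hi2).mono' (AEMeasurable.aestronglyMeasurable (by fun_prop))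
      (ae_of_all _ fun ω => by rw [Real.norm_of_nonneg (Real.exp_pos _).le]; exact hpt ω)
  refine ⟨hint, ?_⟩
  calc mgf (fun ω => Z ω ^ 2) μ t
      ≤ ∫ ω, (1 + t * Z ω ^ 2 + 8 * r ^ 2 * Real.exp (Z ω ^ 2 / (4 * v))) ∂μ :=
        integral_mono hint (hi1.add hi2) hpt
    _ = 1 + t + 8 * r ^ 2 * ∫ ω, Real.exp (Z ω ^ 2 / (4 * v)) ∂μ := by
        rw [integral_add hi1 hi2, integral_add (integrable_const _) (hsq.const_mul t),
          integral_const_mul, integral_const_mul, h1]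
        simp
    _ ≤ 1 + t + 8 * r ^ 2 * 2 := by
        gcongr
        exact integral_exp_sq_le hZ hv
    _ = t + 256 * t ^ 2 * v ^ 2 + 1 := by simp only [r]; ring
    _ ≤ _ := Real.add_one_le_exp _

/-- Concentration of the empirical second moment of a sub-Gaussian variable. -/
lemma measure_sum_sq_sub_gt_le {μ : Measure Ω} [IsProbabilityMeasure μ] {n : ℕ}
    {Z : Fin n → Ω → ℝ} {v : ℝ≥0} (hind : iIndepFun Z μ)
    (hZ : ∀ i, HasSubgaussianMGF (Z i) v μ) (h1 : ∀ i, ∫ ω, Z i ω ^ 2 ∂μ = 1) :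
    μ {ω | (n : ℝ) / 8 < |∑ i, Z i ω ^ 2 - n|} ≤
      ENNReal.ofReal (2 * Real.exp (-(n : ℝ) / (65536 * v ^ 2))) := by
  rcases Nat.eq_zero_or_pos n with rfl | hn
  · exact prob_le_one.trans (by simp)
  have h4v := HasSubgaussianMGF.one_le_four_mul (hZ ⟨0, hn⟩) (h1 ⟨0, hn⟩)
  have hv' : (0 : ℝ) < v := by linarith
  -- optimising `256 θ² v² - θ / 8`
  set θ : ℝ := 1 / (4096 * v ^ 2) with hθdef
  have hθ : 0 < θ := by positivity
  have hθv : θ * (8 * v) ≤ 1 := by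
    rw [hθdef, div_mul_eq_mul_div, div_le_one (by positivity)]
    nlinarith
  have hindsq : iIndepFun (fun i ω => Z i ω ^ 2) μ :=
    hind.comp (fun _ y => y ^ 2) fun _ => by fun_prop
  have hmeas : ∀ i, AEMeasurable (fun ω => Z i ω ^ 2) μ := fun i => (hZ i).aemeasurable.pow_const 2
  have hmgf : ∀ t : ℝ, |t| = θ → Integrable (fun ω => Real.exp (t * ∑ i, Z i ω ^ 2)) μ ∧
      mgf (fun ω => ∑ i, Z i ω ^ 2) μ t ≤ Real.exp (n * (t + 256 * θ ^ 2 * v ^ 2)) := fun t ht => by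
    have hstep : ∀ i, Integrable (fun ω => Real.exp (t * Z i ω ^ 2)) μ ∧
      mgf (fun ω => Z i ω ^ 2) μ t ≤ Real.exp (t + 256 * t ^ 2 * v ^ 2) := fun i =>
        HasSubgaussianMGF.mgf_sq_le (hZ i) (h1 i) (by rw [ht]; exact hθv)
    have hfun : (fun ω => ∑ i, Z i ω ^ 2) = ∑ i, fun ω => Z i ω ^ 2 := by
      ext ω; simp
    constructor
    · refine mgf_pos_iff.1 ?_
      rw [hfun, hindsq.mgf_sum₀ hmeas]
      exact Finset.prod_pos fun i _ => mgf_pos (hstep i).1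
    · rw [hfun, hindsq.mgf_sum₀ hmeas]
      calc ∏ i, mgf (fun ω => Z i ω ^ 2) μ t
          ≤ ∏ _i : Fin n, Real.exp (t + 256 * t ^ 2 * v ^ 2) :=
            Finset.prod_le_prod (fun _ _ => mgf_nonneg) fun i _ => (hstep i).2
        _ = _ := by
            rw [Finset.prod_const, ← Real.exp_nat_mul, Finset.card_univ, Fintype.card_fin,
              ← sq_abs t, ht]
  have hval : -(θ / 8) + 256 * θ ^ 2 * v ^ 2 = -1 / (65536 * v ^ 2) := by
    rw [hθdef]; field_simp; norm_num
  obtain ⟨hip, hmp⟩ := hmgf θ (abs_of_pos hθ)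
  obtain ⟨hin, hmn⟩ := hmgf (-θ) (by rw [abs_neg, abs_of_pos hθ])
  have hup := measure_ge_le_exp_mul_mgf ((n : ℝ) + n / 8) hθ.le hip
  have hlo := measure_le_le_exp_mul_mgf ((n : ℝ) - n / 8) (neg_nonpos.2 hθ.le) hin
  have hup' : μ.real {ω | (n : ℝ) + n / 8 ≤ ∑ i, Z i ω ^ 2} ≤
      Real.exp (-(n : ℝ) / (65536 * v ^ 2)) := by
    refine hup.trans ((mul_le_mul_of_nonneg_left hmp (Real.exp_pos _).le).trans (le_of_eq ?_))
    rw [← Real.exp_add]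
    congr 1
    rw [show -(n : ℝ) / (65536 * v ^ 2) = n * (-1 / (65536 * v ^ 2)) by ring, ← hval]
    ring
  have hlo' : μ.real {ω | ∑ i, Z i ω ^ 2 ≤ (n : ℝ) - n / 8} ≤
      Real.exp (-(n : ℝ) / (65536 * v ^ 2)) := by
    refine hlo.trans ((mul_le_mul_of_nonneg_left hmn (Real.exp_pos _).le).trans (le_of_eq ?_))
    rw [← Real.exp_add]
    congr 1
    rw [show -(n : ℝ) / (65536 * v ^ 2) = n * (-1 / (65536 * v ^ 2)) by ring, ← hval]
    ring
  calc μ {ω | (n : ℝ) / 8 < |∑ i, Z i ω ^ 2 - n|}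
      ≤ μ ({ω | (n : ℝ) + n / 8 ≤ ∑ i, Z i ω ^ 2} ∪ {ω | ∑ i, Z i ω ^ 2 ≤ (n : ℝ) - n / 8}) := by
        refine measure_mono fun ω hω => ?_
        simp only [Set.mem_ofPred_eq, Set.mem_union] at hω ⊢
        rcases lt_abs.1 hω with h | h
        · left; linarith
        · right; linarith
    _ ≤ _ := measure_union_le _ _
    _ ≤ ENNReal.ofReal (Real.exp (-(n : ℝ) / (65536 * v ^ 2))) +
          ENNReal.ofReal (Real.exp (-(n : ℝ) / (65536 * v ^ 2))) := by
        rw [← ofReal_measureReal, ← ofReal_measureReal]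
        gcongr
    _ = _ := by
        rw [← ENNReal.ofReal_add (Real.exp_pos _).le (Real.exp_pos _).le, two_mul]

end SSL

namespace SSL

/-! ### The empirical covariance matrix -/

/-- A half-net of the unit sphere of cardinality at most `5 ^ dim`, namely a maximal
half-separated subset. -/
lemma exists_half_net (E : Type*) [NormedAddCommGroup E] [NormedSpace ℝ E]
    [FiniteDimensional ℝ E] :
    ∃ N : Finset E, N.card ≤ 5 ^ Module.finrank ℝ E ∧ (∀ x ∈ N, ‖x‖ = 1) ∧
      ∀ x : E, ‖x‖ = 1 → ∃ y ∈ N, ‖x - y‖ ≤ 1 / 2 := by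
  classical
  let P : Finset E → Prop := fun N => (∀ x ∈ N, ‖x‖ = 1) ∧
    ∀ x ∈ N, ∀ y ∈ N, x ≠ y → 1 / 2 ≤ ‖x - y‖
  have hcard : ∀ N, P N → N.card ≤ 5 ^ Module.finrank ℝ E := fun N hN => by
    have hinj : Function.Injective fun x : E => (2 : ℝ) • x := smul_right_injective E two_ne_zero
    rw [← Finset.card_image_of_injective N hinj]
    refine Besicovitch.card_le_of_separated _ (fun c hc => ?_) fun c hc d hd hcd => ?_
    · obtain ⟨x, hx, rfl⟩ := Finset.mem_image.1 hc
      rw [norm_smul, hN.1 x hx]; simp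
    · obtain ⟨x, hx, rfl⟩ := Finset.mem_image.1 hc
      obtain ⟨y, hy, rfl⟩ := Finset.mem_image.1 hd
      have := hN.2 x hx y hy fun h => hcd (by rw [h])
      rw [← smul_sub, norm_smul, Real.norm_ofNat]
      linarith
  have hbdd : BddAbove {k | ∃ N, P N ∧ N.card = k} := ⟨5 ^ Module.finrank ℝ E, by
    rintro k ⟨N, hN, rfl⟩; exact hcard N hN⟩
  have hne : {k | ∃ N, P N ∧ N.card = k}.Nonempty := ⟨0, ∅, by simp [P], rfl⟩
  obtain ⟨N, hN, hNk⟩ := Nat.sSup_mem hne hbdd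
  refine ⟨N, hcard N hN, hN.1, fun x hx => ?_⟩
  by_contra! hfar
  have hxN : x ∉ N := fun h => by have := hfar x h; simp at this; linarith
  have hins : P (insert x N) := by
    constructor
    · intro y hy
      rcases Finset.mem_insert.1 hy with rfl | hy
      exacts [hx, hN.1 y hy]
    · intro y hy z hz hyz
      rcases Finset.mem_insert.1 hy with hy | hy <;> rcases Finset.mem_insert.1 hz with hz | hz
      · exact absurd (hy.trans hz.symm) hyz
      · rw [hy]; exact (hfar z hz).le
      · rw [hz, norm_sub_rev]; exact (hfar y hy).le
      · exact hN.2 y hy z hz hyz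
  have := le_csSup hbdd ⟨insert x N, hins, rfl⟩
  rw [Finset.card_insert_of_notMem hxN, ← hNk] at this
  omega

/-- Finitely many unit vectors, at most `2 * 25 ^ dim`, control every quadratic form: for a
half-net `N`, the operator norm is at most four times the bilinear form on pairs from `N`, which
polarisation writes in terms of the quadratic form at the normalised vectors `x ± y`. -/
lemma exists_quadratic_net (E : Type*) [NormedAddCommGroup E] [InnerProductSpace ℝ E]
    [FiniteDimensional ℝ E] :
    ∃ M : Finset E, M.card ≤ 2 * 25 ^ Module.finrank ℝ E ∧ (∀ x ∈ M, ‖x‖ = 1) ∧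
      ∀ T : E →L[ℝ] E, (∀ x y, inner ℝ (T x) y = inner ℝ (T y) x) → ∀ t : ℝ, 0 ≤ t →
        (∀ x ∈ M, |inner ℝ (T x) x| ≤ t) → ‖T‖ ≤ 4 * t := by
  classical
  obtain ⟨N, hNc, hN1, hN⟩ := exists_half_net E
  let f : E → E := fun x => ‖x‖⁻¹ • x
  refine ⟨(((N ×ˢ N).image fun q => f (q.1 + q.2)) ∪
    ((N ×ˢ N).image fun q => f (q.1 - q.2))).filter fun x => ‖x‖ = 1, ?_,
    fun x hx => (Finset.mem_filter.1 hx).2, fun T hT t ht hM => ?_⟩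
  · have h25 : N.card * N.card ≤ 25 ^ Module.finrank ℝ E := by
      calc N.card * N.card ≤ 5 ^ Module.finrank ℝ E * 5 ^ Module.finrank ℝ E :=
            Nat.mul_le_mul hNc hNc
        _ = _ := by rw [← mul_pow]; norm_num
    refine (Finset.card_filter_le _ _).trans ((Finset.card_union_le _ _).trans ?_)
    rw [two_mul]
    refine add_le_add ?_ ?_ <;>
      exact Finset.card_image_le.trans (by rw [Finset.card_product]; exact h25)
  have hq : ∀ z : E, (f z ∈ (((N ×ˢ N).image fun q => f (q.1 + q.2)) ∪
      ((N ×ˢ N).image fun q => f (q.1 - q.2)))) → |inner ℝ (T z) z| ≤ t * ‖z‖ ^ 2 := fun z hz => by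
    rcases eq_or_ne z 0 with rfl | hz0
    · simp
    have hz1 : 0 < ‖z‖ := norm_pos_iff.2 hz0
    have h := hM (f z) (Finset.mem_filter.2 ⟨hz, by
      simp only [f, norm_smul, norm_inv, norm_norm]; exact inv_mul_cancel₀ hz1.ne'⟩)
    simp only [f, map_smul, real_inner_smul_left, real_inner_smul_right] at h
    rw [abs_mul, abs_mul, abs_inv, abs_norm, ← mul_assoc, ← mul_inv, ← sq,
      inv_mul_le_iff₀ (by positivity)] at h
    linarith
  have hbil : ∀ x ∈ N, ∀ y ∈ N, |inner ℝ (T x) y| ≤ t := fun x hx y hy => by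
    have hp := hq (x + y) (Finset.mem_union_left _ (Finset.mem_image.2
      ⟨(x, y), Finset.mem_product.2 ⟨hx, hy⟩, rfl⟩))
    have hm := hq (x - y) (Finset.mem_union_right _ (Finset.mem_image.2
      ⟨(x, y), Finset.mem_product.2 ⟨hx, hy⟩, rfl⟩))
    have hid : 4 * inner ℝ (T x) y = inner ℝ (T (x + y)) (x + y) - inner ℝ (T (x - y)) (x - y) := by
      simp only [map_add, map_sub, inner_add_left, inner_add_right, inner_sub_left,
        inner_sub_right, hT y x]
      ring
    have hpar := parallelogram_law_with_norm ℝ x y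
    rw [hN1 x hx, hN1 y hy] at hpar
    rw [abs_le] at hp hm ⊢
    constructor <;> nlinarith [hp.1, hp.2, hm.1, hm.2]
  have hNT : ∀ x ∈ N, ‖T x‖ ≤ 2 * t := fun x hx => by
    rcases eq_or_ne (T x) 0 with h0 | h0
    · rw [h0, norm_zero]; positivity
    have hp : 0 < ‖T x‖ := norm_pos_iff.2 h0
    set y := ‖T x‖⁻¹ • T x with hy
    have hy1 : ‖y‖ = 1 := by
      rw [hy, norm_smul, norm_inv, norm_norm]; exact inv_mul_cancel₀ hp.ne'
    obtain ⟨y', hy', hd⟩ := hN y hy1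
    have h1 : inner ℝ (T x) y = ‖T x‖ := by
      rw [hy, real_inner_smul_right, real_inner_self_eq_norm_sq]; field_simp
    have h2 : inner ℝ (T x) y = inner ℝ (T x) y' + inner ℝ (T x) (y - y') := by
      rw [inner_sub_right]; ring
    have h3 := (abs_le.1 (hbil x hx y' hy')).2
    have h4 : inner ℝ (T x) (y - y') ≤ ‖T x‖ * (1 / 2) :=
      (real_inner_le_norm _ _).trans (by gcongr)
    linarith
  have hop : ‖T‖ ≤ 2 * t + ‖T‖ / 2 := by
    refine T.opNorm_le_bound (by positivity) fun x => ?_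
    rcases eq_or_ne x 0 with rfl | h0
    · simp
    have hp : 0 < ‖x‖ := norm_pos_iff.2 h0
    set y := ‖x‖⁻¹ • x with hy
    have hy1 : ‖y‖ = 1 := by
      rw [hy, norm_smul, norm_inv, norm_norm]; exact inv_mul_cancel₀ hp.ne'
    obtain ⟨y', hy', hd⟩ := hN y hy1
    have hTy : ‖T y‖ ≤ 2 * t + ‖T‖ / 2 := by
      calc ‖T y‖ = ‖T y' + T (y - y')‖ := by rw [← map_add]; congr 2; abel
        _ ≤ ‖T y'‖ + ‖T (y - y')‖ := norm_add_le _ _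
        _ ≤ 2 * t + ‖T‖ * (1 / 2) := by
            refine add_le_add (hNT y' hy') ((T.le_opNorm _).trans ?_)
            gcongr
        _ = _ := by ring
    have hxy : x = ‖x‖ • y := by rw [hy, smul_smul, mul_inv_cancel₀ hp.ne', one_smul]
    calc ‖T x‖ = ‖x‖ * ‖T y‖ := by
          conv_lhs => rw [hxy]
          rw [map_smul, norm_smul, norm_norm]
      _ ≤ ‖x‖ * (2 * t + ‖T‖ / 2) := by gcongr
      _ = _ := mul_comm _ _
  linarith

variable {Ω : Type*} [MeasurableSpace Ω]

/-- The empirical covariance matrix of `n` independent isotropic sub-Gaussian vectors dominates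
half the identity matrix, with high probability, once `n` exceeds the dimension. -/
lemma measure_exists_sum_sq_lt_le {μ : Measure Ω} [IsProbabilityMeasure μ] {n r : ℕ}
    {z : Fin n → Ω → Fin r → ℝ} {v : ℝ≥0} {δ : ℝ} (hind : iIndepFun z μ)
    (hsub : ∀ i (u : Fin r → ℝ), u ⬝ᵥ u = 1 → HasSubgaussianMGF (fun ω => u ⬝ᵥ z i ω) v μ)
    (hvar : ∀ i (u : Fin r → ℝ), u ⬝ᵥ u = 1 → ∫ ω, (u ⬝ᵥ z i ω) ^ 2 ∂μ = 1)
    (hr : 0 < r) (hδ : 0 < δ) (hδ1 : δ < 1) (hv : 0 < v)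
    (hn : 2 ^ 19 * (v : ℝ) ^ 2 * (r + Real.log (1 / δ)) ≤ n) (hn0 : 0 < n) :
    μ {ω | ∃ u : Fin r → ℝ, ∑ i, (u ⬝ᵥ z i ω) ^ 2 < n / 2 * (u ⬝ᵥ u)} ≤
      ENNReal.ofReal (δ / 5) := by
  classical
  have hn' : (0 : ℝ) < n := by exact_mod_cast hn0
  set E := EuclideanSpace ℝ (Fin r)
  obtain ⟨M, hMc, hM1, hM⟩ := exists_quadratic_net E
  rw [finrank_euclideanSpace_fin] at hMc
  set q : ℝ := Real.exp (-(n : ℝ) / (65536 * v ^ 2))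
  have hunit : ∀ x ∈ M, x.ofLp ⬝ᵥ x.ofLp = 1 := fun x hx => by
    have := EuclideanSpace.real_norm_sq_eq x
    rw [hM1 x hx] at this
    simp only [dotProduct, ← sq]
    linarith
  have hpoint : ∀ x ∈ M, μ {ω | (n : ℝ) / 8 < |∑ i, (x.ofLp ⬝ᵥ z i ω) ^ 2 - n|} ≤
      ENNReal.ofReal (2 * q) := fun x hx =>
    measure_sum_sq_sub_gt_le (Z := fun i ω => x.ofLp ⬝ᵥ z i ω)
      (hind.comp (fun _ y => x.ofLp ⬝ᵥ y) fun _ => by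
        simp only [dotProduct]; fun_prop) (fun i => hsub i _ (hunit x hx))
      fun i => hvar i _ (hunit x hx)
  have hsubset : {ω | ∃ u : Fin r → ℝ, ∑ i, (u ⬝ᵥ z i ω) ^ 2 < n / 2 * (u ⬝ᵥ u)} ⊆
      ⋃ x ∈ M, {ω | (n : ℝ) / 8 < |∑ i, (x.ofLp ⬝ᵥ z i ω) ^ 2 - n|} := by
    rintro ω ⟨u, hu⟩
    by_contra hcon
    simp only [Set.mem_iUnion, Set.mem_ofPred_eq, not_exists, not_lt] at hcon
    let Z : Fin n → E := fun i => WithLp.toLp 2 (z i ω)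
    have hZ : ∀ i (x : E), inner ℝ (Z i) x = x.ofLp ⬝ᵥ z i ω := fun i x => by
      rw [EuclideanSpace.inner_eq_star_dotProduct]; simp [Z]
    let T : E →L[ℝ] E := (n : ℝ)⁻¹ • (∑ i, (innerSL ℝ (Z i)).smulRight (Z i)) -
      ContinuousLinearMap.id ℝ E
    have hTxy : ∀ x y : E, inner ℝ (T x) y =
        (n : ℝ)⁻¹ * (∑ i, inner ℝ (Z i) x * inner ℝ (Z i) y) - inner ℝ x y := fun x y => by
      simp [T, inner_sub_left, real_inner_smul_left, sum_inner]
    have hTq : ∀ x : E, inner ℝ (T x) x =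
        (n : ℝ)⁻¹ * (∑ i, (x.ofLp ⬝ᵥ z i ω) ^ 2) - ‖x‖ ^ 2 := fun x => by
      rw [hTxy, real_inner_self_eq_norm_sq]
      simp only [hZ, ← sq]
    have hnorm := hM T (fun x y => by
      rw [hTxy, hTxy, real_inner_comm]; congr 2
      exact Finset.sum_congr rfl fun i _ => mul_comm _ _) (1 / 8) (by norm_num) fun x hx => by
        have h := hcon x hx
        rw [hTq, hM1 x hx, show (n : ℝ)⁻¹ * (∑ i, (x.ofLp ⬝ᵥ z i ω) ^ 2) - 1 ^ 2 =
          (n : ℝ)⁻¹ * (∑ i, (x.ofLp ⬝ᵥ z i ω) ^ 2 - n) by field_simp, abs_mul,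
          abs_of_pos (by positivity), inv_mul_le_iff₀ hn']
        linarith
    set U : E := WithLp.toLp 2 u
    have hU : ‖U‖ ^ 2 = u ⬝ᵥ u := by
      rw [EuclideanSpace.real_norm_sq_eq]; simp [U, dotProduct, sq]
    have h1 := hTq U
    have h2 : |inner ℝ (T U) U| ≤ 1 / 2 * ‖U‖ ^ 2 := by
      calc |inner ℝ (T U) U| ≤ ‖T U‖ * ‖U‖ := abs_real_inner_le_norm _ _
        _ ≤ (‖T‖ * ‖U‖) * ‖U‖ := by gcongr; exact T.le_opNorm U
        _ ≤ (1 / 2 * ‖U‖) * ‖U‖ := by gcongr; linarith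
        _ = _ := by ring
    have h3 := (abs_le.1 h2).1
    rw [h1, hU] at h3
    have h4 : u ⬝ᵥ u / 2 ≤ (n : ℝ)⁻¹ * (∑ i, (u ⬝ᵥ z i ω) ^ 2) := by
      have : U.ofLp = u := rfl
      rw [this] at h3
      linarith
    rw [le_inv_mul_iff₀ hn'] at h4
    linarith
  have hexp : (2 * 25 ^ r : ℝ) * (2 * q) ≤ δ / 5 := by
    have hlogδ : 0 < Real.log (1 / δ) := Real.log_pos (by rw [lt_div_iff₀ hδ]; linarith)
    have h25 : Real.log 25 ≤ 4 := by
      rw [Real.log_le_iff_le_exp (by norm_num)]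
      have := Real.quadratic_le_exp_of_nonneg (x := 2) (by norm_num)
      rw [show (4 : ℝ) = 2 + 2 by norm_num, Real.exp_add]
      nlinarith
    have hr1 : (1 : ℝ) ≤ r := by exact_mod_cast hr
    have hkey : 8 * (r + Real.log (1 / δ)) ≤ n / (65536 * v ^ 2) := by
      rw [le_div_iff₀ (by positivity)]
      nlinarith
    have hq : q ≤ Real.exp (-(4 * r) - 4 - Real.log (1 / δ)) := by
      refine Real.exp_le_exp.2 ?_
      rw [neg_div]
      linarith
    have e2 : (25 : ℝ) ≤ Real.exp 4 := (Real.log_le_iff_le_exp (by norm_num)).1 h25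
    have e1 : (25 : ℝ) ^ r ≤ Real.exp (4 * r) := by
      rw [mul_comm 4 (r : ℝ), Real.exp_nat_mul]
      gcongr
    have hprod : (25 : ℝ) ^ r * q ≤ Real.exp (-4) * δ := by
      calc (25 : ℝ) ^ r * q ≤ Real.exp (4 * r) * Real.exp (-(4 * r) - 4 - Real.log (1 / δ)) := by
            gcongr
        _ = Real.exp (-4) * δ := by
            rw [← Real.exp_add, show 4 * (r : ℝ) + (-(4 * r) - 4 - Real.log (1 / δ)) =
              -4 + Real.log δ by rw [one_div, Real.log_inv]; ring, Real.exp_add, Real.exp_log hδ]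
    have e4 : Real.exp (-4) ≤ 1 / 25 := by
      rw [Real.exp_neg, one_div]
      exact inv_anti₀ (by norm_num) e2
    nlinarith
  calc _ ≤ μ (⋃ x ∈ M, {ω | (n : ℝ) / 8 < |∑ i, (x.ofLp ⬝ᵥ z i ω) ^ 2 - n|}) :=
        measure_mono hsubset
    _ ≤ ∑ x ∈ M, μ {ω | (n : ℝ) / 8 < |∑ i, (x.ofLp ⬝ᵥ z i ω) ^ 2 - n|} :=
        measure_biUnion_finset_le _ _
    _ ≤ ∑ _x ∈ M, ENNReal.ofReal (2 * q) := Finset.sum_le_sum hpoint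
    _ = ENNReal.ofReal (M.card * (2 * q)) := by
        rw [Finset.sum_const, nsmul_eq_mul, ENNReal.ofReal_mul (p := (M.card : ℝ)) (by positivity),
          ENNReal.ofReal_natCast]
    _ ≤ ENNReal.ofReal (δ / 5) := by
        refine ENNReal.ofReal_le_ofReal (le_trans ?_ hexp)
        have : (M.card : ℝ) ≤ 2 * 25 ^ r := by exact_mod_cast hMc
        gcongr

end SSL

namespace SSL

/-! ### Spectral decomposition of a covariance matrix -/

lemma sqNorm_eq_dotProduct {d : ℕ} (v : Fin d → ℝ) : sqNorm v = v ⬝ᵥ v := by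
  simp [sqNorm, dotProduct, sq]

lemma dotProduct_self_nonneg' {r : ℕ} (u : Fin r → ℝ) : 0 ≤ u ⬝ᵥ u :=
  Finset.sum_nonneg fun _ _ => mul_self_nonneg _

section Hermitian

variable {d : ℕ} {A : Matrix (Fin d) (Fin d) ℝ} (hA : A.IsHermitian)
include hA

lemma eigenvectorBasis_dotProduct (i j : Fin d) :
    (hA.eigenvectorBasis i).ofLp ⬝ᵥ (hA.eigenvectorBasis j).ofLp = if i = j then 1 else 0 := by
  have h := hA.eigenvectorBasis.inner_eq_ite i j
  rw [← h, EuclideanSpace.inner_eq_star_dotProduct]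
  simp [dotProduct_comm]

lemma sum_eigenvectorBasis_smul (v : Fin d → ℝ) :
    v = ∑ i, ((hA.eigenvectorBasis i).ofLp ⬝ᵥ v) • (hA.eigenvectorBasis i).ofLp := by
  have h := congrArg WithLp.ofLp (hA.eigenvectorBasis.sum_repr' (WithLp.toLp 2 v))
  rw [WithLp.ofLp_sum] at h
  conv_lhs => rw [show v = (WithLp.toLp 2 v : EuclideanSpace ℝ (Fin d)).ofLp from rfl, ← h]
  refine Finset.sum_congr rfl fun i _ => ?_
  rw [WithLp.ofLp_smul, EuclideanSpace.inner_eq_star_dotProduct]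
  simp [dotProduct_comm]

lemma dotProduct_mulVec_eq_sum (D : Fin d → ℝ) :
    D ⬝ᵥ A *ᵥ D = ∑ i, hA.eigenvalues i * ((hA.eigenvectorBasis i).ofLp ⬝ᵥ D) ^ 2 := by
  conv_lhs => rw [sum_eigenvectorBasis_smul hA D, mulVec_sum, ← sum_eigenvectorBasis_smul hA D]
  rw [dotProduct_sum]
  refine Finset.sum_congr rfl fun i _ => ?_
  rw [mulVec_smul, hA.mulVec_eigenvectorBasis, dotProduct_smul, dotProduct_smul,
    dotProduct_comm D, smul_eq_mul, smul_eq_mul]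
  ring

lemma dotProduct_self_eq_sum (D : Fin d → ℝ) :
    D ⬝ᵥ D = ∑ i, ((hA.eigenvectorBasis i).ofLp ⬝ᵥ D) ^ 2 := by
  conv_lhs => rw [sum_eigenvectorBasis_smul hA D, ← sum_eigenvectorBasis_smul hA D]
  conv_lhs => enter [2]; rw [sum_eigenvectorBasis_smul hA D]
  rw [dotProduct_sum]
  refine Finset.sum_congr rfl fun i _ => ?_
  rw [dotProduct_smul, dotProduct_comm D, smul_eq_mul, sq]

lemma dotProduct_mulVec_le_lambdaMax (D : Fin d → ℝ) :
    D ⬝ᵥ A *ᵥ D ≤ lambdaMax A * (D ⬝ᵥ D) := by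
  rw [dotProduct_mulVec_eq_sum hA, dotProduct_self_eq_sum hA, Finset.mul_sum]
  refine Finset.sum_le_sum fun i _ => mul_le_mul_of_nonneg_right ?_ (sq_nonneg _)
  exact le_csSup (Matrix.finite_real_spectrum (A := A)).bddAbove (hA.eigenvalues_mem_spectrum_real i)

lemma eigenvectorBasis_dotProduct_cfc_mulVec (f : ℝ → ℝ) (i : Fin d) (v : Fin d → ℝ) :
    (hA.eigenvectorBasis i).ofLp ⬝ᵥ (hA.cfc f) *ᵥ v =
      f (hA.eigenvalues i) * ((hA.eigenvectorBasis i).ofLp ⬝ᵥ v) := by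
  have hcfc : hA.cfc f = (hA.eigenvectorUnitary : Matrix (Fin d) (Fin d) ℝ) *
      diagonal (f ∘ hA.eigenvalues) * (star (hA.eigenvectorUnitary : Matrix (Fin d) (Fin d) ℝ)) := by
    rw [IsHermitian.cfc, Unitary.conjStarAlgAut_apply]
    rfl
  have hsymm : (hA.cfc f)ᵀ = hA.cfc f := by
    rw [hcfc, star_eq_conjTranspose, conjTranspose_eq_transpose_of_trivial]
    simp only [transpose_mul, transpose_transpose, diagonal_transpose, mul_assoc]
  have heig : hA.cfc f *ᵥ (hA.eigenvectorBasis i).ofLp =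
      f (hA.eigenvalues i) • (hA.eigenvectorBasis i).ofLp := by
    rw [hcfc, ← mulVec_mulVec, hA.star_eigenvectorUnitary_mulVec, ← mulVec_mulVec,
      diagonal_mulVec_single, ← smul_eq_mul, Pi.single_smul, mulVec_smul,
      hA.eigenvectorUnitary_mulVec]
    rfl
  rw [dotProduct_mulVec, ← mulVec_transpose, hsymm, heig, smul_dotProduct, smul_eq_mul]

end Hermitian

variable {Ω : Type*} [MeasurableSpace Ω]

section Covariance

variable {d : ℕ} {μ : Measure Ω} {Z : Ω → Fin d → ℝ}

lemma centre_apply [IsProbabilityMeasure μ] (hZ : MemLp Z 2 μ) (ω : Ω) (i : Fin d) :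
    centre μ Z ω i = Z ω i - ∫ ω', Z ω' i ∂μ := by
  have hi : Integrable Z μ := hZ.integrable (by norm_num)
  rw [centre, Pi.sub_apply, eval_integral fun i => hi.eval i]

lemma memLp_centre [IsProbabilityMeasure μ] (hZ : MemLp Z 2 μ) : MemLp (centre μ Z) 2 μ :=
  hZ.sub (memLp_const _)

lemma memLp_dotProduct_centre [IsProbabilityMeasure μ] (hZ : MemLp Z 2 μ) (D : Fin d → ℝ) :
    MemLp (fun ω => D ⬝ᵥ centre μ Z ω) 2 μ := by
  simp only [dotProduct]
  exact memLp_finsetSum _ fun i _ => ((memLp_centre hZ).eval i).const_mul (D i)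

lemma integral_dotProduct_centre_mul [IsProbabilityMeasure μ] (hZ : MemLp Z 2 μ)
    (D D' : Fin d → ℝ) :
    ∫ ω, (D ⬝ᵥ centre μ Z ω) * (D' ⬝ᵥ centre μ Z ω) ∂μ = D ⬝ᵥ covMatrix μ Z *ᵥ D' := by
  have hint : ∀ i j, Integrable (fun ω => centre μ Z ω i * centre μ Z ω j) μ := fun i j =>
    ((memLp_centre hZ).eval i).integrable_mul ((memLp_centre hZ).eval j)
  have hcov : ∀ i j, ∫ ω, centre μ Z ω i * centre μ Z ω j ∂μ = covMatrix μ Z i j := fun i j => by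
    simp only [centre_apply hZ]
    rfl
  have hpt : ∀ ω, (D ⬝ᵥ centre μ Z ω) * (D' ⬝ᵥ centre μ Z ω) =
      ∑ i, ∑ j, D i * D' j * (centre μ Z ω i * centre μ Z ω j) := fun ω => by
    simp only [dotProduct]
    rw [Finset.sum_mul_sum]
    refine Finset.sum_congr rfl fun i _ => Finset.sum_congr rfl fun j _ => by ring
  simp only [hpt]
  rw [integral_finsetSum _ fun i _ => integrable_finsetSum _ fun j _ => (hint i j).const_mul _]
  simp only [dotProduct, mulVec, Finset.mul_sum]
  refine Finset.sum_congr rfl fun i _ => ?_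
  rw [integral_finsetSum _ fun j _ => (hint i j).const_mul _]
  refine Finset.sum_congr rfl fun j _ => ?_
  rw [integral_const_mul, hcov]
  ring

lemma integral_dotProduct_centre_sq [IsProbabilityMeasure μ] (hZ : MemLp Z 2 μ)
    (D : Fin d → ℝ) :
    ∫ ω, (D ⬝ᵥ centre μ Z ω) ^ 2 ∂μ = D ⬝ᵥ covMatrix μ Z *ᵥ D := by
  simp only [sq, integral_dotProduct_centre_mul hZ]

lemma eigenvalues_covMatrix_nonneg [IsProbabilityMeasure μ] (hZ : MemLp Z 2 μ) (i : Fin d) :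
    0 ≤ (covMatrix_isHermitian μ Z).eigenvalues i := by
  have h := integral_dotProduct_centre_sq hZ ((covMatrix_isHermitian μ Z).eigenvectorBasis i).ofLp
  rw [(covMatrix_isHermitian μ Z).mulVec_eigenvectorBasis, dotProduct_smul,
    eigenvectorBasis_dotProduct, if_pos rfl, smul_eq_mul, mul_one] at h
  rw [← h]
  exact integral_nonneg fun ω => sq_nonneg _

/-- An orthonormal family of eigenvectors `e k` for the nonzero eigenvalues `l k` of the covariance
matrix of `Z`. It spans the range of the covariance matrix, to which the centred vector belongs
almost surely. -/
structure EigenFrame {d : ℕ} (μ : Measure Ω) (Z : Ω → Fin d → ℝ) (r : ℕ) where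
  e : Fin r → Fin d → ℝ
  l : Fin r → ℝ
  l_pos : ∀ k, 0 < l k
  l_mem : ∀ k, l k ∈ spectrum ℝ (covMatrix μ Z)
  orthonormal : ∀ j k, e j ⬝ᵥ e k = if j = k then 1 else 0
  mulVec_e : ∀ k, covMatrix μ Z *ᵥ e k = l k • e k
  dotProduct_whiten : ∀ k ω, e k ⬝ᵥ whiten μ Z ω = (√(l k))⁻¹ * (e k ⬝ᵥ centre μ Z ω)
  expand : ∀ᵐ ω ∂μ, centre μ Z ω = ∑ k, (e k ⬝ᵥ centre μ Z ω) • e k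

lemma nonempty_eigenFrame [IsProbabilityMeasure μ] (hZ : MemLp Z 2 μ) :
    Nonempty (EigenFrame μ Z (covMatrix μ Z).rank) := by
  have hS := covMatrix_isHermitian μ Z
  let b : Fin d → Fin d → ℝ := fun i => (hS.eigenvectorBasis i).ofLp
  let E : {i // hS.eigenvalues i ≠ 0} ≃ Fin (covMatrix μ Z).rank :=
    Fintype.equivFinOfCardEq hS.rank_eq_card_non_zero_eigs.symm
  have hzero : ∀ i, hS.eigenvalues i = 0 → ∀ᵐ ω ∂μ, b i ⬝ᵥ centre μ Z ω = 0 := fun i hi => by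
    have h := integral_dotProduct_centre_sq hZ (b i)
    rw [hS.mulVec_eigenvectorBasis, hi, zero_smul, dotProduct_zero] at h
    have h0 := (integral_eq_zero_iff_of_nonneg (fun ω => sq_nonneg _)
      (memLp_dotProduct_centre hZ (b i)).integrable_sq).1 h
    filter_upwards [h0] with ω hω
    exact pow_eq_zero_iff two_ne_zero |>.1 hω
  refine ⟨⟨fun k => b (E.symm k), fun k => hS.eigenvalues (E.symm k), fun k => ?_,
    fun k => hS.eigenvalues_mem_spectrum_real _, fun j k => ?_,
    fun k => hS.mulVec_eigenvectorBasis _, fun k ω => ?_, ?_⟩⟩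
  · exact lt_of_le_of_ne (eigenvalues_covMatrix_nonneg hZ _) (E.symm k).2.symm
  · simp only [b]
    rw [eigenvectorBasis_dotProduct]
    simp only [Subtype.val_inj, E.symm.injective.eq_iff]
  · exact eigenvectorBasis_dotProduct_cfc_mulVec hS (fun x => (√x)⁻¹) _ _
  · have hall : ∀ᵐ ω ∂μ, ∀ i, hS.eigenvalues i = 0 → b i ⬝ᵥ centre μ Z ω = 0 :=
      ae_all_iff.2 fun i => by
        by_cases hi : hS.eigenvalues i = 0
        · filter_upwards [hzero i hi] with ω h _ using h
        · exact ae_of_all _ fun ω h => absurd h hi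
    filter_upwards [hall] with ω hω
    have hex := sum_eigenvectorBasis_smul hS (centre μ Z ω)
    rw [E.symm.sum_comp (fun i : {i // hS.eigenvalues i ≠ 0} =>
      (b i ⬝ᵥ centre μ Z ω) • b i)]
    conv_lhs => rw [hex]
    rw [← Finset.sum_filter_add_sum_filter_not Finset.univ (fun i => hS.eigenvalues i ≠ 0),
      Finset.sum_eq_zero (s := Finset.univ.filter fun i => ¬ hS.eigenvalues i ≠ 0), add_zero]
    · exact Finset.sum_subtype _ (by simp) _
    · intro i hi
      simp only [Finset.mem_filter, Finset.mem_univ, true_and, not_not] at hi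
      have := hω i hi
      simp only [b] at this
      rw [this, zero_smul]

lemma lambdaMinNeZero_covMatrix_pos [IsProbabilityMeasure μ] (hZ : MemLp Z 2 μ) {r : ℕ}
    (F : EigenFrame μ Z r) (hr : 0 < r) : 0 < lambdaMinNeZero (covMatrix μ Z) := by
  have hne : (spectrum ℝ (covMatrix μ Z) \ {0}).Nonempty :=
    ⟨F.l ⟨0, hr⟩, F.l_mem _, (F.l_pos _).ne'⟩
  obtain ⟨h1, h2⟩ := hne.csInf_mem
    ((Matrix.finite_real_spectrum (A := covMatrix μ Z)).subset Set.sdiff_subset)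
  rw [(covMatrix_isHermitian μ Z).spectrum_real_eq_range_eigenvalues] at h1
  obtain ⟨i, hi⟩ := h1
  rw [lambdaMinNeZero]
  refine lt_of_le_of_ne ?_ (Ne.symm h2)
  rw [← (covMatrix_isHermitian μ Z).spectrum_real_eq_range_eigenvalues] at hi
  rw [← hi]
  exact eigenvalues_covMatrix_nonneg hZ i

namespace EigenFrame

variable {r : ℕ} (F : EigenFrame μ Z r)

/-- The whitened coordinates of a vector in the eigenbasis. -/
noncomputable def coord (v : Fin d → ℝ) (k : Fin r) : ℝ := (√(F.l k))⁻¹ * (F.e k ⬝ᵥ v)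

/-- The coefficients of a linear functional in whitened coordinates. -/
noncomputable def load (D : Fin d → ℝ) (k : Fin r) : ℝ := √(F.l k) * (D ⬝ᵥ F.e k)

/-- The linear functional with given coefficients in whitened coordinates, in the range of the
covariance matrix. -/
noncomputable def lift (u : Fin r → ℝ) : Fin d → ℝ := ∑ k, (u k * (√(F.l k))⁻¹) • F.e k

lemma measurable_coord : Measurable F.coord := by
  unfold coord dotProduct
  fun_prop

lemma sqrt_l_ne_zero (k : Fin r) : √(F.l k) ≠ 0 := (Real.sqrt_pos.2 (F.l_pos k)).ne'

lemma lift_dotProduct (u : Fin r → ℝ) (v : Fin d → ℝ) : F.lift u ⬝ᵥ v = u ⬝ᵥ F.coord v := by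
  simp only [lift, sum_dotProduct, smul_dotProduct, smul_eq_mul]
  exact Finset.sum_congr rfl fun k _ => by rw [coord]; ring

lemma sum_smul_e_dotProduct_sum_smul_e (x y : Fin r → ℝ) :
    (∑ k, x k • F.e k) ⬝ᵥ (∑ k, y k • F.e k) = ∑ k, x k * y k := by
  simp only [sum_dotProduct, dotProduct_sum, smul_dotProduct, dotProduct_smul, smul_eq_mul,
    F.orthonormal]
  simp [mul_comm]

lemma lift_dotProduct_lift_le {c : ℝ} (hc : 0 < c) (hcl : ∀ k, c ≤ F.l k) (u : Fin r → ℝ) :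
    F.lift u ⬝ᵥ F.lift u ≤ (u ⬝ᵥ u) / c := by
  rw [lift, sum_smul_e_dotProduct_sum_smul_e, dotProduct, Finset.sum_div]
  refine Finset.sum_le_sum fun k _ => ?_
  calc u k * (√(F.l k))⁻¹ * (u k * (√(F.l k))⁻¹) = u k * u k * (√(F.l k) ^ 2)⁻¹ := by ring
    _ = u k * u k / F.l k := by rw [Real.sq_sqrt (F.l_pos k).le, div_eq_mul_inv]
    _ ≤ u k * u k / c := div_le_div_of_nonneg_left (mul_self_nonneg _) hc (hcl k)

lemma dotProduct_eq_of_expand {v : Fin d → ℝ} (h : v = ∑ k, (F.e k ⬝ᵥ v) • F.e k)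
    (D : Fin d → ℝ) : D ⬝ᵥ v = F.load D ⬝ᵥ F.coord v := by
  conv_lhs => rw [h]
  rw [dotProduct_sum]
  refine Finset.sum_congr rfl fun k _ => ?_
  have := F.sqrt_l_ne_zero k
  rw [dotProduct_smul, smul_eq_mul, load, coord]
  field_simp

lemma integral_dotProduct_coord_sq [IsProbabilityMeasure μ] (hZ : MemLp Z 2 μ) (u : Fin r → ℝ) :
    ∫ ω, (u ⬝ᵥ F.coord (centre μ Z ω)) ^ 2 ∂μ = u ⬝ᵥ u := by
  simp only [← lift_dotProduct]
  rw [integral_dotProduct_centre_sq hZ]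
  have : covMatrix μ Z *ᵥ F.lift u = ∑ k, (u k * √(F.l k)) • F.e k := by
    rw [lift, mulVec_sum]
    refine Finset.sum_congr rfl fun k _ => ?_
    rw [mulVec_smul, F.mulVec_e, smul_smul]
    congr 1
    have := F.sqrt_l_ne_zero k
    field_simp
    rw [Real.sq_sqrt (F.l_pos k).le]
  rw [this, lift, sum_smul_e_dotProduct_sum_smul_e]
  refine Finset.sum_congr rfl fun k _ => ?_
  have := F.sqrt_l_ne_zero k
  field_simp

lemma load_dotProduct_load [IsProbabilityMeasure μ] (hZ : MemLp Z 2 μ) (D : Fin d → ℝ) :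
    F.load D ⬝ᵥ F.load D = ∫ ω, (D ⬝ᵥ centre μ Z ω) ^ 2 ∂μ := by
  rw [← F.integral_dotProduct_coord_sq hZ]
  refine integral_congr_ae ?_
  filter_upwards [F.expand] with ω h
  rw [F.dotProduct_eq_of_expand h]

lemma coord_centre (ω : Ω) (k : Fin r) :
    F.coord (centre μ Z ω) k = F.e k ⬝ᵥ whiten μ Z ω := (F.dotProduct_whiten k ω).symm

lemma dotProduct_coord_centre (u : Fin r → ℝ) (ω : Ω) :
    u ⬝ᵥ F.coord (centre μ Z ω) = (∑ k, u k • F.e k) ⬝ᵥ whiten μ Z ω := by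
  simp only [sum_dotProduct, smul_dotProduct, smul_eq_mul, ← F.coord_centre]
  rfl

lemma coord_dotProduct_coord_le (ω : Ω) :
    F.coord (centre μ Z ω) ⬝ᵥ F.coord (centre μ Z ω) ≤ sqNorm (whiten μ Z ω) := by
  -- Bessel's inequality, from the square of the distance to the span of the frame
  set w := whiten μ Z ω
  set c := F.coord (centre μ Z ω)
  have hpw : (∑ k, c k • F.e k) ⬝ᵥ w = c ⬝ᵥ c := (F.dotProduct_coord_centre c ω).symm
  have hpp := F.sum_smul_e_dotProduct_sum_smul_e c c
  have h0 := dotProduct_self_nonneg' (w - ∑ k, c k • F.e k)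
  rw [sub_dotProduct, dotProduct_sub, dotProduct_sub, dotProduct_comm w (∑ k, c k • F.e k), hpw, hpp] at h0
  rw [sqNorm_eq_dotProduct]
  have : ∑ k, c k * c k = c ⬝ᵥ c := rfl
  linarith

lemma hasSubgaussianMGF_dotProduct_coord {v : ℝ≥0} (h : IsSubGaussian μ (whiten μ Z) v)
    (u : Fin r → ℝ) (hu : u ⬝ᵥ u = 1) :
    HasSubgaussianMGF (fun ω => u ⬝ᵥ F.coord (centre μ Z ω)) v μ := by
  simp only [dotProduct_coord_centre]
  refine h.2.2 _ ?_
  rw [sqNorm_eq_dotProduct, sum_smul_e_dotProduct_sum_smul_e]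
  exact hu

end EigenFrame

lemma HasSubgaussianMGF.of_le {X : Ω → ℝ} {a b : ℝ≥0} (hX : HasSubgaussianMGF X a μ)
    (hab : a ≤ b) : HasSubgaussianMGF X b μ :=
  ⟨hX.integrable_exp_mul, fun t => (hX.mgf_le t).trans (by
    have : (a : ℝ) ≤ b := hab
    gcongr)⟩

/-- Sub-Gaussian unit directions give all directions, with the squared length as a factor. -/
lemma hasSubgaussianMGF_dotProduct_of_unit [IsProbabilityMeasure μ] {r : ℕ} {w : Ω → Fin r → ℝ}
    {v : ℝ≥0} (h : ∀ u : Fin r → ℝ, u ⬝ᵥ u = 1 → HasSubgaussianMGF (fun ω => u ⬝ᵥ w ω) v μ)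
    (u : Fin r → ℝ) {K : ℝ≥0} (hK : u ⬝ᵥ u ≤ K) :
    HasSubgaussianMGF (fun ω => u ⬝ᵥ w ω) (K * v) μ := by
  rcases eq_or_ne u 0 with rfl | hu
  · simp only [zero_dotProduct]
    exact HasSubgaussianMGF.of_le HasSubgaussianMGF.fun_zero zero_le
  have hpos : 0 < u ⬝ᵥ u := (dotProduct_self_nonneg' u).lt_of_ne' (by
    rwa [Ne, dotProduct_self_eq_zero])
  set c := √(u ⬝ᵥ u)
  have hc : 0 < c := Real.sqrt_pos.2 hpos
  have hc2 : c ^ 2 = u ⬝ᵥ u := Real.sq_sqrt hpos.le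
  have hunit : (c⁻¹ • u) ⬝ᵥ (c⁻¹ • u) = 1 := by
    rw [smul_dotProduct, dotProduct_smul, ← hc2, smul_eq_mul, smul_eq_mul]
    field_simp
  have h1 := (h _ hunit).const_mul c
  have h2 : (fun ω => c * (c⁻¹ • u) ⬝ᵥ w ω) = fun ω => u ⬝ᵥ w ω := by
    ext ω
    rw [smul_dotProduct, smul_eq_mul, mul_inv_cancel_left₀ hc.ne']
  rw [h2] at h1
  refine HasSubgaussianMGF.of_le h1 ?_
  refine mul_le_mul_of_nonneg_right ?_ zero_le
  exact NNReal.coe_le_coe.1 (hc2.le.trans hK)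

end Covariance

end SSL

namespace SSL

/-! ### Sample cross-moments -/

/-- The matrix `a wᵀ` as an element of the Euclidean space with the Frobenius norm. -/
noncomputable def outer {p r : ℕ} (a : Fin p → ℝ) (w : Fin r → ℝ) :
    EuclideanSpace ℝ (Fin p × Fin r) :=
  WithLp.toLp 2 fun q => a q.1 * w q.2

lemma norm_outer_sq {p r : ℕ} (a : Fin p → ℝ) (w : Fin r → ℝ) :
    ‖outer a w‖ ^ 2 = (a ⬝ᵥ a) * (w ⬝ᵥ w) := by
  rw [EuclideanSpace.real_norm_sq_eq, Fintype.sum_prod_type]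
  simp only [outer, dotProduct, Finset.sum_mul_sum]
  exact Finset.sum_congr rfl fun i _ => Finset.sum_congr rfl fun j _ => by ring

lemma norm_outer {p r : ℕ} (a : Fin p → ℝ) (w : Fin r → ℝ) :
    ‖outer a w‖ = √(a ⬝ᵥ a) * √(w ⬝ᵥ w) := by
  rw [← Real.sqrt_mul (dotProduct_self_nonneg' a), ← norm_outer_sq, Real.sqrt_sq (norm_nonneg _)]

lemma measurable_outer {𝒳 : Type*} [MeasurableSpace 𝒳] {p r : ℕ} {a : 𝒳 → Fin p → ℝ}
    {w : 𝒳 → Fin r → ℝ} (ha : Measurable a) (hw : Measurable w) :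
    Measurable fun x => outer (a x) (w x) := by
  unfold outer
  refine (WithLp.measurable_toLp 2 _).comp ?_
  fun_prop

variable {Ω : Type*} [MeasurableSpace Ω]

lemma one_add_log_le {n d : ℕ} {δ ℓ c : ℝ} (hn : 0 < n) (hd : 0 < d) (hδ : 0 < δ) (hδ1 : δ < 1)
    (hℓ : ℓ = 1 + Real.log (n * d / δ)) (hc : 0 < c) (hc20 : c ≤ 20) :
    1 + Real.log (c / δ) ≤ 5 * ℓ := by
  have hn1 : (1 : ℝ) ≤ n := by exact_mod_cast hn
  have hd1 : (1 : ℝ) ≤ d := by exact_mod_cast hd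
  have hnd : (1 : ℝ) ≤ n * d := by nlinarith
  have h20 : Real.log c ≤ 4 := by
    refine (Real.log_le_log hc hc20).trans ?_
    rw [Real.log_le_iff_le_exp (by norm_num)]
    have := Real.quadratic_le_exp_of_nonneg (x := 2) (by norm_num)
    rw [show (4 : ℝ) = 2 + 2 by norm_num, Real.exp_add]
    nlinarith
  have h1 : Real.log (c / δ) = Real.log c - Real.log δ := Real.log_div hc.ne' hδ.ne'
  have h2 : Real.log (n * d / δ) = Real.log (n * d) - Real.log δ :=
    Real.log_div (by positivity) hδ.ne'
  have h3 : 0 ≤ Real.log (n * d) := Real.log_nonneg hnd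
  have h4 : Real.log δ < 0 := Real.log_neg hδ hδ1
  rw [hℓ, h1, h2]
  linarith

lemma one_le_logFactor {n d : ℕ} {δ ℓ : ℝ} (hn : 0 < n) (hd : 0 < d) (hδ : 0 < δ) (hδ1 : δ < 1)
    (hℓ : ℓ = 1 + Real.log (n * d / δ)) : 1 ≤ ℓ := by
  have hn1 : (1 : ℝ) ≤ n := by exact_mod_cast hn
  have hd1 : (1 : ℝ) ≤ d := by exact_mod_cast hd
  rw [hℓ]
  refine le_add_of_nonneg_right (Real.log_nonneg ?_)
  rw [le_div_iff₀ hδ]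
  nlinarith

lemma exp_neg_logFactor {n d : ℕ} {δ ℓ : ℝ} (hn : 0 < n) (hd : 0 < d) (hδ : 0 < δ)
    (hℓ : ℓ = 1 + Real.log (n * d / δ)) : Real.exp (-ℓ) = Real.exp (-1) * (δ / (n * d)) := by
  rw [hℓ, neg_add, Real.exp_add, Real.exp_neg (Real.log _), Real.exp_log (by positivity), inv_div]

section Sample

variable {𝒳 : Type*} [MeasurableSpace 𝒳] {μ : Measure Ω} [IsProbabilityMeasure μ] {n : ℕ}
  {ζ : Ω → 𝒳} {ξ : Fin n → Ω → 𝒳}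

lemma measure_norm_sum_comp_gt_le {H : Type*} [NormedAddCommGroup H] [InnerProductSpace ℝ H]
    [FiniteDimensional ℝ H] [MeasurableSpace H] [BorelSpace H] (hind : iIndepFun ξ μ)
    (hid : ∀ i, IdentDistrib (ξ i) ζ μ μ) {f : 𝒳 → H} (hf : Measurable f) {v R δ : ℝ}
    (hR : ∀ᵐ ω ∂μ, ‖f (ζ ω)‖ ≤ R) (h0 : ∫ ω, f (ζ ω) ∂μ = 0)
    (hv : ∫ ω, ‖f (ζ ω)‖ ^ 2 ∂μ ≤ v) (hv0 : 0 ≤ v) (hR0 : 0 ≤ R) (hδ : 0 < δ) :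
    μ {ω | (√(n * v) + R) * (1 + Real.log (2 / δ)) < ‖∑ i, f (ξ i ω)‖} ≤ ENNReal.ofReal δ := by
  have hid' : ∀ i, IdentDistrib (fun ω => f (ξ i ω)) (fun ω => f (ζ ω)) μ μ :=
    fun i => (hid i).comp hf
  refine measure_norm_sum_gt_le (Y := fun i ω => f (ξ i ω)) (fun i => (hid' i).aemeasurable_fst)
    (hind.comp (fun _ => f) fun _ => hf) (fun i => ?_) (fun i => ?_) (fun i => ?_) hv0 hR0 hδ
  · exact (hid' i).symm.ae_snd (measurableSet_le measurable_norm measurable_const) hR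
  · rw [(hid' i).integral_eq, h0]
  · exact ((hid' i).comp (u := fun y => ‖y‖ ^ 2) (by fun_prop)).integral_eq.trans_le hv

/-- Concentration of the cross-moment of two functions with bounded product. -/
lemma measure_sum_outer_sub_gt_le (hind : iIndepFun ξ μ) (hid : ∀ i, IdentDistrib (ξ i) ζ μ μ)
    {p r d : ℕ} {a : 𝒳 → Fin p → ℝ} {w : 𝒳 → Fin r → ℝ} (ha : Measurable a) (hw : Measurable w)
    {b m δ ℓ : ℝ} (hb : 0 ≤ b) (hm : 0 ≤ m) (hbd : ∀ᵐ ω ∂μ, ‖outer (a (ζ ω)) (w (ζ ω))‖ ≤ b * √m)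
    (hn : 0 < n) (hd : 0 < d) (hδ : 0 < δ) (hδ1 : δ < 1) (hℓ : ℓ = 1 + Real.log (n * d / δ)) :
    μ {ω | 400 * b ^ 2 * m * n * ℓ ^ 2 < ‖∑ i, (outer (a (ξ i ω)) (w (ξ i ω)) -
      ∫ ω', outer (a (ζ ω')) (w (ζ ω')) ∂μ)‖ ^ 2} ≤ ENNReal.ofReal (δ / 5) := by
  set E := ∫ ω', outer (a (ζ ω')) (w (ζ ω')) ∂μ with hE
  have hm' := measurable_outer ha hw
  have hζ : AEMeasurable ζ μ := (hid ⟨0, hn⟩).aemeasurable_snd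
  have hint : Integrable (fun ω => outer (a (ζ ω)) (w (ζ ω))) μ :=
    Integrable.of_bound (hm'.comp_aemeasurable hζ).aestronglyMeasurable _ hbd
  have hEn : ‖E‖ ≤ b * √m := by
    have := norm_integral_le_of_norm_le_const hbd
    simpa using this
  have hR : ∀ᵐ ω ∂μ, ‖outer (a (ζ ω)) (w (ζ ω)) - E‖ ≤ 2 * (b * √m) := by
    filter_upwards [hbd] with ω h
    refine (norm_sub_le _ _).trans ?_
    linarith
  have h2 : ∫ ω, ‖outer (a (ζ ω)) (w (ζ ω)) - E‖ ^ 2 ∂μ ≤ (2 * (b * √m)) ^ 2 := by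
    have h := norm_integral_le_of_norm_le_const (μ := μ)
      (f := fun ω => ‖outer (a (ζ ω)) (w (ζ ω)) - E‖ ^ 2) (C := (2 * (b * √m)) ^ 2) (by
        filter_upwards [hR] with ω h
        rw [norm_pow, norm_norm]
        gcongr)
    simp only [probReal_univ, mul_one] at h
    exact (le_abs_self _).trans h
  have hB := measure_norm_sum_comp_gt_le hind hid (f := fun x => outer (a x) (w x) - E)
    (hm'.sub_const E) hR (by rw [integral_sub hint (integrable_const _), integral_const]; simp [hE])
    h2 (by positivity) (by positivity) (show 0 < δ / 5 by positivity)
  refine (measure_mono fun ω hω => ?_).trans hB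
  simp only [Set.mem_ofPred_eq] at hω ⊢
  have hlog : 1 + Real.log (2 / (δ / 5)) ≤ 5 * ℓ := by
    rw [show 2 / (δ / 5) = 10 / δ by field_simp; norm_num]
    exact one_add_log_le hn hd hδ hδ1 hℓ (by norm_num) (by norm_num)
  have hℓ1 := one_le_logFactor hn hd hδ hδ1 hℓ
  have hn1 : 1 ≤ √(n : ℝ) := Real.one_le_sqrt.2 (by exact_mod_cast hn)
  have hlt : 4 * (b * √m) * √n * (5 * ℓ) < ‖∑ i, (outer (a (ξ i ω)) (w (ξ i ω)) - E)‖ := by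
    refine lt_of_pow_lt_pow_left₀ 2 (norm_nonneg _) (lt_of_eq_of_lt ?_ hω)
    rw [mul_pow, mul_pow, mul_pow, mul_pow, Real.sq_sqrt hm, Real.sq_sqrt (Nat.cast_nonneg n)]
    ring
  refine lt_of_le_of_lt ?_ hlt
  rw [Real.sqrt_mul (Nat.cast_nonneg n), Real.sqrt_sq (by positivity)]
  have hbm : 0 ≤ b * √m := by positivity
  calc (√n * (2 * (b * √m)) + 2 * (b * √m)) * (1 + Real.log (2 / (δ / 5)))
      ≤ (√n * (2 * (b * √m)) + 2 * (b * √m)) * (5 * ℓ) := by gcongr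
    _ ≤ (4 * (b * √m) * √n) * (5 * ℓ) := by
        gcongr
        nlinarith

/-- All `n` sample vectors have length `O(ρ √(r log))`. -/
lemma measure_exists_dotProduct_self_gt_le (hid : ∀ i, IdentDistrib (ξ i) ζ μ μ) {r d : ℕ}
    {w : 𝒳 → Fin r → ℝ} (hw : Measurable w) {ρ2 : ℝ≥0} (hρ : 0 < ρ2)
    (hsub : ∀ u : Fin r → ℝ, u ⬝ᵥ u = 1 → HasSubgaussianMGF (fun ω => u ⬝ᵥ w (ζ ω)) ρ2 μ)
    (hrd : r ≤ d) {δ ℓ : ℝ} (hn : 0 < n) (hd : 0 < d) (hδ : 0 < δ) (hδ1 : δ < 1)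
    (hℓ : ℓ = 1 + Real.log (n * d / δ)) :
    μ {ω | ∃ i, 8 * ρ2 * ℓ * r < w (ξ i ω) ⬝ᵥ w (ξ i ω)} ≤ ENNReal.ofReal (δ / 10) := by
  have hℓ1 := one_le_logFactor hn hd hδ hδ1 hℓ
  set x := √(8 * ρ2 * ℓ) with hx
  have hx2 : x ^ 2 = 8 * ρ2 * ℓ := Real.sq_sqrt (by positivity)
  set q := Real.exp (-4 * ℓ)
  have hsub' : ∀ i, ∀ u : Fin r → ℝ, u ⬝ᵥ u = 1 →
      μ {ω | x ≤ u ⬝ᵥ w (ξ i ω)} ≤ ENNReal.ofReal q := fun i u hu => by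
    have hidu : IdentDistrib (fun ω => u ⬝ᵥ w (ξ i ω)) (fun ω => u ⬝ᵥ w (ζ ω)) μ μ :=
      (hid i).comp (u := fun y => u ⬝ᵥ w y) (by simp only [dotProduct]; fun_prop)
    have h := ((hsub u hu).congr_identDistrib hidu.symm).measure_ge_le (Real.sqrt_nonneg (8 * ρ2 * ℓ))
    rw [← ofReal_measureReal]
    refine ENNReal.ofReal_le_ofReal (h.trans (le_of_eq ?_))
    rw [← hx, hx2]
    simp only [q]
    congr 1
    field_simp
    ring
  have hone : ∀ k : Fin r, (Pi.single k (1 : ℝ)) ⬝ᵥ (Pi.single k (1 : ℝ)) = 1 := fun k => by simp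
  have hneg : ∀ k : Fin r, (-Pi.single k (1 : ℝ)) ⬝ᵥ (-Pi.single k (1 : ℝ)) = 1 := fun k => by simp
  have hsubset : {ω | ∃ i, 8 * ρ2 * ℓ * r < w (ξ i ω) ⬝ᵥ w (ξ i ω)} ⊆
      ⋃ i, ⋃ k : Fin r, ({ω | x ≤ Pi.single k (1 : ℝ) ⬝ᵥ w (ξ i ω)} ∪
        {ω | x ≤ -Pi.single k (1 : ℝ) ⬝ᵥ w (ξ i ω)}) := by
    rintro ω ⟨i, hi⟩
    by_contra hcon
    simp only [Set.mem_iUnion, Set.mem_union, Set.mem_ofPred_eq, not_exists, not_or, not_le,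
      neg_dotProduct, single_dotProduct, one_mul] at hcon
    have : w (ξ i ω) ⬝ᵥ w (ξ i ω) ≤ ∑ _k : Fin r, x ^ 2 := by
      refine Finset.sum_le_sum fun k _ => ?_
      rw [← sq, sq_le_sq, abs_of_nonneg (Real.sqrt_nonneg _)]
      exact abs_le.2 ⟨by linarith [(hcon i k).2], (hcon i k).1.le⟩
    rw [Finset.sum_const, hx2, Finset.card_univ, Fintype.card_fin, nsmul_eq_mul] at this
    linarith
  have hq : n * (r * (2 * q)) ≤ δ / 10 := by
    have hq1 : q ≤ Real.exp (-3) * Real.exp (-ℓ) := by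
      rw [← Real.exp_add]
      exact Real.exp_le_exp.2 (by linarith)
    have he : Real.exp (-3) * Real.exp (-1) ≤ 1 / 20 := by
      rw [← Real.exp_add, show (-3 : ℝ) + -1 = -(2 + 2) by norm_num, Real.exp_neg, Real.exp_add,
        one_div]
      refine inv_anti₀ (by norm_num) ?_
      have := Real.quadratic_le_exp_of_nonneg (x := 2) (by norm_num)
      nlinarith
    rw [exp_neg_logFactor hn hd hδ hℓ] at hq1
    have hq2 : q ≤ 1 / 20 * (δ / (n * d)) := by
      refine hq1.trans ?_
      rw [← mul_assoc]
      gcongr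
    calc n * (r * (2 * q)) ≤ n * (d * (2 * (1 / 20 * (δ / (n * d))))) := by gcongr
      _ = δ / 10 := by field_simp; norm_num
  calc _ ≤ _ := measure_mono hsubset
    _ ≤ ∑ i, μ (⋃ k : Fin r, ({ω | x ≤ Pi.single k (1 : ℝ) ⬝ᵥ w (ξ i ω)} ∪
        {ω | x ≤ -Pi.single k (1 : ℝ) ⬝ᵥ w (ξ i ω)})) := measure_iUnion_fintype_le _ _
    _ ≤ ∑ _i : Fin n, ∑ _k : Fin r, (ENNReal.ofReal q + ENNReal.ofReal q) :=
        Finset.sum_le_sum fun i _ => (measure_iUnion_fintype_le _ _).trans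
          (Finset.sum_le_sum fun k _ => (measure_union_le _ _).trans
            (add_le_add (hsub' i _ (hone k)) (hsub' i _ (hneg k))))
    _ = ENNReal.ofReal (n * (r * (2 * q))) := by
        simp only [Finset.sum_const, Finset.card_univ, Fintype.card_fin, nsmul_eq_mul]
        rw [← ENNReal.ofReal_add (Real.exp_pos _).le (Real.exp_pos _).le, ← two_mul,
          ENNReal.ofReal_mul (p := (n : ℝ)) (by positivity),
          ENNReal.ofReal_mul (p := (r : ℝ)) (by positivity), ENNReal.ofReal_natCast,
          ENNReal.ofReal_natCast]
    _ ≤ _ := ENNReal.ofReal_le_ofReal hq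

end Sample

end SSL

namespace SSL

/-! ### The noise -/

variable {Ω : Type*} [MeasurableSpace Ω] {𝒳 : Type*} [MeasurableSpace 𝒳] {μ : Measure Ω}
  [IsProbabilityMeasure μ] {n : ℕ} {ζ : Ω → 𝒳} {ξ : Fin n → Ω → 𝒳}

/-- If the noise level `σ` is smaller than `1 / √log`, then the labels are all but deterministic,
and the total noise of the sample is negligible. -/
lemma measure_sum_noise_gt_le (hid : ∀ i, IdentDistrib (ξ i) ζ μ μ) {p d : ℕ}
    {η : 𝒳 → Fin p → ℝ} (hη : Measurable η) {σ2 : ℝ} (hσ : 0 < σ2)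
    (hsmall : ∀ j, ∫ ω, η (ζ ω) j ^ 2 ∂μ ≤ 4 * Real.exp (-(1 / (8 * σ2))))
    (hint : ∀ j, Integrable (fun ω => η (ζ ω) j ^ 2) μ)
    (hpd : p ≤ d) {δ ℓ : ℝ} (hn : 0 < n) (hd : 0 < d) (hδ : 0 < δ) (hδ1 : δ < 1)
    (hℓ : ℓ = 1 + Real.log (n * d / δ)) (hσℓ : 128 * σ2 * ℓ < 1) :
    μ {ω | σ2 / n < ∑ i, η (ξ i ω) ⬝ᵥ η (ξ i ω)} ≤ ENNReal.ofReal (δ / 10) := by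
  have hd' : (0 : ℝ) < d := by exact_mod_cast hd
  have hd1 : (1 : ℝ) ≤ d := by exact_mod_cast hd
  have hidη : ∀ i j, IdentDistrib (fun ω => η (ξ i ω) j ^ 2) (fun ω => η (ζ ω) j ^ 2) μ μ :=
    fun i j => (hid i).comp (u := fun y => η y j ^ 2) (by fun_prop)
  have hints : ∀ i, Integrable (fun ω => η (ξ i ω) ⬝ᵥ η (ξ i ω)) μ := fun i => by
    simp only [dotProduct, ← sq]
    exact integrable_finsetSum _ fun j _ => (hidη i j).integrable_iff.2 (hint j)
  have hE : ∫ ω, ∑ i, η (ξ i ω) ⬝ᵥ η (ξ i ω) ∂μ ≤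
      n * (p * (4 * Real.exp (-(1 / (8 * σ2))))) := by
    rw [integral_finsetSum _ fun i _ => hints i]
    calc ∑ i, ∫ ω, η (ξ i ω) ⬝ᵥ η (ξ i ω) ∂μ
        ≤ ∑ _i : Fin n, (p * (4 * Real.exp (-(1 / (8 * σ2))))) := by
          refine Finset.sum_le_sum fun i _ => ?_
          simp only [dotProduct, ← sq]
          rw [integral_finsetSum _ fun j _ => (hidη i j).integrable_iff.2 (hint j)]
          calc ∑ j, ∫ ω, η (ξ i ω) j ^ 2 ∂μ ≤ ∑ _j : Fin p, 4 * Real.exp (-(1 / (8 * σ2))) :=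
                Finset.sum_le_sum fun j _ => (hidη i j).integral_eq.trans_le (hsmall j)
            _ = _ := by simp
      _ = _ := by simp
  have hM := mul_meas_ge_le_integral_of_nonneg (μ := μ)
    (f := fun ω => ∑ i, η (ξ i ω) ⬝ᵥ η (ξ i ω))
    (ae_of_all _ fun ω => Finset.sum_nonneg fun i _ => dotProduct_self_nonneg' _)
    (integrable_finsetSum _ fun i _ => hints i) (σ2 / n)
  have hfin : n * (p * (4 * Real.exp (-(1 / (8 * σ2))))) ≤ σ2 / n * (δ / 10) := by
    set x := 1 / (16 * σ2) with hx
    have hx0 : 0 < x := by positivity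
    have hσx : σ2 = 1 / (16 * x) := by rw [hx]; field_simp
    have hxℓ : 8 * ℓ ≤ x := by
      rw [hx, le_div_iff₀ (by positivity)]
      linarith
    have e1 : Real.exp (-(1 / (8 * σ2))) = Real.exp (-x) * Real.exp (-x) := by
      rw [← Real.exp_add, hx]; congr 1; field_simp; norm_num
    have e2 : x * Real.exp (-x) ≤ 1 := by
      rw [Real.exp_neg, ← div_eq_mul_inv, div_le_one (Real.exp_pos _)]
      linarith [Real.add_one_le_exp x]
    have e3 : Real.exp (-x) ≤ Real.exp (-ℓ) ^ 8 := by
      rw [← Real.exp_nat_mul]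
      exact Real.exp_le_exp.2 (by push_cast; linarith)
    have e4 : Real.exp (-ℓ) ^ 8 ≤ 1 / 640 * (δ / (n * d)) ^ 2 := by
      have hq := exp_neg_logFactor hn hd hδ hℓ
      have hn1 : (1 : ℝ) ≤ n := by exact_mod_cast hn
      have hq1 : δ / (n * d) ≤ 1 := by
        rw [div_le_one (by positivity)]
        nlinarith
      have hq0 : 0 ≤ δ / (n * d) := by positivity
      have he : Real.exp (-1) ^ 8 ≤ 1 / 640 := by
        rw [Real.exp_neg, inv_pow, one_div]
        refine inv_anti₀ (by norm_num) ?_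
        calc (640 : ℝ) ≤ 2.7 ^ 8 := by norm_num
          _ ≤ Real.exp 1 ^ 8 := by
            gcongr
            linarith [Real.exp_one_gt_d9]
      rw [hq, mul_pow]
      refine mul_le_mul he ?_ (by positivity) (by norm_num)
      exact pow_le_pow_of_le_one hq0 hq1 (by norm_num)
    rw [e1, hσx]
    calc n * (p * (4 * (Real.exp (-x) * Real.exp (-x))))
        = n * p * 4 * (x * Real.exp (-x)) * Real.exp (-x) / x := by field_simp
      _ ≤ n * d * 4 * 1 * (1 / 640 * (δ / (n * d)) ^ 2) / x := by
          gcongr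
          exact e3.trans e4
      _ = 1 / (16 * x) / n * (δ / 10) * (δ / d) := by field_simp; norm_num
      _ ≤ 1 / (16 * x) / n * (δ / 10) * 1 := by
          gcongr
          rw [div_le_one hd']
          linarith
      _ = _ := mul_one _
  have hreal : μ.real {ω | σ2 / n ≤ ∑ i, η (ξ i ω) ⬝ᵥ η (ξ i ω)} ≤ δ / 10 :=
    le_of_mul_le_mul_left (hM.trans (hE.trans hfin)) (by positivity)
  calc μ {ω | σ2 / n < ∑ i, η (ξ i ω) ⬝ᵥ η (ξ i ω)}
      ≤ μ {ω | σ2 / n ≤ ∑ i, η (ξ i ω) ⬝ᵥ η (ξ i ω)} := by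
        refine measure_mono fun ω hω => ?_
        simp only [Set.mem_ofPred_eq] at hω ⊢
        exact hω.le
    _ ≤ ENNReal.ofReal (δ / 10) := by
        rw [← ofReal_measureReal]
        exact ENNReal.ofReal_le_ofReal hreal

/-- The cross-moment of the label noise `η` with an isotropic sub-Gaussian function `w` of the
features. Two regimes: if `σ² log` is at least a constant, then the bound `‖η‖² ≤ 2` of one-hot
noise is as good as `σ²` up to logarithms, and Bernstein's inequality applies after truncating `w`;
the truncation level enters with a factor `1 / n`, which absorbs `ρ²`. Otherwise the total noise is
negligible. -/
lemma measure_sum_noise_outer_gt_le (hind : iIndepFun ξ μ) (hid : ∀ i, IdentDistrib (ξ i) ζ μ μ)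
    {p r d : ℕ} {η : 𝒳 → Fin p → ℝ} {w : 𝒳 → Fin r → ℝ} (hη : Measurable η) (hw : Measurable w)
    {σ2 : ℝ} (hσ : 0 < σ2) {ρ2 : ℝ≥0} (hρn : (ρ2 : ℝ) ≤ n)
    (hη2 : ∀ᵐ ω ∂μ, η (ζ ω) ⬝ᵥ η (ζ ω) ≤ 2)
    (hsmall : ∀ j, ∫ ω, η (ζ ω) j ^ 2 ∂μ ≤ 4 * Real.exp (-(1 / (8 * σ2))))
    (horth : ∀ (M : ℝ) j k,
      ∫ ω, η (ζ ω) j * (if w (ζ ω) ⬝ᵥ w (ζ ω) ≤ M then w (ζ ω) k else 0) ∂μ = 0)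
    (hsub : ∀ u : Fin r → ℝ, u ⬝ᵥ u = 1 → HasSubgaussianMGF (fun ω => u ⬝ᵥ w (ζ ω)) ρ2 μ)
    (hvar : ∀ u : Fin r → ℝ, ∫ ω, (u ⬝ᵥ w (ζ ω)) ^ 2 ∂μ = u ⬝ᵥ u)
    (hpd : p ≤ d) (hrd : r ≤ d) {δ ℓ : ℝ} (hn : 0 < n) (hd : 0 < d) (hδ : 0 < δ) (hδ1 : δ < 1)
    (hℓ : ℓ = 1 + Real.log (n * d / δ)) :
    μ {ω | 115200 * ℓ ^ 4 * σ2 * n * r < ‖∑ i, outer (η (ξ i ω)) (w (ξ i ω))‖ ^ 2} ≤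
      ENNReal.ofReal (δ / 5) := by
  classical
  rcases Nat.eq_zero_or_pos r with rfl | hr
  · refine le_of_eq_of_le (measure_mono_null (t := ∅) (fun ω hω => ?_) measure_empty) zero_le
    have h0 : ∀ (a : Fin p → ℝ) (w : Fin 0 → ℝ), outer a w = 0 := fun a w => by
      ext q; exact q.2.elim0
    simp [h0] at hω
  have hℓ1 := one_le_logFactor hn hd hδ hδ1 hℓ
  have hρ : 0 < ρ2 := by
    refine HasSubgaussianMGF.pos_of_integral_sq_eq_one (hsub (Pi.single ⟨0, hr⟩ 1) (by simp)) ?_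
    rw [hvar]; simp
  have hζ : AEMeasurable ζ μ := (hid ⟨0, hn⟩).aemeasurable_snd
  have hηj : ∀ᵐ ω ∂μ, ∀ j, η (ζ ω) j ^ 2 ≤ 2 := by
    filter_upwards [hη2] with ω h j
    refine le_trans ?_ h
    simp only [dotProduct, ← sq]
    exact Finset.single_le_sum (f := fun j => η (ζ ω) j ^ 2) (fun _ _ => sq_nonneg _)
      (Finset.mem_univ j)
  have hlarge := measure_exists_dotProduct_self_gt_le hid hw hρ hsub hrd hn hd hδ hδ1 hℓ
  set K : ℝ := 8 * ρ2 * ℓ * r with hK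
  -- on the complement of the first event, and of a second one, the bound holds
  suffices ∃ B : Set Ω, μ B ≤ ENNReal.ofReal (δ / 10) ∧ ∀ ω, ω ∉ B →
      (∀ i, w (ξ i ω) ⬝ᵥ w (ξ i ω) ≤ K) →
      ‖∑ i, outer (η (ξ i ω)) (w (ξ i ω))‖ ^ 2 ≤ 115200 * ℓ ^ 4 * σ2 * n * r by
    obtain ⟨B, hB, hBω⟩ := this
    calc _ ≤ μ ({ω | ∃ i, K < w (ξ i ω) ⬝ᵥ w (ξ i ω)} ∪ B) := by
          refine measure_mono fun ω hω => ?_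
          by_contra hcon
          simp only [Set.mem_union, Set.mem_ofPred_eq, not_or, not_exists, not_lt] at hcon hω
          exact absurd (hBω ω hcon.2 hcon.1) (not_le.2 hω)
      _ ≤ ENNReal.ofReal (δ / 10) + ENNReal.ofReal (δ / 10) :=
          (measure_union_le _ _).trans (add_le_add hlarge hB)
      _ = ENNReal.ofReal (δ / 5) := by
          rw [← ENNReal.ofReal_add (by positivity) (by positivity)]; congr 1; ring
  rcases lt_or_ge (128 * σ2 * ℓ) 1 with hcase | hcase
  · refine ⟨_, measure_sum_noise_gt_le hid hη hσ hsmall (fun j => ?_) hpd hn hd hδ hδ1 hℓ hcase,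
      fun ω hω hwK => ?_⟩
    · refine Integrable.of_bound (C := 2) (AEMeasurable.aestronglyMeasurable
        ((by fun_prop : Measurable fun x => η x j ^ 2).comp_aemeasurable hζ)) ?_
      filter_upwards [hηj] with ω h
      rw [Real.norm_of_nonneg (sq_nonneg _)]
      exact h j
    · simp only [Set.mem_ofPred_eq, not_lt] at hω
      have h1 : ‖∑ i, outer (η (ξ i ω)) (w (ξ i ω))‖ ≤
          ∑ i, √(η (ξ i ω) ⬝ᵥ η (ξ i ω)) * √(w (ξ i ω) ⬝ᵥ w (ξ i ω)) :=
        (norm_sum_le _ _).trans (le_of_eq (Finset.sum_congr rfl fun i _ => norm_outer _ _))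
      have h2 := Finset.sum_mul_sq_le_sq_mul_sq Finset.univ
        (fun i => √(η (ξ i ω) ⬝ᵥ η (ξ i ω))) (fun i => √(w (ξ i ω) ⬝ᵥ w (ξ i ω)))
      simp only [Real.sq_sqrt (dotProduct_self_nonneg' _)] at h2
      have h3 : ∑ i, w (ξ i ω) ⬝ᵥ w (ξ i ω) ≤ n * K := by
        calc _ ≤ ∑ _i : Fin n, K := Finset.sum_le_sum fun i _ => hwK i
          _ = _ := by simp
      have h3' : 0 ≤ ∑ i, w (ξ i ω) ⬝ᵥ w (ξ i ω) :=
        Finset.sum_nonneg fun i _ => dotProduct_self_nonneg' _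
      calc _ ≤ (∑ i, √(η (ξ i ω) ⬝ᵥ η (ξ i ω)) * √(w (ξ i ω) ⬝ᵥ w (ξ i ω))) ^ 2 := by gcongr
        _ ≤ _ := h2
        _ ≤ σ2 / n * (n * K) := by gcongr
        _ = 8 * σ2 * r * (ρ2 * ℓ) := by rw [hK]; field_simp
        _ ≤ 8 * σ2 * r * (n * ℓ ^ 4) := by
            gcongr
            exact le_self_pow₀ hℓ1 (by norm_num)
        _ ≤ _ := by
            have : 0 ≤ σ2 * r * (n * ℓ ^ 4) := by positivity
            nlinarith
  · -- the truncated summands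
    let f : 𝒳 → EuclideanSpace ℝ (Fin p × Fin r) := fun x =>
      outer (η x) (if w x ⬝ᵥ w x ≤ K then w x else 0)
    have hwt : Measurable fun x => if w x ⬝ᵥ w x ≤ K then w x else 0 := by
      refine Measurable.ite (measurableSet_le ?_ measurable_const) hw measurable_const
      simp only [dotProduct]; fun_prop
    have hf : Measurable f := measurable_outer hη hwt
    have hfn : ∀ᵐ ω ∂μ, ‖f (ζ ω)‖ ^ 2 ≤ 2 * K ∧ ‖f (ζ ω)‖ ^ 2 ≤ 2 * (w (ζ ω) ⬝ᵥ w (ζ ω)) := by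
      filter_upwards [hη2] with ω h
      simp only [f, norm_outer_sq]
      have h0 := dotProduct_self_nonneg' (w (ζ ω))
      split_ifs with hc
      · exact ⟨by gcongr, by gcongr⟩
      · simp only [zero_dotProduct, mul_zero]
        constructor <;> positivity
    have hR : ∀ᵐ ω ∂μ, ‖f (ζ ω)‖ ≤ √(2 * K) := by
      filter_upwards [hfn] with ω h
      exact Real.le_sqrt_of_sq_le h.1
    have hfi : Integrable (fun ω => f (ζ ω)) μ :=
      Integrable.of_bound (hf.comp_aemeasurable hζ).aestronglyMeasurable _ hR
    have h0 : ∫ ω, f (ζ ω) ∂μ = 0 := by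
      ext q
      have h := (EuclideanSpace.proj (𝕜 := ℝ) q).integral_comp_comm hfi
      refine h.symm.trans ?_
      rw [PiLp.zero_apply, ← horth K q.1 q.2]
      refine integral_congr_ae (ae_of_all _ fun ω => ?_)
      simp only [f, outer]
      split_ifs <;> rfl
    have hwk : ∀ k, ∫ ω, w (ζ ω) k ^ 2 ∂μ = 1 := fun k => by
      have := hvar (Pi.single k 1)
      simpa using this
    have hwi : ∀ k, Integrable (fun ω => w (ζ ω) k ^ 2) μ := fun k => by
      have := HasSubgaussianMGF.integrable_sq (hsub (Pi.single k 1) (by simp))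
      simpa using this
    have hv : ∫ ω, ‖f (ζ ω)‖ ^ 2 ∂μ ≤ 2 * r := by
      have hwwi : Integrable (fun ω => 2 * (w (ζ ω) ⬝ᵥ w (ζ ω))) μ := by
        simp only [dotProduct, ← sq]
        exact (integrable_finsetSum _ fun k _ => hwi k).const_mul 2
      calc _ ≤ ∫ ω, 2 * (w (ζ ω) ⬝ᵥ w (ζ ω)) ∂μ := by
            refine integral_mono_of_nonneg (ae_of_all _ fun ω => sq_nonneg _) hwwi ?_
            filter_upwards [hfn] with ω h using h.2
        _ = 2 * r := by
            rw [integral_const_mul]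
            simp only [dotProduct, ← sq]
            rw [integral_finsetSum _ fun k _ => hwi k]
            simp [hwk]
    have hB := measure_norm_sum_comp_gt_le hind hid hf hR h0 hv (by positivity)
      (Real.sqrt_nonneg _) (show 0 < δ / 10 by positivity)
    refine ⟨_, hB, fun ω hω hwK => ?_⟩
    simp only [Set.mem_ofPred_eq, not_lt] at hω
    have hsum : ∑ i, f (ξ i ω) = ∑ i, outer (η (ξ i ω)) (w (ξ i ω)) :=
      Finset.sum_congr rfl fun i _ => by simp only [f, if_pos (hwK i)]
    rw [hsum] at hω
    have hlog : 1 + Real.log (2 / (δ / 10)) ≤ 5 * ℓ := by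
      rw [show 2 / (δ / 10) = 20 / δ by field_simp; norm_num]
      exact one_add_log_le hn hd hδ hδ1 hℓ (by norm_num) le_rfl
    have ha : √(n * (2 * r)) ≤ 2 * √(n * r * ℓ) := by
      rw [Real.sqrt_le_left (by positivity), mul_pow, Real.sq_sqrt (by positivity)]
      have : (n : ℝ) * r ≤ n * r * ℓ := le_mul_of_one_le_right (by positivity) hℓ1
      have : (0 : ℝ) ≤ n * r := by positivity
      linarith
    have hb : √(2 * K) ≤ 4 * √(n * r * ℓ) := by
      rw [Real.sqrt_le_left (by positivity), mul_pow, Real.sq_sqrt (by positivity), hK]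
      have : ρ2 * (ℓ * r) ≤ n * (ℓ * r) := by gcongr
      nlinarith
    have hlt : ‖∑ i, outer (η (ξ i ω)) (w (ξ i ω))‖ ≤ 30 * ℓ * √(n * r * ℓ) := by
      refine hω.trans ?_
      calc _ ≤ (√(n * (2 * r)) + √(2 * K)) * (5 * ℓ) := by gcongr
        _ ≤ (2 * √(n * r * ℓ) + 4 * √(n * r * ℓ)) * (5 * ℓ) := by gcongr
        _ = _ := by ring
    calc _ ≤ (30 * ℓ * √(n * r * ℓ)) ^ 2 := by gcongr
      _ = 900 * ℓ ^ 3 * n * r * 1 := by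
          rw [mul_pow, Real.sq_sqrt (by positivity)]; ring
      _ ≤ 900 * ℓ ^ 3 * n * r * (128 * σ2 * ℓ) := by gcongr
      _ = _ := by ring

end SSL

namespace SSL

/-! ### The population -/

variable {Ω : Type*} [MeasurableSpace Ω] {μ : Measure Ω}

lemma oneHot_eq_zero_or_one {p : ℕ} (l : Fin (p + 1)) (j : Fin p) :
    oneHot l j = 0 ∨ oneHot l j = 1 := by
  unfold oneHot
  split_ifs <;> simp

lemma oneHot_nonneg {p : ℕ} (l : Fin (p + 1)) (j : Fin p) : 0 ≤ oneHot l j := by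
  rcases oneHot_eq_zero_or_one l j with h | h <;> simp [h]

lemma oneHot_le_one {p : ℕ} (l : Fin (p + 1)) (j : Fin p) : oneHot l j ≤ 1 := by
  rcases oneHot_eq_zero_or_one l j with h | h <;> simp [h]

lemma sum_oneHot_le_one {p : ℕ} (l : Fin (p + 1)) : ∑ j, oneHot l j ≤ 1 := by
  have h : ∑ j : Fin (p + 1), (if l = j then (1 : ℝ) else 0) = 1 := by simp
  rw [Fin.sum_univ_castSucc] at h
  have : (0 : ℝ) ≤ if l = Fin.last p then 1 else 0 := by split_ifs <;> norm_num
  simp only [oneHot]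
  linarith

lemma measurable_oneHot {p : ℕ} : Measurable (oneHot (p := p)) := Measurable.of_discrete

/-- The label noise as a function of features and label. -/
def noise {d₁ p : ℕ} (m : (Fin d₁ → ℝ) → Fin p → ℝ) (q : (Fin d₁ → ℝ) × Fin (p + 1)) : Fin p → ℝ :=
  oneHot q.2 - m q.1

lemma measurable_noise {d₁ p : ℕ} {m : (Fin d₁ → ℝ) → Fin p → ℝ} (hm : Measurable m) :
    Measurable (noise m) :=
  (measurable_oneHot.comp measurable_snd).sub (hm.comp measurable_fst)

namespace IsPopulation

variable {d₁ d₂ p : ℕ} {X₁ : Ω → Fin d₁ → ℝ} {X₂ : Ω → Fin d₂ → ℝ} {L : Ω → Fin (p + 1)}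
  {ψ : (Fin d₁ → ℝ) → Fin d₂ → ℝ} {m : (Fin d₁ → ℝ) → Fin p → ℝ}
  (hP : IsPopulation μ X₁ X₂ L ψ m)
include hP

lemma measurable_pair : Measurable fun ω => (X₁ ω, L ω) :=
  hP.measurable_X₁.prodMk hP.measurable_L

lemma measurable_oneHot_L : Measurable fun ω => oneHot (L ω) :=
  measurable_oneHot.comp hP.measurable_L

lemma comap_le : MeasurableSpace.comap X₁ inferInstance ≤ (inferInstance : MeasurableSpace Ω) :=
  hP.measurable_X₁.comap_le

lemma memLp_ψ : MemLp (fun ω => ψ (X₁ ω)) 2 μ :=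
  (memLp_congr_ae hP.isRegression_ψ.2).2 (MemLp.condExp (by norm_num) hP.memLp_X₂)

variable [IsProbabilityMeasure μ]

lemma integrable_oneHot_L : Integrable (fun ω => oneHot (L ω)) μ := by
  refine Integrable.of_bound hP.measurable_oneHot_L.aestronglyMeasurable 1 (ae_of_all _ fun ω => ?_)
  refine (pi_norm_le_iff_of_nonneg zero_le_one).2 fun j => ?_
  rw [Real.norm_of_nonneg (oneHot_nonneg _ _)]
  exact oneHot_le_one _ _

lemma m_apply_ae (j : Fin p) : (fun ω => m (X₁ ω) j) =ᵐ[μ]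
    μ[fun ω => oneHot (L ω) j | MeasurableSpace.comap X₁ inferInstance] := by
  have h := (ContinuousLinearMap.proj (R := ℝ) (φ := fun _ : Fin p => ℝ) j).comp_condExp_comm
    (m := MeasurableSpace.comap X₁ inferInstance) hP.integrable_oneHot_L
  filter_upwards [hP.isRegression_m.2, h] with ω h1 h2
  rw [h1]
  exact h2

lemma m_nonneg_ae : ∀ᵐ ω ∂μ, ∀ j, 0 ≤ m (X₁ ω) j := ae_all_iff.2 fun j => by
  have h := condExp_nonneg (m := MeasurableSpace.comap X₁ inferInstance) (μ := μ)
    (f := fun ω => oneHot (L ω) j) (ae_of_all _ fun ω => oneHot_nonneg _ _)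
  filter_upwards [hP.m_apply_ae j, h] with ω h1 h2
  rw [h1]
  exact h2

lemma sum_m_le_one_ae : ∀ᵐ ω ∂μ, ∑ j, m (X₁ ω) j ≤ 1 := by
  let T : (Fin p → ℝ) →L[ℝ] ℝ := ∑ j, ContinuousLinearMap.proj j
  have hT : ∀ v, T v = ∑ j, v j := fun v => by simp [T]
  have h := T.comp_condExp_comm (m := MeasurableSpace.comap X₁ inferInstance)
    hP.integrable_oneHot_L
  have h1 := condExp_mono (m := MeasurableSpace.comap X₁ inferInstance) (μ := μ)
    (T.integrable_comp hP.integrable_oneHot_L) (integrable_const (1 : ℝ))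
    (ae_of_all _ fun ω => by simpa only [hT] using sum_oneHot_le_one (L ω))
  rw [condExp_const hP.comap_le] at h1
  filter_upwards [hP.isRegression_m.2, h, h1] with ω h2 h3 h4
  rw [h2, ← hT]
  exact h3.trans_le h4

lemma m_le_one_ae : ∀ᵐ ω ∂μ, ∀ j, m (X₁ ω) j ≤ 1 := by
  filter_upwards [hP.m_nonneg_ae, hP.sum_m_le_one_ae] with ω h1 h2 j
  exact (Finset.single_le_sum (fun j _ => h1 j) (Finset.mem_univ j)).trans h2

lemma memLp_m : MemLp (fun ω => m (X₁ ω)) 2 μ := by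
  refine MemLp.of_bound (hP.isRegression_m.1.comp hP.measurable_X₁).aestronglyMeasurable 1 ?_
  filter_upwards [hP.m_nonneg_ae, hP.m_le_one_ae] with ω h1 h2
  refine (pi_norm_le_iff_of_nonneg zero_le_one).2 fun j => ?_
  rw [Real.norm_of_nonneg (h1 j)]
  exact h2 j

/-- The noise is orthogonal to every bounded function of the features. -/
lemma integral_mul_noise_eq_zero {h : (Fin d₁ → ℝ) → ℝ} (hh : Measurable h) {C : ℝ}
    (hC : ∀ x, ‖h x‖ ≤ C) (j : Fin p) : ∫ ω, h (X₁ ω) * noise m (X₁ ω, L ω) j ∂μ = 0 := by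
  have hZ : Integrable (fun ω => oneHot (L ω) j) μ := hP.integrable_oneHot_L.eval j
  have hm : Integrable (fun ω => m (X₁ ω) j) μ := (hP.memLp_m.integrable (by norm_num)).eval j
  have hhX : AEStronglyMeasurable (fun ω => h (X₁ ω)) μ :=
    (hh.comp hP.measurable_X₁).aestronglyMeasurable
  have hpull := condExp_stronglyMeasurable_mul_of_bound hP.comap_le
    (f := fun ω => h (X₁ ω)) (hh.comp (comap_measurable X₁)).stronglyMeasurable hZ C
    (ae_of_all _ fun ω => hC _)
  have h1 : ∫ ω, h (X₁ ω) * oneHot (L ω) j ∂μ = ∫ ω, h (X₁ ω) * m (X₁ ω) j ∂μ := by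
    rw [← integral_condExp hP.comap_le]
    refine integral_congr_ae ?_
    filter_upwards [hpull, hP.m_apply_ae j] with ω h1 h2
    rw [h2]
    exact h1
  simp only [noise, Pi.sub_apply, mul_sub]
  rw [integral_sub (hZ.bdd_mul hhX (ae_of_all _ fun ω => hC _))
    (hm.bdd_mul hhX (ae_of_all _ fun ω => hC _)), h1, sub_self]

lemma noise_dotProduct_self_le_ae :
    ∀ᵐ ω ∂μ, noise m (X₁ ω, L ω) ⬝ᵥ noise m (X₁ ω, L ω) ≤ 2 := by
  filter_upwards [hP.m_nonneg_ae, hP.m_le_one_ae, hP.sum_m_le_one_ae] with ω h0 h1 h2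
  calc noise m (X₁ ω, L ω) ⬝ᵥ noise m (X₁ ω, L ω)
      ≤ ∑ j, (oneHot (L ω) j + m (X₁ ω) j) := by
        refine Finset.sum_le_sum fun j _ => ?_
        simp only [noise, Pi.sub_apply]
        rcases oneHot_eq_zero_or_one (L ω) j with h | h <;> rw [h] <;> nlinarith [h0 j, h1 j]
    _ ≤ 2 := by
        rw [Finset.sum_add_distrib]
        linarith [sum_oneHot_le_one (L ω)]

/-- A sub-Gaussian binary noise has small variance: conditionally on the features, the variance
`m (1 - m)` is at most the probability `min m (1 - m)` that the noise exceeds `1 / 2` in absolute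
value. The pointwise form used here adds to that indicator a term of mean zero. -/
lemma integral_noise_sq_le {σ2 : ℝ≥0}
    (hsub : IsSubGaussian μ (fun ω => oneHot (L ω) - m (X₁ ω)) σ2) (j : Fin p) :
    ∫ ω, noise m (X₁ ω, L ω) j ^ 2 ∂μ ≤ 4 * Real.exp (-(1 / (8 * σ2))) := by
  classical
  set N : Ω → ℝ := fun ω => noise m (X₁ ω, L ω) j with hN
  have hNm : Measurable N :=
    (measurable_pi_apply j).comp ((measurable_noise hP.isRegression_m.1).comp hP.measurable_pair)
  have hNsub : HasSubgaussianMGF N σ2 μ := by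
    have h := hsub.2.2 (Pi.single j 1) (by rw [sqNorm_eq_dotProduct]; simp)
    refine h.congr (ae_of_all _ fun ω => ?_)
    simp [hN, noise]
  have htail : ∀ {Y : Ω → ℝ}, HasSubgaussianMGF Y σ2 μ →
      μ.real {ω | 1 / 2 ≤ Y ω} ≤ Real.exp (-(1 / (8 * σ2))) := fun {Y} hY => by
    refine (hY.measure_ge_le (by norm_num)).trans (le_of_eq ?_)
    congr 1
    rw [neg_div, div_pow]
    congr 1
    rw [div_div]
    congr 1
    · norm_num
    · ring
  set A : Set Ω := {ω | 1 / 2 ≤ |N ω|}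
  have hA : MeasurableSet A := measurableSet_le measurable_const hNm.norm
  have hAle : μ.real A ≤ 2 * Real.exp (-(1 / (8 * σ2))) := by
    calc μ.real A ≤ μ.real ({ω | 1 / 2 ≤ N ω} ∪ {ω | 1 / 2 ≤ (-N) ω}) := by
          refine measureReal_mono fun ω hω => ?_
          simp only [A, Set.mem_ofPred_eq, Set.mem_union, Pi.neg_apply] at hω ⊢
          exact le_abs.1 hω
      _ ≤ _ := measureReal_union_le _ _
      _ ≤ Real.exp (-(1 / (8 * σ2))) + Real.exp (-(1 / (8 * σ2))) :=
          add_le_add (htail hNsub) (htail hNsub.neg)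
      _ = _ := (two_mul _).symm
  let h : (Fin d₁ → ℝ) → ℝ := fun x => if m x j ≤ 1 / 2 then -1 else 1
  have hh : Measurable h := by
    refine Measurable.ite (measurableSet_le ?_ measurable_const) measurable_const measurable_const
    exact (measurable_pi_apply j).comp hP.isRegression_m.1
  have hh1 : ∀ x, ‖h x‖ ≤ 1 := fun x => by simp only [h]; split_ifs <;> simp
  have horth := hP.integral_mul_noise_eq_zero hh hh1 j
  have hNi : Integrable N μ := hNsub.integrable
  have hhN : Integrable (fun ω => h (X₁ ω) * N ω) μ :=
    hNi.bdd_mul (hh.comp hP.measurable_X₁).aestronglyMeasurable (ae_of_all _ fun ω => hh1 _)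
  have hAi : Integrable (fun ω => 2 * A.indicator (fun _ => (1 : ℝ)) ω) μ :=
    ((integrable_const (1 : ℝ)).indicator hA).const_mul 2
  calc ∫ ω, N ω ^ 2 ∂μ
      ≤ ∫ ω, (2 * A.indicator (fun _ => (1 : ℝ)) ω + h (X₁ ω) * N ω) ∂μ := by
        refine integral_mono_ae (HasSubgaussianMGF.integrable_sq hNsub) (hAi.add hhN) ?_
        filter_upwards [hP.m_nonneg_ae, hP.m_le_one_ae] with ω h0 h1
        have h0 := h0 j
        have h1 := h1 j
        have hNω : N ω = oneHot (L ω) j - m (X₁ ω) j := rfl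
        have hind0 : 0 ≤ A.indicator (fun _ => (1 : ℝ)) ω :=
          Set.indicator_nonneg (fun _ _ => zero_le_one) ω
        have hind1 : 1 / 2 ≤ |N ω| → A.indicator (fun _ => (1 : ℝ)) ω = 1 :=
          fun hω => Set.indicator_of_mem (s := A) hω _
        simp only [h]
        rcases oneHot_eq_zero_or_one (L ω) j with hl | hl <;> rw [hl] at hNω <;> split_ifs with hc
        · nlinarith
        · rw [hind1 (by rw [hNω, zero_sub, abs_neg, abs_of_nonneg h0]; linarith)]
          nlinarith
        · rw [hind1 (by rw [hNω, abs_of_nonneg (by linarith)]; linarith)]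
          nlinarith
        · nlinarith
    _ = 2 * μ.real A := by
        rw [integral_add hAi hhN, horth, integral_const_mul, integral_indicator_const _ hA]
        simp
    _ ≤ _ := by linarith

end IsPopulation

/-! ### The approximation error -/

section ErrApx

variable {d₁ d₂ p : ℕ} {X₁ : Ω → Fin d₁ → ℝ} {X₂ : Ω → Fin d₂ → ℝ} {L : Ω → Fin (p + 1)}
  {ψ : (Fin d₁ → ℝ) → Fin d₂ → ℝ} {m : (Fin d₁ → ℝ) → Fin p → ℝ}
  [IsProbabilityMeasure μ] (hP : IsPopulation μ X₁ X₂ L ψ m) (y₀ : Fin p → ℝ)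
include hP

lemma memLp_mulVec_centre (D : Matrix (Fin p) (Fin d₂) ℝ) (j : Fin p) :
    MemLp (fun ω => (D *ᵥ centre μ (fun ω' => ψ (X₁ ω')) ω) j) 2 μ :=
  memLp_dotProduct_centre hP.memLp_ψ (D j)

lemma memLp_residual (β : Matrix (Fin p) (Fin d₂) ℝ) (j : Fin p) :
    MemLp (fun ω => residual μ X₁ ψ m y₀ β ω j) 2 μ :=
  ((hP.memLp_m.eval j).sub (memLp_const (y₀ j))).sub (memLp_mulVec_centre hP β j)

lemma errApx_add (β D : Matrix (Fin p) (Fin d₂) ℝ) :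
    errApx μ X₁ ψ m y₀ (β + D) = errApx μ X₁ ψ m y₀ β -
      2 * (∫ ω, residual μ X₁ ψ m y₀ β ω ⬝ᵥ (D *ᵥ centre μ (fun ω' => ψ (X₁ ω')) ω) ∂μ) +
      ∫ ω, sqNorm (D *ᵥ centre μ (fun ω' => ψ (X₁ ω')) ω) ∂μ := by
  have hr := memLp_residual hP y₀ β
  have hD := memLp_mulVec_centre hP D
  have h1 : Integrable (fun ω => sqNorm (residual μ X₁ ψ m y₀ β ω)) μ :=
    integrable_finsetSum _ fun j _ => (hr j).integrable_sq
  have h2 : Integrable (fun ω => residual μ X₁ ψ m y₀ β ω ⬝ᵥ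
      (D *ᵥ centre μ (fun ω' => ψ (X₁ ω')) ω)) μ :=
    integrable_finsetSum _ fun j _ => (hr j).integrable_mul (hD j)
  have h3 : Integrable (fun ω => sqNorm (D *ᵥ centre μ (fun ω' => ψ (X₁ ω')) ω)) μ :=
    integrable_finsetSum _ fun j _ => (hD j).integrable_sq
  have hpt : ∀ ω, sqNorm (residual μ X₁ ψ m y₀ (β + D) ω) =
      sqNorm (residual μ X₁ ψ m y₀ β ω) - 2 * (residual μ X₁ ψ m y₀ β ω ⬝ᵥ
        (D *ᵥ centre μ (fun ω' => ψ (X₁ ω')) ω)) +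
      sqNorm (D *ᵥ centre μ (fun ω' => ψ (X₁ ω')) ω) := fun ω => by
    simp only [sqNorm, dotProduct, residual, add_mulVec, Finset.mul_sum]
    rw [← Finset.sum_sub_distrib, ← Finset.sum_add_distrib]
    refine Finset.sum_congr rfl fun j _ => ?_
    simp only [Pi.sub_apply, Pi.add_apply]
    ring
  have h12 : Integrable (fun ω => sqNorm (residual μ X₁ ψ m y₀ β ω) -
      2 * (residual μ X₁ ψ m y₀ β ω ⬝ᵥ (D *ᵥ centre μ (fun ω' => ψ (X₁ ω')) ω))) μ :=
    h1.sub (h2.const_mul 2)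
  simp only [errApx, hpt]
  rw [integral_add h12 h3, integral_sub h1 (h2.const_mul 2),
    integral_const_mul]

/-- The normal equations for a minimizer of the approximation error. -/
lemma integral_residual_dotProduct_eq_zero {βs : Matrix (Fin p) (Fin d₂) ℝ}
    (hβ : ∀ β, errApx μ X₁ ψ m y₀ βs ≤ errApx μ X₁ ψ m y₀ β) (D : Matrix (Fin p) (Fin d₂) ℝ) :
    ∫ ω, residual μ X₁ ψ m y₀ βs ω ⬝ᵥ (D *ᵥ centre μ (fun ω' => ψ (X₁ ω')) ω) ∂μ = 0 := by
  set c := ∫ ω, residual μ X₁ ψ m y₀ βs ω ⬝ᵥ (D *ᵥ centre μ (fun ω' => ψ (X₁ ω')) ω) ∂μ with hc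
  set q := ∫ ω, sqNorm (D *ᵥ centre μ (fun ω' => ψ (X₁ ω')) ω) ∂μ with hq
  have hq0 : 0 ≤ q := integral_nonneg fun ω => Finset.sum_nonneg fun _ _ => sq_nonneg _
  have key : ∀ t : ℝ, 0 ≤ -2 * t * c + t ^ 2 * q := fun t => by
    have h := hβ (βs + t • D)
    rw [errApx_add hP] at h
    simp only [smul_mulVec, dotProduct_smul, smul_eq_mul, sqNorm, Pi.smul_apply, mul_pow,
      ← Finset.mul_sum, integral_const_mul] at h
    simp only [← hc] at h
    have h' : t ^ 2 * ∫ ω, ∑ j, (D *ᵥ centre μ (fun ω' => ψ (X₁ ω')) ω) j ^ 2 ∂μ = t ^ 2 * q := rfl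
    linarith
  have h := key (c / (q + 1))
  have h2 : -2 * (c / (q + 1)) * c + (c / (q + 1)) ^ 2 * q =
      -(c ^ 2 * (q + 2)) / (q + 1) ^ 2 := by field_simp; ring
  rw [h2, neg_div, le_neg, neg_zero] at h
  by_contra hne
  have : 0 < c ^ 2 * (q + 2) / (q + 1) ^ 2 := by positivity
  linarith

lemma errApx_eq_errApxMin_add {βs : Matrix (Fin p) (Fin d₂) ℝ}
    (hβ : ∀ β, errApx μ X₁ ψ m y₀ βs ≤ errApx μ X₁ ψ m y₀ β) (β : Matrix (Fin p) (Fin d₂) ℝ) :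
    errApx μ X₁ ψ m y₀ β = errApxMin μ X₁ ψ m y₀ +
      ∫ ω, sqNorm ((β - βs) *ᵥ centre μ (fun ω' => ψ (X₁ ω')) ω) ∂μ := by
  have hmin : errApxMin μ X₁ ψ m y₀ = errApx μ X₁ ψ m y₀ βs :=
    le_antisymm (ciInf_le ⟨errApx μ X₁ ψ m y₀ βs, by rintro _ ⟨β, rfl⟩; exact hβ β⟩ βs)
      (le_ciInf hβ)
  have h := errApx_add hP y₀ βs (β - βs)
  rw [integral_residual_dotProduct_eq_zero hP y₀ hβ, add_sub_cancel] at h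
  rw [h, hmin]
  ring

end ErrApx

end SSL

namespace SSL

/-! ### The least squares estimator -/

lemma inner_toLp_outer {p r : ℕ} (T : Fin p → Fin r → ℝ) (a : Fin p → ℝ) (w : Fin r → ℝ) :
    inner ℝ (WithLp.toLp 2 fun q : Fin p × Fin r => T q.1 q.2) (outer a w) =
      ∑ j, a j * (T j ⬝ᵥ w) := by
  rw [EuclideanSpace.inner_eq_star_dotProduct]
  simp only [outer, dotProduct, Fintype.sum_prod_type, Finset.mul_sum]
  refine Finset.sum_congr rfl fun j _ => Finset.sum_congr rfl fun k _ => ?_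
  simp only [Pi.star_apply, star_trivial]
  ring

lemma norm_toLp_sq {p r : ℕ} (T : Fin p → Fin r → ℝ) :
    ‖(WithLp.toLp 2 fun q : Fin p × Fin r => T q.1 q.2 : EuclideanSpace ℝ (Fin p × Fin r))‖ ^ 2 =
      ∑ j, T j ⬝ᵥ T j := by
  rw [EuclideanSpace.real_norm_sq_eq, Fintype.sum_prod_type]
  simp only [dotProduct, sq]

lemma outer_add_left {p r : ℕ} (a b : Fin p → ℝ) (w : Fin r → ℝ) :
    outer (a + b) w = outer a w + outer b w := by
  ext q
  simp only [outer, Pi.add_apply, PiLp.add_apply]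
  ring

lemma norm_outer_eq_frobNorm {p d : ℕ} (a : Fin p → ℝ) (w : Fin d → ℝ) :
    √(a ⬝ᵥ a) * √(w ⬝ᵥ w) = frobNorm (Matrix.vecMulVec w a) := by
  rw [frobNorm, ← Real.sqrt_mul (dotProduct_self_nonneg' a), mul_comm]
  congr 1
  simp only [dotProduct, Finset.sum_mul_sum, vecMulVec_apply]
  exact Finset.sum_congr rfl fun i _ => Finset.sum_congr rfl fun j _ => by ring

/-- The basic inequality for least squares, solved for the squared error `U`: here `Q` is the
empirical and `U` the population quadratic form of the estimation error, whose images `t` and `b`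
under the two whitenings are tested against the noise moments `Nt`, `Nb` and the centred residual
moments `At`, `Ab`. -/
lemma le_of_basic_inequality {H₁ H₂ : Type*} [NormedAddCommGroup H₁] [InnerProductSpace ℝ H₁]
    [NormedAddCommGroup H₂] [InnerProductSpace ℝ H₂] {t Nt At : H₁} {b Nb Ab : H₂}
    {n U Q K₁ K₂ α₁ α₂ α₃ α₄ : ℝ} (hn : 0 < n) (hU : 0 ≤ U) (hQ : n / 2 * U ≤ Q)
    (hbasic : Q ≤ 2 * (inner ℝ t (Nt + At) - inner ℝ b (Nb + Ab)))
    (ht : ‖t‖ ^ 2 ≤ K₁ * U) (hb : ‖b‖ ^ 2 ≤ K₂ * U) (hK₁ : 0 ≤ K₁) (hK₂ : 0 ≤ K₂)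
    (h₁ : ‖Nt‖ ^ 2 ≤ α₁) (h₂ : ‖At‖ ^ 2 ≤ α₂) (h₃ : ‖Nb‖ ^ 2 ≤ α₃) (h₄ : ‖Ab‖ ^ 2 ≤ α₄) :
    U ≤ 64 / n ^ 2 * (K₁ * (α₁ + α₂) + K₂ * (α₃ + α₄)) := by
  have hNt : ‖Nt + At‖ ^ 2 ≤ 2 * (α₁ + α₂) := by
    have h' : ‖Nt + At‖ ^ 2 ≤ (‖Nt‖ + ‖At‖) ^ 2 := by gcongr; exact norm_add_le _ _
    nlinarith [sq_nonneg (‖Nt‖ - ‖At‖)]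
  have hNb : ‖Nb + Ab‖ ^ 2 ≤ 2 * (α₃ + α₄) := by
    have h' : ‖Nb + Ab‖ ^ 2 ≤ (‖Nb‖ + ‖Ab‖) ^ 2 := by gcongr; exact norm_add_le _ _
    nlinarith [sq_nonneg (‖Nb‖ - ‖Ab‖)]
  have hi1 : inner ℝ t (Nt + At) ≤ ‖t‖ * ‖Nt + At‖ := real_inner_le_norm _ _
  have hi2 : -(‖b‖ * ‖Nb + Ab‖) ≤ inner ℝ b (Nb + Ab) := by
    have := abs_real_inner_le_norm b (Nb + Ab)
    exact (abs_le.1 this).1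
  set x := ‖t‖
  set y := ‖Nt + At‖
  set x' := ‖b‖
  set y' := ‖Nb + Ab‖
  have h1 : n / 4 * U ≤ x * y + x' * y' := by linarith
  have hxy : (x * y) ^ 2 ≤ K₁ * U * (2 * (α₁ + α₂)) := by
    rw [mul_pow]; exact mul_le_mul ht hNt (sq_nonneg _) (by positivity)
  have hxy' : (x' * y') ^ 2 ≤ K₂ * U * (2 * (α₃ + α₄)) := by
    rw [mul_pow]; exact mul_le_mul hb hNb (sq_nonneg _) (by positivity)
  have h2 : (n / 4 * U) ^ 2 ≤ (x * y + x' * y') ^ 2 := by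
    have : 0 ≤ n / 4 * U := by positivity
    gcongr
  have h3 : (n / 4 * U) ^ 2 ≤ U * (4 * (K₁ * (α₁ + α₂) + K₂ * (α₃ + α₄))) := by
    nlinarith [sq_nonneg (x * y - x' * y')]
  rcases hU.eq_or_lt with h0 | h0
  · rw [← h0]
    have e1 : 0 ≤ α₁ := (sq_nonneg _).trans h₁
    have e2 : 0 ≤ α₂ := (sq_nonneg _).trans h₂
    have e3 : 0 ≤ α₃ := (sq_nonneg _).trans h₃
    have e4 : 0 ≤ α₄ := (sq_nonneg _).trans h₄
    positivity
  · have h4 : n ^ 2 / 16 * U ≤ 4 * (K₁ * (α₁ + α₂) + K₂ * (α₃ + α₄)) := by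
      refine le_of_mul_le_mul_left ?_ h0
      calc U * (n ^ 2 / 16 * U) = (n / 4 * U) ^ 2 := by ring
        _ ≤ _ := h3
    rw [div_mul_eq_mul_div, le_div_iff₀ (by positivity)]
    linarith

lemma measurable_sum_dotProduct_smul {α : Type*} [MeasurableSpace α] {d r : ℕ}
    {V : α → Fin d → ℝ} {e : Fin r → Fin d → ℝ} (hV : Measurable V) :
    Measurable fun q => ∑ k, (e k ⬝ᵥ V q) • e k := by
  simp only [dotProduct]
  fun_prop

variable {Ω : Type*} [MeasurableSpace Ω] {μ : Measure Ω}

lemma norm_outer_coord_le {p d r : ℕ} {Z : Ω → Fin d → ℝ} (F : EigenFrame μ Z r)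
    (a : Fin p → ℝ) (ω : Ω) :
    ‖outer a (F.coord (centre μ Z ω))‖ ≤ frobNorm (Matrix.vecMulVec (whiten μ Z ω) a) := by
  rw [norm_outer, ← norm_outer_eq_frobNorm]
  gcongr
  rw [← sqNorm_eq_dotProduct (whiten μ Z ω)]
  exact F.coord_dotProduct_coord_le ω

/-- The squared estimation error of least squares, in terms of a decomposition of the
representation `X = X̃ - X̄`, where `K₁` and `K₂` bound the variances of `X̃` and `X̄` relative to the
variance of `X`. -/
lemma measure_exists_ols_error_gt_le [IsProbabilityMeasure μ] {d₁ d₂ p n r rt rb : ℕ}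
    {X₁ : Ω → Fin d₁ → ℝ} {X₂ : Ω → Fin d₂ → ℝ} {L : Ω → Fin (p + 1)}
    {ψ φ : (Fin d₁ → ℝ) → Fin d₂ → ℝ} {m : (Fin d₁ → ℝ) → Fin p → ℝ}
    (hP : IsPopulation μ X₁ X₂ L ψ m) (hφ : Measurable φ) (hφ2 : MemLp (fun ω => φ (X₁ ω)) 2 μ)
    (F : EigenFrame μ (fun ω => ψ (X₁ ω)) r) (Ft : EigenFrame μ (fun ω => φ (X₁ ω)) rt)
    (Fb : EigenFrame μ (fun ω => φ (X₁ ω) - ψ (X₁ ω)) rb) {y₀ : Fin p → ℝ}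
    {βs : Matrix (Fin p) (Fin d₂) ℝ}
    (hβs : ∀ β, errApx μ X₁ ψ m y₀ βs ≤ errApx μ X₁ ψ m y₀ β)
    {σ2 ρ2 v : ℝ≥0} (hσ : 0 < σ2)
    (hnoise : IsSubGaussian μ (fun ω => oneHot (L ω) - m (X₁ ω)) σ2)
    (hsubt : IsSubGaussian μ (whiten μ fun ω => φ (X₁ ω)) ρ2)
    (hsubb : IsSubGaussian μ (whiten μ fun ω => φ (X₁ ω) - ψ (X₁ ω)) ρ2)
    {K₁ K₂ : ℝ≥0}
    (hvart : ∀ u, ∫ ω, (F.lift u ⬝ᵥ centre μ (fun ω => φ (X₁ ω)) ω) ^ 2 ∂μ ≤ K₁ * (u ⬝ᵥ u))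
    (hvarb : ∀ u, ∫ ω, (F.lift u ⬝ᵥ centre μ (fun ω => φ (X₁ ω) - ψ (X₁ ω)) ω) ^ 2 ∂μ ≤
      K₂ * (u ⬝ᵥ u))
    (hv : 2 * (K₁ + K₂) * ρ2 ≤ v) (hρv : ρ2 ≤ v) {bt bb mt mb : ℝ} (hbt : 0 ≤ bt) (hbb : 0 ≤ bb)
    (hmt : (rt : ℝ) ≤ mt) (hmb : (rb : ℝ) ≤ mb)
    (hbdt : ∀ᵐ ω ∂μ, frobNorm (Matrix.vecMulVec (whiten μ (fun ω => φ (X₁ ω)) ω)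
      (residual μ X₁ ψ m y₀ βs ω)) ≤ bt * √mt)
    (hbdb : ∀ᵐ ω ∂μ, frobNorm (Matrix.vecMulVec (whiten μ (fun ω => φ (X₁ ω) - ψ (X₁ ω)) ω)
      (residual μ X₁ ψ m y₀ βs ω)) ≤ bb * √mb)
    {x : Fin n → Ω → Fin d₁ → ℝ} {l : Fin n → Ω → Fin (p + 1)}
    (hS : IsLabelledSample μ X₁ L x l) {δ ℓ : ℝ} (hδ : 0 < δ) (hδ1 : δ < 1) (hr : 0 < r)
    (hpd : p ≤ d₂) (hd : 0 < d₂) (hrt : rt ≤ d₂) (hrb : rb ≤ d₂) (hn0 : 0 < n)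
    (hn : 2 ^ 19 * (v : ℝ) ^ 2 * (r + Real.log (1 / δ)) ≤ n)
    (hℓ : ℓ = 1 + Real.log (n * d₂ / δ)) :
    μ {ω | ∃ β, IsOLS μ X₁ ψ y₀ (fun i => x i ω) (fun i => l i ω) β ∧
        64 / n * (115200 * ℓ ^ 4) * (K₁ * (mt * (σ2 + bt ^ 2)) + K₂ * (mb * (σ2 + bb ^ 2))) <
          ∫ ω', sqNorm ((β - βs) *ᵥ centre μ (fun ω => ψ (X₁ ω)) ω') ∂μ} ≤ ENNReal.ofReal δ := by
  classical
  have hn' : (0 : ℝ) < n := by exact_mod_cast hn0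
  have hℓ1 := one_le_logFactor hn0 hd hδ hδ1 hℓ
  have hψ2 := hP.memLp_ψ
  have hψi : Integrable (fun ω => ψ (X₁ ω)) μ := hψ2.integrable (by norm_num)
  have hφi : Integrable (fun ω => φ (X₁ ω)) μ := hφ2.integrable (by norm_num)
  have hb2 : MemLp (fun ω => φ (X₁ ω) - ψ (X₁ ω)) 2 μ := hφ2.sub hψ2
  have hψm := hP.isRegression_ψ.1
  have hmm := hP.isRegression_m.1
  set c := ∫ ω, ψ (X₁ ω) ∂μ with hc
  set ct := ∫ ω, φ (X₁ ω) ∂μ with hct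
  have hcb : ∫ ω, (φ (X₁ ω) - ψ (X₁ ω)) ∂μ = ct - c := integral_sub hφi hψi
  let 𝒳 := (Fin d₁ → ℝ) × Fin (p + 1)
  let ζ : Ω → 𝒳 := fun ω => (X₁ ω, L ω)
  let ξ : Fin n → Ω → 𝒳 := fun i ω => (x i ω, l i ω)
  have hind : iIndepFun ξ μ := hS.1
  have hid : ∀ i, IdentDistrib (ξ i) ζ μ μ := hS.2
  -- the centred representations and their whitenings, as functions of the features
  let V : 𝒳 → Fin d₂ → ℝ := fun q => ψ q.1 - c
  let Vt : 𝒳 → Fin d₂ → ℝ := fun q => φ q.1 - ct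
  let Vb : 𝒳 → Fin d₂ → ℝ := fun q => φ q.1 - ψ q.1 - (ct - c)
  have hVζ : ∀ ω, centre μ (fun ω => ψ (X₁ ω)) ω = V (ζ ω) := fun ω => rfl
  have hVtζ : ∀ ω, centre μ (fun ω => φ (X₁ ω)) ω = Vt (ζ ω) := fun ω => rfl
  have hVbζ : ∀ ω, centre μ (fun ω => φ (X₁ ω) - ψ (X₁ ω)) ω = Vb (ζ ω) := fun ω => by
    simp only [centre, hcb]; rfl
  have hVm : Measurable V := (hψm.comp measurable_fst).sub_const c
  have hVtm : Measurable Vt := (hφ.comp measurable_fst).sub_const ct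
  have hVbm : Measurable Vb :=
    ((hφ.comp measurable_fst).sub (hψm.comp measurable_fst)).sub_const (ct - c)
  let z : 𝒳 → Fin r → ℝ := fun q => F.coord (V q)
  let wt : 𝒳 → Fin rt → ℝ := fun q => Ft.coord (Vt q)
  let wb : 𝒳 → Fin rb → ℝ := fun q => Fb.coord (Vb q)
  have hzm : Measurable z := F.measurable_coord.comp hVm
  have hwtm : Measurable wt := Ft.measurable_coord.comp hVtm
  have hwbm : Measurable wb := Fb.measurable_coord.comp hVbm
  let a : 𝒳 → Fin p → ℝ := fun q => m q.1 - y₀ - βs *ᵥ V q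
  have ham : Measurable a := by
    refine ((hmm.comp measurable_fst).sub_const y₀).sub ?_
    refine measurable_pi_iff.2 fun j => ?_
    change Measurable fun q => ∑ k, βs j k * V q k
    fun_prop
  have hηm : Measurable (noise m) := measurable_noise hmm
  -- almost all feature vectors have an expansion in the three eigenbases
  let good : 𝒳 → Prop := fun q => (V q = ∑ k, (F.e k ⬝ᵥ V q) • F.e k) ∧
    (Vt q = ∑ k, (Ft.e k ⬝ᵥ Vt q) • Ft.e k) ∧ (Vb q = ∑ k, (Fb.e k ⬝ᵥ Vb q) • Fb.e k)
  have hgoodm : MeasurableSet {q | good q} :=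
    (measurableSet_eq_fun hVm (measurable_sum_dotProduct_smul hVm)).inter
      ((measurableSet_eq_fun hVtm (measurable_sum_dotProduct_smul hVtm)).inter
        (measurableSet_eq_fun hVbm (measurable_sum_dotProduct_smul hVbm)))
  have hgoodζ : ∀ᵐ ω ∂μ, good (ζ ω) := by
    filter_upwards [F.expand, Ft.expand, Fb.expand] with ω h1 h2 h3
    rw [hVζ] at h1
    rw [hVtζ] at h2
    rw [hVbζ] at h3
    exact ⟨h1, h2, h3⟩
  have hgoodξ : ∀ᵐ ω ∂μ, ∀ i, good (ξ i ω) :=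
    ae_all_iff.2 fun i => (hid i).symm.ae_snd hgoodm hgoodζ
  have hsplit : ∀ q, good q → ∀ u : Fin r → ℝ,
      u ⬝ᵥ z q = Ft.load (F.lift u) ⬝ᵥ wt q - Fb.load (F.lift u) ⬝ᵥ wb q := fun q hq u => by
    rw [← Ft.dotProduct_eq_of_expand hq.2.1, ← Fb.dotProduct_eq_of_expand hq.2.2,
      ← dotProduct_sub, ← F.lift_dotProduct]
    congr 1
    simp only [V, Vt, Vb]
    abel
  have hloadt : ∀ u, Ft.load (F.lift u) ⬝ᵥ Ft.load (F.lift u) ≤ K₁ * (u ⬝ᵥ u) := fun u => by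
    rw [Ft.load_dotProduct_load hφ2]; exact hvart u
  have hloadb : ∀ u, Fb.load (F.lift u) ⬝ᵥ Fb.load (F.lift u) ≤ K₂ * (u ⬝ᵥ u) := fun u => by
    rw [Fb.load_dotProduct_load hb2]; exact hvarb u
  have hsubt' : ∀ u : Fin rt → ℝ, u ⬝ᵥ u = 1 →
      HasSubgaussianMGF (fun ω => u ⬝ᵥ wt (ζ ω)) ρ2 μ := fun u hu =>
    Ft.hasSubgaussianMGF_dotProduct_coord hsubt u hu
  have hsubb' : ∀ u : Fin rb → ℝ, u ⬝ᵥ u = 1 →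
      HasSubgaussianMGF (fun ω => u ⬝ᵥ wb (ζ ω)) ρ2 μ := fun u hu => by
    have h := Fb.hasSubgaussianMGF_dotProduct_coord hsubb u hu
    simp only [hVbζ] at h
    exact h
  have hvart' : ∀ u : Fin rt → ℝ, ∫ ω, (u ⬝ᵥ wt (ζ ω)) ^ 2 ∂μ = u ⬝ᵥ u :=
    fun u => Ft.integral_dotProduct_coord_sq hφ2 u
  have hvarb' : ∀ u : Fin rb → ℝ, ∫ ω, (u ⬝ᵥ wb (ζ ω)) ^ 2 ∂μ = u ⬝ᵥ u := fun u => by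
    have h := Fb.integral_dotProduct_coord_sq hb2 u
    simp only [hVbζ] at h
    exact h
  have hvarz : ∀ u : Fin r → ℝ, ∫ ω, (u ⬝ᵥ z (ζ ω)) ^ 2 ∂μ = u ⬝ᵥ u :=
    fun u => F.integral_dotProduct_coord_sq hψ2 u
  have hsubz : ∀ u : Fin r → ℝ, u ⬝ᵥ u = 1 →
      HasSubgaussianMGF (fun ω => u ⬝ᵥ z (ζ ω)) v μ := fun u hu => by
    have ht := hasSubgaussianMGF_dotProduct_of_unit hsubt' (Ft.load (F.lift u)) (K := K₁)
      (by simpa [hu] using hloadt u)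
    have hb := hasSubgaussianMGF_dotProduct_of_unit hsubb' (Fb.load (F.lift u)) (K := K₂)
      (by simpa [hu] using hloadb u)
    have hsum := ht.add hb.neg
    refine HasSubgaussianMGF.of_le (hsum.congr ?_) (le_trans ?_ hv)
    · filter_upwards [hgoodζ] with ω h
      rw [hsplit _ h, Pi.neg_apply, sub_eq_add_neg]
    · refine (add_sq_le (a := NNReal.sqrt (K₁ * ρ2)) (b := NNReal.sqrt (K₂ * ρ2))).trans
        (le_of_eq ?_)
      rw [NNReal.sq_sqrt, NNReal.sq_sqrt]
      ring
  have hidz : ∀ i (u : Fin r → ℝ),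
      IdentDistrib (fun ω => u ⬝ᵥ z (ξ i ω)) (fun ω => u ⬝ᵥ z (ζ ω)) μ μ := fun i u =>
    (hid i).comp (u := fun q => u ⬝ᵥ z q) (by simp only [dotProduct]; fun_prop)
  have hv14 : (1 : ℝ) ≤ 4 * v :=
    HasSubgaussianMGF.one_le_four_mul (hsubz (Pi.single ⟨0, hr⟩ 1) (by simp)) (by rw [hvarz]; simp)
  have hv0 : 0 < v := by
    have : (0 : ℝ) < v := by linarith
    exact this
  have hρn : (ρ2 : ℝ) ≤ n := by
    have hr1 : (1 : ℝ) ≤ r := by exact_mod_cast hr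
    have hlog : 0 ≤ Real.log (1 / δ) := Real.log_nonneg (by rw [le_div_iff₀ hδ]; linarith)
    nlinarith [sq_nonneg (v : ℝ), mul_nonneg (sq_nonneg (v : ℝ)) hlog]
  -- the five events
  have hcov := measure_exists_sum_sq_lt_le (z := fun i ω => z (ξ i ω)) (v := v)
    (hind.comp (fun _ => z) fun _ => hzm)
    (fun i u hu => (hsubz u hu).congr_identDistrib (hidz i u).symm)
    (fun i u hu => by
      rw [← hu, ← hvarz u]
      exact ((hidz i u).comp (u := fun y => y ^ 2) (by fun_prop)).integral_eq)
    hr hδ hδ1 hv0 hn hn0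
  have hsmall := hP.integral_noise_sq_le hnoise
  have htrunc : ∀ {s : ℕ} (w : 𝒳 → Fin s → ℝ) (w' : (Fin d₁ → ℝ) → Fin s → ℝ),
      Measurable w' → (∀ q, w q = w' q.1) → ∀ (M : ℝ) j k,
      ∫ ω, noise m (ζ ω) j * (if w (ζ ω) ⬝ᵥ w (ζ ω) ≤ M then w (ζ ω) k else 0) ∂μ = 0 :=
    fun {s} w w' hw' hww M j k => by
    have h := hP.integral_mul_noise_eq_zero (C := √M)
      (h := fun y => if w' y ⬝ᵥ w' y ≤ M then w' y k else 0)
      (Measurable.ite (measurableSet_le (by simp only [dotProduct]; fun_prop) measurable_const)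
        (by fun_prop) measurable_const) (fun y => by
        split_ifs with hM
        · refine Real.abs_le_sqrt (le_trans ?_ hM)
          simp only [dotProduct, ← sq]
          exact Finset.single_le_sum (f := fun j => w' y j ^ 2) (fun _ _ => sq_nonneg _)
            (Finset.mem_univ k)
        · simp) j
    refine Eq.trans (integral_congr_ae (ae_of_all _ fun ω => ?_)) h
    simp only [hww]
    exact mul_comm _ _
  have hNt := measure_sum_noise_outer_gt_le hind hid hηm hwtm (σ2 := σ2) hσ hρn
    hP.noise_dotProduct_self_le_ae hsmall
    (htrunc wt (fun y => Ft.coord (φ y - ct)) (Ft.measurable_coord.comp (hφ.sub_const ct))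
      fun q => rfl)
    hsubt' hvart' hpd hrt hn0 hd hδ hδ1 hℓ
  have hNb := measure_sum_noise_outer_gt_le hind hid hηm hwbm (σ2 := σ2) hσ hρn
    hP.noise_dotProduct_self_le_ae hsmall
    (htrunc wb (fun y => Fb.coord (φ y - ψ y - (ct - c)))
      (Fb.measurable_coord.comp ((hφ.sub hψm).sub_const (ct - c))) fun q => rfl)
    hsubb' hvarb' hpd hrb hn0 hd hδ hδ1 hℓ
  have hmt0 : 0 ≤ mt := (Nat.cast_nonneg _).trans hmt
  have hmb0 : 0 ≤ mb := (Nat.cast_nonneg _).trans hmb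
  have hot : ∀ᵐ ω ∂μ, ‖outer (a (ζ ω)) (wt (ζ ω))‖ ≤ bt * √mt := by
    filter_upwards [hbdt] with ω h
    exact (norm_outer_coord_le Ft _ ω).trans h
  have hob : ∀ᵐ ω ∂μ, ‖outer (a (ζ ω)) (wb (ζ ω))‖ ≤ bb * √mb := by
    filter_upwards [hbdb] with ω h
    have h' := (norm_outer_coord_le Fb _ ω).trans h
    rw [hVbζ] at h'
    exact h'
  have hAt := measure_sum_outer_sub_gt_le hind hid ham hwtm hbt hmt0 hot hn0 hd hδ hδ1 hℓ
  have hAb := measure_sum_outer_sub_gt_le hind hid ham hwbm hbb hmb0 hob hn0 hd hδ hδ1 hℓ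
  have hζ : AEMeasurable ζ μ := hP.measurable_pair.aemeasurable
  have hoti : Integrable (fun ω => outer (a (ζ ω)) (wt (ζ ω))) μ :=
    Integrable.of_bound ((measurable_outer ham hwtm).comp_aemeasurable hζ).aestronglyMeasurable
      _ hot
  have hobi : Integrable (fun ω => outer (a (ζ ω)) (wb (ζ ω))) μ :=
    Integrable.of_bound ((measurable_outer ham hwbm).comp_aemeasurable hζ).aestronglyMeasurable
      _ hob
  set Et := ∫ ω, outer (a (ζ ω)) (wt (ζ ω)) ∂μ with hEt
  set Eb := ∫ ω, outer (a (ζ ω)) (wb (ζ ω)) ∂μ with hEb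
  set E₁ : Set Ω := {ω | ∃ u : Fin r → ℝ, ∑ i, (u ⬝ᵥ z (ξ i ω)) ^ 2 < n / 2 * (u ⬝ᵥ u)}
  set E₂ : Set Ω := {ω | 115200 * ℓ ^ 4 * σ2 * n * rt <
    ‖∑ i, outer (noise m (ξ i ω)) (wt (ξ i ω))‖ ^ 2}
  set E₃ : Set Ω := {ω | 115200 * ℓ ^ 4 * σ2 * n * rb <
    ‖∑ i, outer (noise m (ξ i ω)) (wb (ξ i ω))‖ ^ 2}
  set E₄ : Set Ω := {ω | 400 * bt ^ 2 * mt * n * ℓ ^ 2 <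
    ‖∑ i, (outer (a (ξ i ω)) (wt (ξ i ω)) - Et)‖ ^ 2}
  set E₅ : Set Ω := {ω | 400 * bb ^ 2 * mb * n * ℓ ^ 2 <
    ‖∑ i, (outer (a (ξ i ω)) (wb (ξ i ω)) - Eb)‖ ^ 2}
  have hmain : ∀ᵐ ω ∂μ, (∃ β, IsOLS μ X₁ ψ y₀ (fun i => x i ω) (fun i => l i ω) β ∧
        64 / n * (115200 * ℓ ^ 4) * (K₁ * (mt * (σ2 + bt ^ 2)) + K₂ * (mb * (σ2 + bb ^ 2))) <
          ∫ ω', sqNorm ((β - βs) *ᵥ centre μ (fun ω => ψ (X₁ ω)) ω') ∂μ) →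
      ω ∈ E₁ ∪ E₂ ∪ E₃ ∪ E₄ ∪ E₅ := by
    filter_upwards [hgoodξ] with ω hgood hβ
    obtain ⟨β, hols, hlt⟩ := hβ
    by_contra hcon
    simp only [E₁, E₂, E₃, E₄, E₅, Set.mem_union, Set.mem_ofPred_eq, not_or, not_exists,
      not_lt] at hcon
    obtain ⟨⟨⟨⟨h1, h2⟩, h3⟩, h4⟩, h5⟩ := hcon
    refine absurd hlt (not_lt.2 ?_)
    set D := β - βs with hD
    let u : Fin p → Fin r → ℝ := fun j => F.load (D j)
    let T : Fin p → Fin rt → ℝ := fun j => Ft.load (F.lift (u j))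
    let Bb : Fin p → Fin rb → ℝ := fun j => Fb.load (F.lift (u j))
    let tE : EuclideanSpace ℝ (Fin p × Fin rt) := WithLp.toLp 2 fun q => T q.1 q.2
    let bE : EuclideanSpace ℝ (Fin p × Fin rb) := WithLp.toLp 2 fun q => Bb q.1 q.2
    have hDV : ∀ q, good q → ∀ j, (D *ᵥ V q) j = u j ⬝ᵥ z q := fun q hq j =>
      F.dotProduct_eq_of_expand hq.1 (D j)
    have hpair : ∀ q, good q → ∀ e : Fin p → ℝ,
        e ⬝ᵥ (D *ᵥ V q) = inner ℝ tE (outer e (wt q)) - inner ℝ bE (outer e (wb q)) :=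
      fun q hq e => by
      rw [inner_toLp_outer, inner_toLp_outer, ← Finset.sum_sub_distrib]
      refine Finset.sum_congr rfl fun j _ => ?_
      rw [hDV q hq, hsplit q hq]
      ring
    -- the population moments cancel by the normal equations
    have hcancel : inner ℝ tE Et - inner ℝ bE Eb = 0 := by
      rw [← integral_residual_dotProduct_eq_zero hP y₀ hβs D, hEt, hEb, ← integral_inner hoti,
        ← integral_inner hobi, ← integral_sub (hoti.const_inner tE) (hobi.const_inner bE)]
      refine integral_congr_ae ?_
      filter_upwards [hgoodζ] with ω' h
      exact (hpair _ h (a (ζ ω'))).symm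
    have hU : ∫ ω', sqNorm (D *ᵥ centre μ (fun ω => ψ (X₁ ω)) ω') ∂μ = ∑ j, u j ⬝ᵥ u j := by
      simp only [sqNorm]
      rw [integral_finsetSum _ fun j _ => (memLp_mulVec_centre hP D j).integrable_sq]
      exact Finset.sum_congr rfl fun j _ => (F.load_dotProduct_load hψ2 (D j)).symm
    rw [hU]
    have hQ : n / 2 * ∑ j, u j ⬝ᵥ u j ≤ ∑ i, sqNorm (D *ᵥ V (ξ i ω)) := by
      simp only [sqNorm]
      rw [Finset.sum_comm, Finset.mul_sum]
      refine Finset.sum_le_sum fun j _ => ?_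
      refine (h1 (u j)).trans (le_of_eq (Finset.sum_congr rfl fun i _ => ?_))
      rw [hDV _ (hgood i)]
    have hbasic : ∑ i, sqNorm (D *ᵥ V (ξ i ω)) ≤
        2 * ∑ i, (noise m (ξ i ω) + a (ξ i ω)) ⬝ᵥ (D *ᵥ V (ξ i ω)) := by
      have h' : ∑ i, sqNorm (oneHot (l i ω) - y₀ - β *ᵥ (ψ (x i ω) - c)) ≤
          ∑ i, sqNorm (oneHot (l i ω) - y₀ - βs *ᵥ (ψ (x i ω) - c)) :=
        le_of_mul_le_mul_left (hols βs) (by positivity)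
      have e1 : ∀ i, sqNorm (oneHot (l i ω) - y₀ - β *ᵥ (ψ (x i ω) - c)) =
          sqNorm (oneHot (l i ω) - y₀ - βs *ᵥ (ψ (x i ω) - c)) -
          2 * ((noise m (ξ i ω) + a (ξ i ω)) ⬝ᵥ (D *ᵥ V (ξ i ω))) +
          sqNorm (D *ᵥ V (ξ i ω)) := fun i => by
        have e2 : noise m (ξ i ω) + a (ξ i ω) =
            oneHot (l i ω) - y₀ - βs *ᵥ (ψ (x i ω) - c) := by
          simp only [noise, a, ξ, V]; abel
        have e3 : β *ᵥ (ψ (x i ω) - c) = βs *ᵥ (ψ (x i ω) - c) + D *ᵥ V (ξ i ω) := by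
          rw [hD, sub_mulVec]; simp only [ξ, V]; abel
        rw [e2, e3]
        simp only [sqNorm, dotProduct, Finset.mul_sum]
        rw [← Finset.sum_sub_distrib, ← Finset.sum_add_distrib]
        refine Finset.sum_congr rfl fun j _ => ?_
        simp only [Pi.sub_apply, Pi.add_apply]
        ring
      rw [Finset.sum_congr rfl fun i _ => e1 i, Finset.sum_add_distrib, Finset.sum_sub_distrib,
        ← Finset.mul_sum] at h'
      linarith
    have hsum : ∑ i, (noise m (ξ i ω) + a (ξ i ω)) ⬝ᵥ (D *ᵥ V (ξ i ω)) =
        inner ℝ tE (∑ i, outer (noise m (ξ i ω)) (wt (ξ i ω)) +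
          ∑ i, (outer (a (ξ i ω)) (wt (ξ i ω)) - Et)) -
        inner ℝ bE (∑ i, outer (noise m (ξ i ω)) (wb (ξ i ω)) +
          ∑ i, (outer (a (ξ i ω)) (wb (ξ i ω)) - Eb)) := by
      rw [← Finset.sum_add_distrib, ← Finset.sum_add_distrib, inner_sum, inner_sum,
        ← Finset.sum_sub_distrib]
      refine Finset.sum_congr rfl fun i _ => ?_
      rw [hpair _ (hgood i), outer_add_left, outer_add_left]
      simp only [inner_add_right, inner_sub_right]
      linarith
    rw [hsum] at hbasic
    have hUnn : 0 ≤ ∑ j, u j ⬝ᵥ u j := Finset.sum_nonneg fun j _ => dotProduct_self_nonneg' _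
    have hfin := le_of_basic_inequality hn' hUnn hQ hbasic
      (K₁ := K₁) (K₂ := K₂)
      (by rw [norm_toLp_sq, Finset.mul_sum]; exact Finset.sum_le_sum fun j _ => hloadt (u j))
      (by rw [norm_toLp_sq, Finset.mul_sum]; exact Finset.sum_le_sum fun j _ => hloadb (u j))
      K₁.2 K₂.2 h2 h4 h3 h5
    refine hfin.trans ?_
    have hfac : ∀ {rr b M : ℝ}, rr ≤ M → 0 ≤ M →
        115200 * ℓ ^ 4 * σ2 * n * rr + 400 * b ^ 2 * M * n * ℓ ^ 2 ≤
          n * (115200 * ℓ ^ 4) * (M * (σ2 + b ^ 2)) := fun {rr b M} h hM => by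
      have e1 : 115200 * ℓ ^ 4 * σ2 * n * rr ≤ 115200 * ℓ ^ 4 * σ2 * n * M := by gcongr
      have e2 : 400 * b ^ 2 * M * n * ℓ ^ 2 ≤ 115200 * b ^ 2 * M * n * ℓ ^ 4 := by
        gcongr
        · norm_num
        · norm_num
      linarith
    calc _ ≤ 64 / (n : ℝ) ^ 2 * (K₁ * (n * (115200 * ℓ ^ 4) * (mt * (σ2 + bt ^ 2))) +
          K₂ * (n * (115200 * ℓ ^ 4) * (mb * (σ2 + bb ^ 2)))) := by
          gcongr
          · exact hfac hmt hmt0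
          · exact hfac hmb hmb0
      _ = _ := by field_simp
  have hδ5 : ENNReal.ofReal δ = ENNReal.ofReal (δ / 5) + ENNReal.ofReal (δ / 5) +
      ENNReal.ofReal (δ / 5) + ENNReal.ofReal (δ / 5) + ENNReal.ofReal (δ / 5) := by
    have h : 0 ≤ δ / 5 := by positivity
    rw [← ENNReal.ofReal_add h h, ← ENNReal.ofReal_add (by positivity) h,
      ← ENNReal.ofReal_add (by positivity) h, ← ENNReal.ofReal_add (by positivity) h]
    congr 1
    ring
  calc _ ≤ μ (E₁ ∪ E₂ ∪ E₃ ∪ E₄ ∪ E₅) := measure_mono_ae hmain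
    _ ≤ μ E₁ + μ E₂ + μ E₃ + μ E₄ + μ E₅ :=
        (measure_union_le _ _).trans (add_le_add_left ((measure_union_le _ _).trans
          (add_le_add_left ((measure_union_le _ _).trans
            (add_le_add_left (measure_union_le _ _) _)) _)) _)
    _ ≤ ENNReal.ofReal δ := by
        rw [hδ5]
        exact add_le_add (add_le_add (add_le_add (add_le_add hcov hNt) hNb) hAt) hAb

end SSL

namespace SSL

/-! ### Low-rank approximations -/

section Rank

variable {Ω : Type*} [MeasurableSpace Ω] {μ : Measure Ω} [IsProbabilityMeasure μ] {d : ℕ}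
  {Z : Ω → Fin d → ℝ}

lemma rank_covMatrix_le_card {ι : Type*} [Fintype ι] (hZ : MemLp Z 2 μ) (N : Matrix (Fin d) ι ℝ)
    (y : Ω → ι → ℝ) (h : ∀ ω, Z ω = N *ᵥ y ω) : (covMatrix μ Z).rank ≤ Fintype.card ι := by
  have hker : LinearMap.ker Nᵀ.mulVecLin ≤ LinearMap.ker (covMatrix μ Z).mulVecLin := by
    intro D hD
    rw [LinearMap.mem_ker, mulVecLin_apply] at hD ⊢
    have hDZ : ∀ ω, D ⬝ᵥ Z ω = 0 := fun ω => by
      rw [h ω, dotProduct_mulVec, ← mulVec_transpose, hD, zero_dotProduct]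
    have hDc : ∀ ω, D ⬝ᵥ centre μ Z ω = 0 := fun ω => by
      have hi : ∀ i, Integrable (fun ω => D i * Z ω i) μ := fun i =>
        ((hZ.eval i).integrable (by norm_num)).const_mul (D i)
      have e : D ⬝ᵥ centre μ Z ω = D ⬝ᵥ Z ω - ∫ ω', D ⬝ᵥ Z ω' ∂μ := by
        simp only [dotProduct, centre_apply hZ]
        rw [integral_finsetSum _ fun i _ => hi i, ← Finset.sum_sub_distrib]
        refine Finset.sum_congr rfl fun i _ => ?_
        rw [integral_const_mul]
        ring
      rw [e, hDZ]
      simp [hDZ]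
    have h0 := integral_dotProduct_centre_mul hZ (covMatrix μ Z *ᵥ D) D
    simp only [hDc, mul_zero, integral_zero] at h0
    exact dotProduct_self_eq_zero.1 h0.symm
  have h1 := LinearMap.finrank_range_add_finrank_ker Nᵀ.mulVecLin
  have h2 := LinearMap.finrank_range_add_finrank_ker (covMatrix μ Z).mulVecLin
  have h3 := Submodule.finrank_mono hker
  have h4 := Nᵀ.rank_le_card_height
  rw [Matrix.rank] at h4 ⊢
  omega

lemma trace_covMatrix_le (hZ : MemLp Z 2 μ) :
    (covMatrix μ Z).trace ≤ ∫ ω, sqNorm (Z ω) ∂μ := by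
  simp only [sqNorm]
  rw [integral_finsetSum _ fun i _ => (hZ.eval i).integrable_sq]
  refine Finset.sum_le_sum fun i _ => ?_
  rw [diag_apply, covMatrix, of_apply, covariance_self (hZ.eval i).aemeasurable]
  exact variance_le_expectation_sq (hZ.eval i).1

end Rank

lemma sqNorm_sub_comm {d : ℕ} (v w : Fin d → ℝ) : sqNorm (v - w) = sqNorm (w - v) := by
  refine Finset.sum_congr rfl fun i _ => ?_
  simp only [Pi.sub_apply]
  ring

lemma sqNorm_nonneg {d : ℕ} (v : Fin d → ℝ) : 0 ≤ sqNorm v :=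
  Finset.sum_nonneg fun _ _ => sq_nonneg _

section LowRank

variable {Ω : Type*} [MeasurableSpace Ω] {μ : Measure Ω} {d₁ d₂ p s : ℕ}
  {X₁ : Ω → Fin d₁ → ℝ} {X₂ : Ω → Fin d₂ → ℝ} {L : Ω → Fin (p + 1)}
  {ψ : (Fin d₁ → ℝ) → Fin d₂ → ℝ} {m : (Fin d₁ → ℝ) → Fin p → ℝ}
  {Ct : Matrix (Fin d₂) (Fin p) ℝ} {B : Matrix (Fin d₂) (Fin s) ℝ}
  {g : (Fin d₁ → ℝ) → Matrix (Fin s) (Fin p) ℝ}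

lemma measurable_lowRank_comp (hm : Measurable m) (hg : ∀ i j, Measurable fun x => g x i j) :
    Measurable fun x => (Ct + B * g x) *ᵥ m x := by
  refine measurable_pi_iff.2 fun i => ?_
  simp only [mulVec, dotProduct, Matrix.add_apply, Matrix.mul_apply]
  fun_prop

lemma minLowRankError_ne_top [IsProbabilityMeasure μ] (hP : IsPopulation μ X₁ X₂ L ψ m) :
    minLowRankError s μ X₁ ψ m Ct ≠ ∞ := by
  refine ne_top_of_le_ne_top ?_ (iInf_le_of_le (0 : Matrix (Fin d₂) (Fin s) ℝ)
    (iInf_le_of_le (fun _ => 0) (iInf_le _ fun _ _ => measurable_const)))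
  have hm : ∀ i, MemLp (fun ω => (ψ (X₁ ω) - lowRank X₁ m Ct (0 : Matrix (Fin d₂) (Fin s) ℝ)
      (fun _ => 0) ω) i) 2 μ := fun i => by
    simp only [lowRank, Matrix.mul_zero, add_zero, Pi.sub_apply, mulVec, dotProduct]
    exact (hP.memLp_ψ.eval i).sub (memLp_finsetSum _ fun j _ => (hP.memLp_m.eval j).const_mul _)
  have hi : Integrable (fun ω => sqNorm (ψ (X₁ ω) -
      lowRank X₁ m Ct (0 : Matrix (Fin d₂) (Fin s) ℝ) (fun _ => 0) ω)) μ :=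
    integrable_finsetSum _ fun i _ => (hm i).integrable_sq
  rw [lowRankError, ← ofReal_integral_eq_lintegral_ofReal hi (ae_of_all _ fun _ => sqNorm_nonneg _)]
  exact ENNReal.ofReal_ne_top

/-- A best low-rank approximation differs from `ψ(X₁)` by a square-integrable vector. -/
lemma IsLowRankMinimizer.memLp_sub [IsProbabilityMeasure μ] (hP : IsPopulation μ X₁ X₂ L ψ m)
    (h : IsLowRankMinimizer μ X₁ ψ m Ct B g) :
    MemLp (fun ω => lowRank X₁ m Ct B g ω - ψ (X₁ ω)) 2 μ := by
  have hmeas : AEMeasurable (fun ω => lowRank X₁ m Ct B g ω - ψ (X₁ ω)) μ :=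
    ((measurable_lowRank_comp hP.isRegression_m.1 h.1).comp hP.measurable_X₁).aemeasurable.sub
      (hP.isRegression_ψ.1.comp hP.measurable_X₁).aemeasurable
  have hfin : lowRankError μ X₁ ψ m Ct B g ≠ ∞ := h.2 ▸ minLowRankError_ne_top hP
  refine MemLp.of_eval fun i => (memLp_two_iff_integrable_sq
    ((measurable_pi_apply i).comp_aemeasurable hmeas).aestronglyMeasurable).2
    ⟨(((measurable_pi_apply i).comp_aemeasurable hmeas).pow_const 2).aestronglyMeasurable, ?_⟩
  rw [hasFiniteIntegral_iff_ofReal (ae_of_all _ fun _ => sq_nonneg _)]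
  refine lt_of_le_of_lt (lintegral_mono fun ω => ENNReal.ofReal_le_ofReal ?_) hfin.lt_top
  rw [sqNorm_sub_comm]
  exact Finset.single_le_sum (f := fun i => (lowRank X₁ m Ct B g ω - ψ (X₁ ω)) i ^ 2)
    (fun _ _ => sq_nonneg _) (Finset.mem_univ i)

lemma IsLowRankMinimizer.integral_sqNorm [IsProbabilityMeasure μ]
    (hP : IsPopulation μ X₁ X₂ L ψ m) (h : IsLowRankMinimizer μ X₁ ψ m Ct B g) (hd : 0 < d₂) :
    ∫ ω, sqNorm (lowRank X₁ m Ct B g ω - ψ (X₁ ω)) ∂μ = d₂ * epsLevel s μ X₁ ψ m Ct := by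
  have hi : Integrable (fun ω => sqNorm (lowRank X₁ m Ct B g ω - ψ (X₁ ω))) μ :=
    integrable_finsetSum _ fun i _ => ((h.memLp_sub hP).eval i).integrable_sq
  rw [epsLevel, ← h.2, lowRankError, integral_eq_lintegral_of_nonneg_ae
    (ae_of_all _ fun _ => sqNorm_nonneg _) hi.1]
  simp only [sqNorm_sub_comm (ψ _)]
  field_simp

lemma epsLevel_nonneg : 0 ≤ epsLevel s μ X₁ ψ m Ct := by
  unfold epsLevel
  positivity

lemma IsLowRankMinimizer.rank_covMatrix_le [IsProbabilityMeasure μ]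
    (hP : IsPopulation μ X₁ X₂ L ψ m) (h : IsLowRankMinimizer μ X₁ ψ m Ct B g) :
    (covMatrix μ (lowRank X₁ m Ct B g)).rank ≤ p + s := by
  have hL2 : MemLp (lowRank X₁ m Ct B g) 2 μ := by
    refine ((h.memLp_sub hP).add hP.memLp_ψ).ae_eq (ae_of_all _ fun ω => ?_)
    simp
  refine (rank_covMatrix_le_card hL2 (fromCols Ct B)
    (fun ω => Sum.elim (m (X₁ ω)) (g (X₁ ω) *ᵥ m (X₁ ω))) fun ω => ?_).trans (by simp)
  rw [fromCols_mulVec_sumElim, lowRank, add_mulVec, mulVec_mulVec]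

/-- A perfect low-rank approximation coincides with `ψ(X₁)`, whose covariance then has low rank. -/
lemma IsLowRankMinimizer.rank_covMatrix_le_of_eps_eq_zero [IsProbabilityMeasure μ]
    (hP : IsPopulation μ X₁ X₂ L ψ m) (h : IsLowRankMinimizer μ X₁ ψ m Ct B g) (hd : 0 < d₂)
    (hε : epsLevel s μ X₁ ψ m Ct = 0) : (covMatrix μ fun ω => ψ (X₁ ω)).rank ≤ p + s := by
  have hi : Integrable (fun ω => sqNorm (lowRank X₁ m Ct B g ω - ψ (X₁ ω))) μ :=
    integrable_finsetSum _ fun i _ => ((h.memLp_sub hP).eval i).integrable_sq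
  have h0 := h.integral_sqNorm hP hd
  rw [hε, mul_zero, integral_eq_zero_iff_of_nonneg (fun _ => sqNorm_nonneg _) hi] at h0
  have hae : ∀ᵐ ω ∂μ, lowRank X₁ m Ct B g ω = ψ (X₁ ω) := by
    filter_upwards [h0] with ω hω
    have hω' : sqNorm (lowRank X₁ m Ct B g ω - ψ (X₁ ω)) = 0 := hω
    rw [sqNorm_eq_dotProduct, dotProduct_self_eq_zero] at hω'
    exact sub_eq_zero.1 hω'
  have hcov : covMatrix μ (fun ω => ψ (X₁ ω)) = covMatrix μ (lowRank X₁ m Ct B g) := by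
    ext i j
    have e : ∀ k, ∫ ω, ψ (X₁ ω) k ∂μ = ∫ ω, lowRank X₁ m Ct B g ω k ∂μ := fun k =>
      integral_congr_ae (hae.mono fun ω hω => by simp only [hω])
    simp only [covMatrix, of_apply, covariance, e]
    exact integral_congr_ae (hae.mono fun ω hω => by simp only [hω])
  rw [hcov]
  exact h.rank_covMatrix_le hP

end LowRank

/-! ### The excess risk bound -/

section Risk

variable {Ω : Type*} [MeasurableSpace Ω] {μ : Measure Ω} {d r : ℕ} {Z W : Ω → Fin d → ℝ}

lemma EigenFrame.lambdaMinNeZero_le (F : EigenFrame μ Z r) (k : Fin r) :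
    lambdaMinNeZero (covMatrix μ Z) ≤ F.l k :=
  csInf_le ((Matrix.finite_real_spectrum (A := covMatrix μ Z)).subset Set.sdiff_subset).bddBelow
    ⟨F.l_mem k, (F.l_pos k).ne'⟩

variable [IsProbabilityMeasure μ]

/-- In the directions whitened by the covariance matrix of `Z`, the variance of another vector `W`
is controlled by the ratio of its largest eigenvalue to the smallest nonzero one of `Z`. -/
lemma EigenFrame.integral_lift_dotProduct_sq_le (F : EigenFrame μ Z r) (hZ : MemLp Z 2 μ)
    (hW : MemLp W 2 μ) (hr : 0 < r) {M : ℝ} (hM : lambdaMax (covMatrix μ W) ≤ M) (hM0 : 0 ≤ M)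
    (u : Fin r → ℝ) : ∫ ω, (F.lift u ⬝ᵥ centre μ W ω) ^ 2 ∂μ ≤
      M / lambdaMinNeZero (covMatrix μ Z) * (u ⬝ᵥ u) := by
  have hpos := lambdaMinNeZero_covMatrix_pos hZ F hr
  rw [integral_dotProduct_centre_sq hW]
  calc _ ≤ lambdaMax (covMatrix μ W) * (F.lift u ⬝ᵥ F.lift u) :=
        dotProduct_mulVec_le_lambdaMax (covMatrix_isHermitian μ W) _
    _ ≤ M * ((u ⬝ᵥ u) / lambdaMinNeZero (covMatrix μ Z)) :=
        mul_le_mul hM (F.lift_dotProduct_lift_le hpos F.lambdaMinNeZero_le u)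
          (dotProduct_self_nonneg' _) hM0
    _ = _ := by ring

/-- The variance of a sum is at most twice the sum of the variances. -/
lemma EigenFrame.integral_lift_dotProduct_add_sq_le (F : EigenFrame μ Z r) (hZ : MemLp Z 2 μ)
    (hW : MemLp W 2 μ) (u : Fin r → ℝ) :
    ∫ ω, (F.lift u ⬝ᵥ centre μ (fun ω => Z ω + W ω) ω) ^ 2 ∂μ ≤
      2 * (u ⬝ᵥ u) + 2 * ∫ ω, (F.lift u ⬝ᵥ centre μ W ω) ^ 2 ∂μ := by
  have hZs := (memLp_dotProduct_centre hZ (F.lift u)).integrable_sq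
  have hWs := (memLp_dotProduct_centre hW (F.lift u)).integrable_sq
  have hvar : ∫ ω, (F.lift u ⬝ᵥ centre μ Z ω) ^ 2 ∂μ = u ⬝ᵥ u := by
    simp only [F.lift_dotProduct]
    exact F.integral_dotProduct_coord_sq hZ u
  have hc : ∀ ω, centre μ (fun ω => Z ω + W ω) ω = centre μ Z ω + centre μ W ω := fun ω => by
    simp only [centre]
    rw [integral_add (hZ.integrable (by norm_num)) (hW.integrable (by norm_num))]
    abel
  rw [← hvar, ← integral_const_mul, ← integral_const_mul,
    ← integral_add (hZs.const_mul 2) (hWs.const_mul 2)]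
  refine integral_mono_of_nonneg (ae_of_all _ fun _ => sq_nonneg _)
    ((hZs.const_mul 2).add (hWs.const_mul 2)) (ae_of_all _ fun ω => ?_)
  simp only [hc, dotProduct_add]
  nlinarith [sq_nonneg (F.lift u ⬝ᵥ centre μ Z ω - F.lift u ⬝ᵥ centre μ W ω)]

lemma estimation_error_bound_le {n ℓ κ ε q D σ x y : ℝ} (hn : 0 ≤ n) (hκ : 0 ≤ κ) (hε : 0 ≤ ε)
    (hq : 0 ≤ q) (hD : 0 ≤ D) :
    64 / n * (115200 * ℓ ^ 4) * (2 * κ * (1 + ε) * (q * (σ ^ 2 + (x * σ) ^ 2)) +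
        κ * ε * (D * (σ ^ 2 + (y * σ) ^ 2))) ≤
      64 * 115200 * 2 * κ * (1 + x ^ 2 + y ^ 2) * ℓ ^ 4 *
        ((1 + ε) * (q / n) * σ ^ 2 + ε * (D / n) * σ ^ 2) := by
  have hx := sq_nonneg x
  have hy := sq_nonneg y
  calc _ = 64 * 115200 * κ * ℓ ^ 4 / n * σ ^ 2 * (2 * ((1 + ε) * q * (1 + x ^ 2)) +
        1 * (ε * D * (1 + y ^ 2))) := by ring
    _ ≤ 64 * 115200 * κ * ℓ ^ 4 / n * σ ^ 2 * (2 * ((1 + ε) * q * (1 + x ^ 2 + y ^ 2)) +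
        2 * (ε * D * (1 + x ^ 2 + y ^ 2))) := by
        refine mul_le_mul_of_nonneg_left (add_le_add ?_ ?_) (by positivity)
        · exact mul_le_mul_of_nonneg_left
            (mul_le_mul_of_nonneg_left (by linarith) (by positivity)) (by norm_num)
        · exact mul_le_mul (by norm_num)
            (mul_le_mul_of_nonneg_left (by linarith) (by positivity)) (by positivity) (by norm_num)
    _ = _ := by ring

/-- The excess risk bound, under a lower bound for the sample size in terms of the rank of the
covariance of the representation. The factor `κ` comes from `λ_max(Σ̄) ≤ c₂ ε`: relative to the
variance of `X`, that of `X̄` is at most `κ ε` and that of `X̃` at most `2 κ (1 + ε)`. -/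
lemma measure_exists_ols_excess_risk_gt_le {d₁ d₂ p s n : ℕ} (hpd : p < d₂) (hn0 : 0 < n)
    {X₁ : Ω → Fin d₁ → ℝ} {X₂ : Ω → Fin d₂ → ℝ} {L : Ω → Fin (p + 1)}
    {ψ : (Fin d₁ → ℝ) → Fin d₂ → ℝ} {m : (Fin d₁ → ℝ) → Fin p → ℝ}
    (hP : IsPopulation μ X₁ X₂ L ψ m) {Ct : Matrix (Fin d₂) (Fin p) ℝ}
    {B : Matrix (Fin d₂) (Fin s) ℝ} {g : (Fin d₁ → ℝ) → Matrix (Fin s) (Fin p) ℝ}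
    (hB : IsLowRankMinimizer μ X₁ ψ m Ct B g) {ε : ℝ} (hε : ε = epsLevel s μ X₁ ψ m Ct)
    {y₀ : Fin p → ℝ} {βs : Matrix (Fin p) (Fin d₂) ℝ}
    (hβs : ∀ β, errApx μ X₁ ψ m y₀ βs ≤ errApx μ X₁ ψ m y₀ β) {σ ρ : ℝ≥0} (hσ : 0 < σ)
    {bt bb c₂ : ℝ} (hbt : 0 ≤ bt) (hbb : 0 ≤ bb) (hc₂ : 0 ≤ c₂)
    (hsub : SubGaussianAssumption μ X₁ L m (lowRank X₁ m Ct B g)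
      (fun ω => lowRank X₁ m Ct B g ω - ψ (X₁ ω)) σ ρ)
    (hbd : BoundedAssumption s μ (lowRank X₁ m Ct B g)
      (fun ω => lowRank X₁ m Ct B g ω - ψ (X₁ ω)) (residual μ X₁ ψ m y₀ βs) bt bb)
    (heig : lambdaMax (covMatrix μ fun ω => lowRank X₁ m Ct B g ω - ψ (X₁ ω)) ≤
      c₂ * (1 / (d₂ : ℝ)) * (covMatrix μ fun ω => lowRank X₁ m Ct B g ω - ψ (X₁ ω)).trace)
    {x : Fin n → Ω → Fin d₁ → ℝ} {l : Fin n → Ω → Fin (p + 1)}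
    (hS : IsLabelledSample μ X₁ L x l) {δ κ : ℝ} (hδ : 0 < δ) (hδ1 : δ < 1)
    (hκ : κ = 1 + c₂ / lambdaMinNeZero (covMatrix μ fun ω => ψ (X₁ ω)))
    (hn : 2 ^ 19 * 36 * κ ^ 2 * (1 + ε) ^ 2 * (ρ : ℝ) ^ 4 *
      ((covMatrix μ fun ω => ψ (X₁ ω)).rank + Real.log (1 / δ)) ≤ n) :
    μ {ω | ∃ β, IsOLS μ X₁ ψ y₀ (fun i => x i ω) (fun i => l i ω) β ∧
        ¬ (errApx μ X₁ ψ m y₀ β ≤ errApxMin μ X₁ ψ m y₀ +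
          64 * 115200 * 2 * κ * (1 + (bt / σ) ^ 2 + (bb / σ) ^ 2) *
            (1 + Real.log (n * d₂ / δ)) ^ 4 *
            ((1 + ε) * ((p + s) / n) * (σ : ℝ) ^ 2 + ε * (d₂ / n) * (σ : ℝ) ^ 2))}
      ≤ ENNReal.ofReal δ := by
  have hd : 0 < d₂ := by omega
  have hd' : (0 : ℝ) < d₂ := by exact_mod_cast hd
  have hn' : (0 : ℝ) < n := by exact_mod_cast hn0
  have hε0 : 0 ≤ ε := hε ▸ epsLevel_nonneg
  have hψ2 := hP.memLp_ψ
  have hb2 := hB.memLp_sub hP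
  obtain ⟨F⟩ := nonempty_eigenFrame hψ2
  set r := (covMatrix μ fun ω => ψ (X₁ ω)).rank
  set lam := lambdaMinNeZero (covMatrix μ fun ω => ψ (X₁ ω))
  set ℓ := 1 + Real.log (n * d₂ / δ) with hℓ
  have hlam0 : 0 ≤ lam := by
    refine Real.sInf_nonneg ?_
    rintro y ⟨hy, -⟩
    rw [(covMatrix_isHermitian μ fun ω => ψ (X₁ ω)).spectrum_real_eq_range_eigenvalues] at hy
    obtain ⟨i, rfl⟩ := hy
    exact eigenvalues_covMatrix_nonneg hψ2 i
  have hκ1 : 1 ≤ κ := by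
    rw [hκ]
    have : 0 ≤ c₂ / lam := by positivity
    linarith
  simp only [errApx_eq_errApxMin_add hP y₀ hβs, not_le, add_lt_add_iff_left]
  rcases Nat.eq_zero_or_pos r with h0 | h0
  · -- a constant representation leaves nothing to estimate
    have hc0 : ∀ᵐ ω ∂μ, centre μ (fun ω => ψ (X₁ ω)) ω = 0 := by
      have : IsEmpty (Fin r) := by rw [h0]; infer_instance
      filter_upwards [F.expand] with ω h
      rw [h, Finset.univ_eq_empty, Finset.sum_empty]
    have hz : ∀ β : Matrix (Fin p) (Fin d₂) ℝ,
        ∫ ω, sqNorm ((β - βs) *ᵥ centre μ (fun ω => ψ (X₁ ω)) ω) ∂μ = 0 := fun β => by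
      refine (integral_congr_ae (hc0.mono fun ω h => ?_)).trans (integral_zero _ _)
      simp only [h, mulVec_zero]
      simp [sqNorm]
    refine (measure_mono_null ?_ measure_empty).le.trans zero_le
    rintro ω ⟨β, -, h⟩
    rw [hz] at h
    exact absurd h (not_lt.2 (by positivity))
  let φ : (Fin d₁ → ℝ) → Fin d₂ → ℝ := fun x => (Ct + B * g x) *ᵥ m x
  have hφ : Measurable φ := measurable_lowRank_comp hP.isRegression_m.1 hB.1
  have hφ2 : MemLp (fun ω => φ (X₁ ω)) 2 μ := by
    refine (hψ2.add hb2).ae_eq (ae_of_all _ fun ω => ?_)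
    simp [φ, lowRank]
  have hrt : (covMatrix μ fun ω => φ (X₁ ω)).rank ≤ p + s := hB.rank_covMatrix_le hP
  obtain ⟨Ft⟩ := nonempty_eigenFrame hφ2
  obtain ⟨Fb⟩ := nonempty_eigenFrame hb2
  have hrtd : (covMatrix μ fun ω => φ (X₁ ω)).rank ≤ d₂ := Matrix.rank_le_height _
  have hrbd : (covMatrix μ fun ω => lowRank X₁ m Ct B g ω - ψ (X₁ ω)).rank ≤ d₂ :=
    Matrix.rank_le_height _
  have hmax : lambdaMax (covMatrix μ fun ω => lowRank X₁ m Ct B g ω - ψ (X₁ ω)) ≤ c₂ * ε := by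
    refine heig.trans ?_
    have h := trace_covMatrix_le hb2
    rw [hB.integral_sqNorm hP hd, ← hε] at h
    calc _ ≤ c₂ * (1 / (d₂ : ℝ)) * (d₂ * ε) := by gcongr
      _ = c₂ * ε := by field_simp
  have hvarb : ∀ u, ∫ ω, (F.lift u ⬝ᵥ
      centre μ (fun ω => lowRank X₁ m Ct B g ω - ψ (X₁ ω)) ω) ^ 2 ∂μ ≤
      c₂ / lam * ε * (u ⬝ᵥ u) := fun u =>
    (F.integral_lift_dotProduct_sq_le hψ2 hb2 h0 hmax (by positivity) u).trans
      (le_of_eq (by ring))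
  have hvart : ∀ u, ∫ ω, (F.lift u ⬝ᵥ centre μ (fun ω => φ (X₁ ω)) ω) ^ 2 ∂μ ≤
      2 * (u ⬝ᵥ u) + 2 * (c₂ / lam * ε * (u ⬝ᵥ u)) := fun u => by
    have h := F.integral_lift_dotProduct_add_sq_le hψ2 hb2 u
    simp only [add_sub_cancel] at h
    exact h.trans (by gcongr; exact hvarb u)
  lift κ to ℝ≥0 using (by linarith)
  lift ε to ℝ≥0 using hε0
  have hcl : 0 ≤ c₂ / lam := by positivity
  have hmain := measure_exists_ols_error_gt_le hP hφ hφ2 F Ft Fb hβs (σ2 := σ ^ 2)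
    (ρ2 := ρ ^ 2) (v := 6 * κ * (1 + ε) * ρ ^ 2) (pow_pos hσ 2) hsub.noise hsub.whiten_tilde
    hsub.whiten_bar (K₁ := 2 * κ * (1 + ε)) (K₂ := κ * ε)
    (fun u => (hvart u).trans (by
      have hu := dotProduct_self_nonneg' u
      push_cast
      rw [hκ]
      have h1 := mul_nonneg hcl hu
      have h2 := mul_nonneg ε.2 hu
      nlinarith [h1, h2]))
    (fun u => (hvarb u).trans (by
      have hu := dotProduct_self_nonneg' u
      push_cast
      rw [hκ]
      have h2 := mul_nonneg ε.2 hu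
      nlinarith [h2]))
    (by
      rw [← NNReal.coe_le_coe]
      push_cast
      have h1 : (0 : ℝ) ≤ κ * ρ ^ 2 := by positivity
      nlinarith [h1])
    (by
      rw [← NNReal.coe_le_coe]
      push_cast
      have h1 : (1 : ℝ) ≤ 6 * κ * (1 + ε) := by nlinarith [mul_nonneg κ.2 ε.2]
      exact le_mul_of_one_le_left (by positivity) h1)
    hbt hbb (mt := p + s) (mb := d₂) (by exact_mod_cast hrt) (by exact_mod_cast hrbd) hbd.tilde
    hbd.bar hS hδ hδ1 h0 hpd.le hd hrtd hrbd hn0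
    (by push_cast; exact le_trans (le_of_eq (by ring)) hn) hℓ
  refine (measure_mono ?_).trans hmain
  rintro ω ⟨β, h1, h2⟩
  refine ⟨β, h1, lt_of_le_of_lt ?_ h2⟩
  push_cast
  set x := bt / (σ : ℝ) with hx
  set y := bb / (σ : ℝ) with hy
  have ex : bt = x * σ := by rw [hx]; field_simp
  have ey : bb = y * σ := by rw [hy]; field_simp
  rw [ex, ey]
  exact estimation_error_bound_le hn'.le κ.2 ε.2 (by positivity) hd'.le

end Risk

end SSL

theorem theorem1 :
    ∃ (k : ℕ) (C₀ : ℝ → ℝ → ℝ → ℝ) (C₁ : ℝ → ℝ → ℝ → ℝ → ℝ → ℝ),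
    ∀ {Ω : Type*} [MeasurableSpace Ω] (μ : Measure Ω) [IsProbabilityMeasure μ]
      {d₁ d₂ p s n : ℕ} (_ : p < d₂) (_ : p + s ≤ d₂) (_ : 0 < n)
      -- the population
      (X₁ : Ω → Fin d₁ → ℝ) (X₂ : Ω → Fin d₂ → ℝ) (L : Ω → Fin (p + 1))
      (ψ : (Fin d₁ → ℝ) → Fin d₂ → ℝ) (m : (Fin d₁ → ℝ) → Fin p → ℝ)
      (_ : SSL.IsPopulation μ X₁ X₂ L ψ m)
      -- the encoding function, and a best low-rank approximation
      (Ch : (Fin d₁ → ℝ) → Matrix (Fin d₂) (Fin p) ℝ) (_ : SSL.IsEncoding μ X₁ ψ m Ch)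
      (Ct : Matrix (Fin d₂) (Fin p) ℝ) (_ : Ct = SSL.meanEncoding μ X₁ Ch)
      (B : Matrix (Fin d₂) (Fin s) ℝ) (g : (Fin d₁ → ℝ) → Matrix (Fin s) (Fin p) ℝ)
      (_ : SSL.IsLowRankMinimizer μ X₁ ψ m Ct B g)
      (ε : ℝ) (_ : ε = SSL.epsLevel s μ X₁ ψ m Ct)
      (Xt Xb : Ω → Fin d₂ → ℝ) (_ : Xt = SSL.lowRank X₁ m Ct B g)
      (_ : Xb = fun ω => Xt ω - ψ (X₁ ω))
      (S St Sb : Matrix (Fin d₂) (Fin d₂) ℝ) (_ : S = SSL.covMatrix μ (fun ω => ψ (X₁ ω)))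
      (_ : St = SSL.covMatrix μ Xt) (_ : Sb = SSL.covMatrix μ Xb)
      -- the true parameter of the downstream task
      (y₀ : Fin p → ℝ) (βs : Matrix (Fin p) (Fin d₂) ℝ)
      (_ : ∀ β, SSL.errApx μ X₁ ψ m y₀ βs ≤ SSL.errApx μ X₁ ψ m y₀ β)
      -- the assumptions
      (σ ρ : ℝ≥0) (_ : 0 < σ) (bt bb c₁ c₂ : ℝ) (_ : 0 ≤ bt) (_ : 0 ≤ bb) (_ : 0 ≤ c₁) (_ : 0 ≤ c₂)
      (_ : SSL.SubGaussianAssumption μ X₁ L m Xt Xb σ ρ)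
      (_ : SSL.BoundedAssumption s μ Xt Xb (SSL.residual μ X₁ ψ m y₀ βs) bt bb)
      (_ : SSL.EigenvalueAssumption S St Sb c₁ c₂)
      (_ : SSL.RankAssumption S St Sb)
      -- the labelled sample
      (x : Fin n → Ω → Fin d₁ → ℝ) (l : Fin n → Ω → Fin (p + 1))
      (_ : SSL.IsLabelledSample μ X₁ L x l)
      (δ : ℝ) (_ : 0 < δ) (_ : δ < 1),
    (C₀ c₁ c₂ (SSL.lambdaMinNeZero S) * (1 + ε) ^ 2 * (ρ : ℝ) ^ 4 * (d₂ + Real.log (1 / δ)) ≤ n →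
      μ {ω | ∃ β, SSL.IsOLS μ X₁ ψ y₀ (fun i => x i ω) (fun i => l i ω) β ∧
          ¬ (SSL.errApx μ X₁ ψ m y₀ β ≤ SSL.errApxMin μ X₁ ψ m y₀ +
            C₁ c₁ c₂ (SSL.lambdaMinNeZero S) (bt / σ) (bb / σ) *
              (1 + Real.log (n * d₂ / δ)) ^ k *
              ((1 + ε) * ((p + s) / n) * (σ : ℝ) ^ 2 + ε * (d₂ / n) * (σ : ℝ) ^ 2))}
        ≤ ENNReal.ofReal δ) ∧
    (ε = 0 →
      C₀ c₁ c₂ (SSL.lambdaMinNeZero S) * (ρ : ℝ) ^ 4 * (p + s + Real.log (1 / δ)) ≤ n →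
      μ {ω | ∃ β, SSL.IsOLS μ X₁ ψ y₀ (fun i => x i ω) (fun i => l i ω) β ∧
          ¬ (SSL.errApx μ X₁ ψ m y₀ β ≤ SSL.errApxMin μ X₁ ψ m y₀ +
            C₁ c₁ c₂ (SSL.lambdaMinNeZero S) (bt / σ) (bb / σ) *
              (1 + Real.log (n * d₂ / δ)) ^ k *
              ((p + s) / n * (σ : ℝ) ^ 2))}
        ≤ ENNReal.ofReal δ) := by
  refine ⟨4, fun _ c₂ lam => 2 ^ 19 * 36 * (1 + c₂ / lam) ^ 2,
    fun _ c₂ lam x y => 64 * 115200 * 2 * (1 + c₂ / lam) * (1 + x ^ 2 + y ^ 2), ?_⟩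
  intro Ω _ μ _ d₁ d₂ p s n hpd _ hn0 X₁ X₂ L ψ m hP Ch _ Ct _ B g hB ε hε Xt Xb hXt hXb S St Sb
    hS _ hSb y₀ βs hβs σ ρ hσ bt bb c₁ c₂ hbt hbb _ hc₂ hsub hbd heig _ x l hxl δ hδ hδ1
  subst hXt hXb hS hSb
  have hbound := fun hn => SSL.measure_exists_ols_excess_risk_gt_le hpd hn0 hP hB hε hβs hσ hbt hbb
    hc₂ hsub hbd heig.bar hxl hδ hδ1 rfl hn
  -- the rank of `Σ` is at most `d₂`, and at most `p + s` if `ε = 0`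
  refine ⟨fun hn => hbound (le_trans ?_ hn), fun h0 hn => ?_⟩
  · have hr : ((SSL.covMatrix μ fun ω => ψ (X₁ ω)).rank : ℝ) ≤ d₂ := by
      exact_mod_cast Matrix.rank_le_height _
    gcongr
  · have hr : ((SSL.covMatrix μ fun ω => ψ (X₁ ω)).rank : ℝ) ≤ p + s := by
      exact_mod_cast hB.rank_covMatrix_le_of_eps_eq_zero hP (by omega) (hε.symm.trans h0)
    rw [h0] at hbound
    simp only [add_zero, one_pow, mul_one, one_mul, zero_mul] at hbound
    refine hbound (le_trans ?_ hn)
    gcongr
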